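/- Let $M$ be a $C^\infty$ manifold (finite-dimensional, without boundary, Hausdorff and second countable). A $C^0$ (i.e. continuous) vector field on $M$ is called uniquely integrable if through every point of $M$ it has a unique maximal integral curve. A compact set $A\subset M$ is asymptotically stable for such a vector field if $A$ is invariant (maximal integral curves starting in $A$ stay in $A$ for all times, positive and negative) and for every open set $W\supset A$ there is an open set $V\supset A$ such that all maximal forward integral curves starting in $V$ are defined for all positive time, are contained in $W$, and converge to $A$ (i.e. are eventually in every neighbourhood of $A$). The basin of attraction of $A$ is the set of all initial conditions whose maximal integral curves are defined for all positive time and converge to $A$. Theorem. Let $X$, $Y$ be uniquely integrable $C^0$ vector fields on $M$, and let $A\subset M$ be a compact set that is asymptotically stable for both. Then there is an open set $U\supset A$ such that $X|_{U\setminus A}$ and $Y|_{U\setminus A}$ are homotopic through nowhere-zero vector fields, i.e. there is a continuous map $H\colon [0,1]\times (U\setminus A)\to TM$ with $0\neq H(t,m)\in T_mM$, $H(0,m)=X(m)$ and $H(1,m)=Y(m)$ for all $t\in[0,1]$ and $m\in U\setminus A$. Moreover, if $B_X$, $B_Y$ denote the basins of attraction of $A$ for $X$, $Y$, then one can take for $U$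 the largest subset of $B_X\cap B_Y$ such that all forward $X$-orbits with initial condition in $U$ are contained in $B_Y$; equivalently, $U$ is the basin of attraction of $A$ for the restricted vector field $X|_{B_Y}$. -/

import Mathlib

open Set Filter Topology
open scoped Manifold ContDiff

/-- The vector field `X` on the manifold `M` is continuous, i.e. it is a `C^0` section of the
tangent bundle. -/
def IsC0VectorField {n : ℕ} {M : Type*} [TopologicalSpace M]
    [ChartedSpace (EuclideanSpace ℝ (Fin n)) M] [IsManifold (𝓡 n) ∞ M]
    (X : (x : M) → TangentSpace (𝓡 n) x) : Prop :=
  Continuous (fun x : M => (⟨x, X x⟩ : TangentBundle (𝓡 n) M))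

/-- `γ`, considered on the set of times `J`, is an integral curve of the restriction `X|_D`, starting
at `x` at time `0`: `J` is an open interval containing `0`, `γ 0 = x`, `γ` stays in `D` on `J` and
`γ' = X ∘ γ` on `J`. The values of `γ` outside `J` are irrelevant. -/
structure IsIntegralCurveFrom {n : ℕ} {M : Type*} [TopologicalSpace M]
    [ChartedSpace (EuclideanSpace ℝ (Fin n)) M]
    (X : (x : M) → TangentSpace (𝓡 n) x) (D : Set M) (x : M) (J : Set ℝ) (γ : ℝ → M) : Prop where
  isOpen : IsOpen J
  ordConnected : J.OrdConnected
  zero_mem : (0 : ℝ) ∈ J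
  start : γ 0 = x
  mapsTo : MapsTo γ J D
  isMIntegralCurveOn : IsMIntegralCurveOn γ X J

/-- `γ` on `J` is a maximal integral curve of `X|_D` starting at `x`: it has no extension to an
integral curve of `X|_D` on a strictly larger open interval. -/
def IsMaximalIntegralCurveFrom {n : ℕ} {M : Type*} [TopologicalSpace M]
    [ChartedSpace (EuclideanSpace ℝ (Fin n)) M]
    (X : (x : M) → TangentSpace (𝓡 n) x) (D : Set M) (x : M) (J : Set ℝ) (γ : ℝ → M) : Prop :=
  IsIntegralCurveFrom X D x J γ ∧
    ∀ (J' : Set ℝ) (γ' : ℝ → M), IsIntegralCurveFrom X D x J' γ' → J ⊆ J' → EqOn γ' γ J → J' = J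

/-- `X` has unique maximal integral curves: through every point there is one and only one. -/
def UniquelyIntegrable {n : ℕ} {M : Type*} [TopologicalSpace M]
    [ChartedSpace (EuclideanSpace ℝ (Fin n)) M]
    (X : (x : M) → TangentSpace (𝓡 n) x) : Prop :=
  ∀ x : M, (∃ (J : Set ℝ) (γ : ℝ → M), IsMaximalIntegralCurveFrom X univ x J γ) ∧
    ∀ (J₁ J₂ : Set ℝ) (γ₁ γ₂ : ℝ → M), IsMaximalIntegralCurveFrom X univ x J₁ γ₁ →
      IsMaximalIntegralCurveFrom X univ x J₂ γ₂ → J₁ = J₂ ∧ EqOn γ₁ γ₂ J₁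

/-- `A` is invariant: maximal integral curves of `X` starting in `A` stay in `A`, forward and
backward in time, as long as they are defined. -/
def IsInvariantSet {n : ℕ} {M : Type*} [TopologicalSpace M]
    [ChartedSpace (EuclideanSpace ℝ (Fin n)) M]
    (X : (x : M) → TangentSpace (𝓡 n) x) (A : Set M) : Prop :=
  ∀ x ∈ A, ∀ (J : Set ℝ) (γ : ℝ → M), IsMaximalIntegralCurveFrom X univ x J γ →
    ∀ t ∈ J, γ t ∈ A

/-- The compact set `A` is asymptotically stable for the (uniquely integrable) vector field `X`: it
is invariant, and for every open `W ⊇ A` there is an open `V ⊇ A` such that all maximal forward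
integral curves starting in `V` are defined for all positive time, stay in `W`, and converge to `A`,
i.e. eventually enter every neighbourhood of `A`. -/
structure IsAsymptoticallyStable {n : ℕ} {M : Type*} [TopologicalSpace M]
    [ChartedSpace (EuclideanSpace ℝ (Fin n)) M]
    (X : (x : M) → TangentSpace (𝓡 n) x) (A : Set M) : Prop where
  isCompact : IsCompact A
  invariant : IsInvariantSet X A
  stable : ∀ W : Set M, IsOpen W → A ⊆ W → ∃ V : Set M, IsOpen V ∧ A ⊆ V ∧
    ∀ x ∈ V, ∀ (J : Set ℝ) (γ : ℝ → M), IsMaximalIntegralCurveFrom X univ x J γ →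
      Ici 0 ⊆ J ∧ (∀ t, 0 ≤ t → γ t ∈ W) ∧ Tendsto γ atTop (𝓝ˢ A)

/-- The basin of attraction of `A` for the restriction `X|_D`: the initial conditions whose maximal
integral curve for `X|_D` is defined for all positive time and converges to `A`. -/
def basin {n : ℕ} {M : Type*} [TopologicalSpace M]
    [ChartedSpace (EuclideanSpace ℝ (Fin n)) M]
    (X : (x : M) → TangentSpace (𝓡 n) x) (D A : Set M) : Set M :=
  {x | ∃ (J : Set ℝ) (γ : ℝ → M), IsMaximalIntegralCurveFrom X D x J γ ∧
    Ici 0 ⊆ J ∧ Tendsto γ atTop (𝓝ˢ A)}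

/-- All forward orbits of `X` with initial condition in `S` are contained in `D`. -/
def ForwardOrbitsIn {n : ℕ} {M : Type*} [TopologicalSpace M]
    [ChartedSpace (EuclideanSpace ℝ (Fin n)) M]
    (X : (x : M) → TangentSpace (𝓡 n) x) (S D : Set M) : Prop :=
  ∀ x ∈ S, ∀ (J : Set ℝ) (γ : ℝ → M), IsMaximalIntegralCurveFrom X univ x J γ →
    ∀ t ∈ J, 0 ≤ t → γ t ∈ D

/-- `X|_S` and `Y|_S` are homotopic through nowhere-zero vector fields: there is a continuous
`H : [0,1] × S → TM` with each `H t` a nowhere-zero vector field on `S`, `H 0 = X|_S` and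
`H 1 = Y|_S`. The values of `H` off `[0,1] × S` are irrelevant. -/
def HomotopicThroughNonvanishing {n : ℕ} {M : Type*} [TopologicalSpace M]
    [ChartedSpace (EuclideanSpace ℝ (Fin n)) M] [IsManifold (𝓡 n) ∞ M]
    (X Y : (x : M) → TangentSpace (𝓡 n) x) (S : Set M) : Prop :=
  ∃ H : ℝ → (x : M) → TangentSpace (𝓡 n) x,
    ContinuousOn (fun p : ℝ × M => (⟨p.2, H p.1 p.2⟩ : TangentBundle (𝓡 n) M)) (Icc 0 1 ×ˢ S) ∧
    (∀ x ∈ S, H 0 x = X x) ∧ (∀ x ∈ S, H 1 x = Y x) ∧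
    ∀ t ∈ Icc (0 : ℝ) 1, ∀ x ∈ S, H t x ≠ 0

/-! Embed `M` by `e` in a Hilbert space, fix `x ∈ U \ A`, and follow the `X`-orbit of `x` to `y = φX
x t`. An orbit outside `A` that converges to `A` is never periodic, so the chord `e y - e x` is
nonzero for `t > 0`. Projected to the tangent space at `x` and divided by `t`, it tends to `X x` as
`t → 0`. Far from `x`, however, the projected chord may vanish. It is therefore replaced by
`displacement`, a vector that depends on the whole forward `Y`-orbit `q s = e (φY y s) - e x` of
`y`; this orbit exists for all positive times and converges to `A` because `y` lies in the basin of
`Y`. If `y` is close to `x`, this vector is the projected chord. If the orbit misses a small ball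
about `x`, it is a positive multiple of `f = Y x`. By stability of `A` for `Y` the second case holds
for all large `t`. Letting `t` run from `0` to a large `T x` leads from `X x` to a positive multiple
of `Y x`, and a linear rescaling ends at `Y x` (`exists_displacement_path`,
`exists_ambient_homotopy`).

The vector does not vanish in between (`displacement_ne_zero`). Since `Y`-orbits do not return to
`x`, all points of one forward orbit in a small ball of radius `r` about `x` lie nearly on one line
parallel to `f` (`exists_straight`). Away from the centre the vector has `f`-coefficient `m - r /
2`, where `m` is the truncated distance of the orbit from `x`, and its part orthogonal to `f` comes
from a weighted integral over the passage through the ball. If `m = r / 2`, the orbit passes `x`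
sideways, so the whole passage lies on one side and the orthogonal part is nonzero. In the zone
where this vector is interpolated with the projected chord, the two have a common half-space.

The fields are only continuous, so continuity of the flow comes from compactness and uniqueness
(`tendsto_apply_of_uniform_time`). The projections, the radii `r` and the times `T` satisfy convex
conditions, so partitions of unity make them continuous in `x`. -/

/-! ### The displacement vector of a nearly straight path -/

section HilbertDisplacement

variable {H : Type*} [NormedAddCommGroup H] [InnerProductSpace ℝ H]

/-- The distance from `0` of the path `q` on `[0, ∞)`, truncated at `r`. -/
noncomputable def truncatedDist (r : ℝ) (q : ℝ → H) : ℝ :=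
  sInf ((fun s => min ‖q s‖ r) '' Ici 0)

/-- The part of the path `q` inside the ball of radius `r`, integrated with a cutoff weight. -/
noncomputable def passageIntegral (r : ℝ) (q : ℝ → H) : H :=
  ∫ s in Ioi (0 : ℝ), max 0 (1 - ‖q s‖ / r) • q s

/-- The displacement vector of a path `q` which crosses the ball of radius `r` nearly parallel
to `f`: it equals `J (q 0)` for small `q 0` and is a positive multiple of `f` if the path avoids the
ball. -/
noncomputable def displacement (J : H →L[ℝ] H) (f : H) (r : ℝ) (q : ℝ → H) : H :=
  (1 - max 0 (min 1 (4 * (‖q 0‖ / r) - 2))) • J (q 0) +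
    max 0 (min 1 (4 * (‖q 0‖ / r) - 2)) •
      (J (passageIntegral r q) - (inner ℝ (J (passageIntegral r q)) f / ‖f‖ ^ 2) • f -
        (r / 2 - truncatedDist r q) • f)

/-- The path `q` runs nearly parallel to `f` inside the ball of radius `r`, where it is almost fixed
by `J`, and finally leaves this ball. -/
structure IsNearlyStraight (J : H →L[ℝ] H) (f : H) (r : ℝ) (q : ℝ → H) : Prop where
  pos : 0 < r
  continuous : Continuous q
  ne_zero : f ≠ 0
  near : ∀ s, 0 ≤ s → ‖q s‖ < r → ‖J (q s) - q s‖ ≤ ‖q s‖ / 100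
  straight : ∀ s₁ s₂, 0 ≤ s₁ → s₁ ≤ s₂ → ‖q s₁‖ < r → ‖q s₂‖ < r →
    ‖q s₂ - q s₁ - (s₂ - s₁) • f‖ ≤ (s₂ - s₁) * ‖f‖ / 100
  escapes : ∃ T, ∀ s, T ≤ s → r ≤ ‖q s‖

/-- In the squared norm the gain `2 * h * r * ‖f‖ / 10` exceeds the error terms, which total less
than `0.123 * h * r * ‖f‖`. Applied to `f` and `-f`, this shows that a path is nearly orthogonal to
`f` where it is closest to `0`. -/
theorem norm_add_smul_add_lt {u f E : H} {h r : ℝ} (hh : 0 < h) (hu : ‖u‖ ≤ r) (hf : f ≠ 0)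
    (hhr : h * ‖f‖ ≤ r / 10) (hE : ‖E‖ ≤ h * ‖f‖ / 100) (hA : inner ℝ u f < -(r * ‖f‖ / 10)) :
    ‖u + h • f + E‖ < ‖u‖ := by
  have hf0 : 0 < ‖f‖ := norm_pos_iff.2 hf
  have h1 : ‖u + (h • f + E)‖ ^ 2 = ‖u‖ ^ 2 + 2 * (h * inner ℝ u f + inner ℝ u E) +
      ‖h • f + E‖ ^ 2 := by
    rw [norm_add_sq_real, inner_add_right, inner_smul_right]
  have h2 : ‖h • f + E‖ ≤ 1.01 * (h * ‖f‖) := by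
    refine (norm_add_le _ _).trans ?_
    rw [norm_smul, Real.norm_of_nonneg hh.le]
    linarith
  have h3 : inner ℝ u E ≤ r * (h * ‖f‖ / 100) :=
    (real_inner_le_norm u E).trans
      (mul_le_mul hu hE (norm_nonneg _) ((norm_nonneg _).trans hu))
  have h4 : 0 < h * ‖f‖ := by positivity
  have h5 : ‖h • f + E‖ ^ 2 ≤ (1.01 * (h * ‖f‖)) * (1.01 * (r / 10)) := by
    rw [sq]
    exact mul_le_mul h2 (h2.trans (by linarith)) (norm_nonneg _) (by positivity)
  have h6 : h * inner ℝ u f < h * -(r * ‖f‖ / 10) := mul_lt_mul_of_pos_left hA hh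
  have hr : 0 < r := by linarith
  have h7 : 0 < r * (h * ‖f‖) := by positivity
  have h8 : ‖u + (h • f + E)‖ ^ 2 < ‖u‖ ^ 2 := by
    rw [h1]
    nlinarith
  rw [add_assoc]
  exact lt_of_pow_lt_pow_left₀ 2 (norm_nonneg _) h8

theorem norm_sq_sub_inner_div_smul (u f : H) (hf : f ≠ 0) :
    ‖u - (inner ℝ u f / ‖f‖ ^ 2) • f‖ ^ 2 = ‖u‖ ^ 2 - inner ℝ u f ^ 2 / ‖f‖ ^ 2 := by
  have hf0 : ‖f‖ ≠ 0 := norm_ne_zero_iff.2 hf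
  rw [norm_sub_sq_real, inner_smul_right, norm_smul, mul_pow, Real.norm_eq_abs, sq_abs]
  field_simp
  ring

theorem inner_sub_inner_div_smul (u f : H) (hf : f ≠ 0) :
    inner ℝ (u - (inner ℝ u f / ‖f‖ ^ 2) • f) f = 0 := by
  have hf0 : ‖f‖ ≠ 0 := norm_ne_zero_iff.2 hf
  rw [inner_sub_left, real_inner_smul_left, real_inner_self_eq_norm_sq]
  field_simp
  ring

namespace IsNearlyStraight

variable {J : H →L[ℝ] H} {f : H} {r : ℝ} {q : ℝ → H}

theorem norm_pos (hq : IsNearlyStraight J f r q) : 0 < ‖f‖ := norm_pos_iff.2 hq.ne_zero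

/-- Both points lie in the ball, so `|s₂ - s₁| * ‖f‖` is hardly more than `2 * r`, and one percent
of it is below `3 * r / 100`. -/
theorem norm_sub_sub_smul_le (hq : IsNearlyStraight J f r q) {s₁ s₂ : ℝ} (h₁ : 0 ≤ s₁)
    (h₂ : 0 ≤ s₂) (hs₁ : ‖q s₁‖ < r) (hs₂ : ‖q s₂‖ < r) :
    ‖q s₂ - q s₁ - (s₂ - s₁) • f‖ ≤ 3 * r / 100 := by
  have key : ∀ a b, 0 ≤ a → a ≤ b → ‖q a‖ < r → ‖q b‖ < r →
      ‖q b - q a - (b - a) • f‖ ≤ 3 * r / 100 := by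
    intro a b ha hab hqa hqb
    have h := hq.straight a b ha hab hqa hqb
    have h3 : ‖(b - a) • f‖ ≤ ‖q b - q a‖ + ‖q b - q a - (b - a) • f‖ := by
      have := norm_sub_le (q b - q a) (q b - q a - (b - a) • f)
      rwa [sub_sub_cancel] at this
    rw [norm_smul, Real.norm_of_nonneg (sub_nonneg.2 hab)] at h3
    have h4 := norm_sub_le (q b) (q a)
    have := hq.pos
    linarith
  rcases le_total s₁ s₂ with h | h
  · exact key _ _ h₁ h hs₁ hs₂
  · have := key _ _ h₂ h hs₂ hs₁
    rw [← norm_neg] at this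
    have e : -(q s₁ - q s₂ - (s₁ - s₂) • f) = q s₂ - q s₁ - (s₂ - s₁) • f := by
      rw [sub_smul, sub_smul]; abel
    rwa [e] at this

/-- Let `w` be the part of `q s₁` orthogonal to `f`. Up to errors `r / 100` from `J` and `3 * r /
100` from straightness, `J (q s₂)` is `w` plus a multiple of `f`. Pairing with `w` leaves at least
`‖w‖ ^ 2 - 4 * r / 100 * ‖w‖`, positive since `‖w‖ ≥ r / 10`. -/
theorem inner_map_pos (hq : IsNearlyStraight J f r q) {s₁ s₂ : ℝ} (h₁ : 0 ≤ s₁)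
    (h₂ : 0 ≤ s₂) (hs₁ : ‖q s₁‖ < r) (hs₂ : ‖q s₂‖ < r)
    (hw : r / 10 ≤ ‖q s₁ - (inner ℝ (q s₁) f / ‖f‖ ^ 2) • f‖) :
    0 < inner ℝ (J (q s₂)) (q s₁ - (inner ℝ (q s₁) f / ‖f‖ ^ 2) • f) := by
  have hf := hq.ne_zero
  have hwf := inner_sub_inner_div_smul (q s₁) f hf
  set w := q s₁ - (inner ℝ (q s₁) f / ‖f‖ ^ 2) • f with hwdef
  have hr := hq.pos
  have hE := hq.norm_sub_sub_smul_le h₁ h₂ hs₁ hs₂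
  set E := q s₂ - q s₁ - (s₂ - s₁) • f with hEdef
  have e1 : J (q s₂) = (J (q s₂) - q s₂) + E + w +
      ((s₂ - s₁) + inner ℝ (q s₁) f / ‖f‖ ^ 2) • f := by
    rw [hEdef, hwdef, add_smul]; abel
  have hw' : inner ℝ f w = 0 := by rw [real_inner_comm]; exact hwf
  rw [e1, inner_add_left, inner_add_left, inner_add_left, real_inner_smul_left, hw',
    real_inner_self_eq_norm_sq]
  have h5 : -(r / 100 * ‖w‖) ≤ inner ℝ (J (q s₂) - q s₂) w := by
    have := abs_le.1 (abs_real_inner_le_norm (J (q s₂) - q s₂) w)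
    have h6 : ‖J (q s₂) - q s₂‖ ≤ r / 100 := (hq.near s₂ h₂ hs₂).trans (by linarith)
    have := mul_le_mul_of_nonneg_right h6 (norm_nonneg w)
    linarith
  have h6 : -(3 * r / 100 * ‖w‖) ≤ inner ℝ E w := by
    have := abs_le.1 (abs_real_inner_le_norm E w)
    have := mul_le_mul_of_nonneg_right hE (norm_nonneg w)
    linarith
  have h7 : 0 < ‖w‖ := lt_of_lt_of_le (by positivity) hw
  nlinarith

theorem passageIntegral_eq (hq : ∃ T, ∀ s, T ≤ s → r ≤ ‖q s‖) (hr : 0 < r) :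
    ∃ T, 0 < T ∧ (∀ s, T ≤ s → r ≤ ‖q s‖) ∧
      passageIntegral r q = ∫ s in (0 : ℝ)..T, max 0 (1 - ‖q s‖ / r) • q s := by
  obtain ⟨T, hT⟩ := hq
  refine ⟨max T 1, by positivity, fun s hs => hT s ((le_max_left _ _).trans hs), ?_⟩
  rw [passageIntegral, intervalIntegral.integral_of_le (by positivity)]
  refine MeasureTheory.setIntegral_eq_of_subset_of_forall_sdiff_eq_zero measurableSet_Ioi
    Ioc_subset_Ioi_self ?_
  rintro s ⟨hs0, hs⟩
  have hs1 : max T 1 < s := by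
    by_contra h
    exact hs ⟨hs0, not_lt.1 h⟩
  have h1 : 1 ≤ ‖q s‖ / r := (one_le_div hr).2 (hT s ((le_max_left _ _).trans hs1.le))
  rw [max_eq_left (by linarith), zero_smul]

/-- The pairing passes under the integral, where the weight is nonnegative and supported in the
ball; a single visit to the ball makes the continuous integrand positive somewhere. -/
theorem inner_map_passageIntegral [CompleteSpace H] (hq : IsNearlyStraight J f r q) {w : H}
    (hpos : ∀ s, 0 ≤ s → ‖q s‖ < r → 0 < inner ℝ (J (q s)) w) :
    0 ≤ inner ℝ (J (passageIntegral r q)) w ∧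
      ((∃ s, 0 ≤ s ∧ ‖q s‖ < r) → 0 < inner ℝ (J (passageIntegral r q)) w) := by
  obtain ⟨T, hT0, hT, he⟩ := passageIntegral_eq hq.escapes hq.pos
  have hr := hq.pos
  have hc : Continuous fun s => max 0 (1 - ‖q s‖ / r) • q s := by
    have := hq.continuous
    fun_prop
  let L : H →L[ℝ] ℝ := (innerSL ℝ w).comp J
  have e2 : inner ℝ (J (passageIntegral r q)) w =
      ∫ s in (0 : ℝ)..T, max 0 (1 - ‖q s‖ / r) * inner ℝ (J (q s)) w := by
    have h1 := L.intervalIntegral_comp_comm (hc.intervalIntegrable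
      (μ := MeasureTheory.volume) 0 T)
    rw [he, real_inner_comm]
    change L _ = _
    rw [← h1]
    refine intervalIntegral.integral_congr fun s _ => ?_
    simp [L, real_inner_comm]
  have hcc : Continuous fun s => max 0 (1 - ‖q s‖ / r) * inner ℝ (J (q s)) w := by
    have := hq.continuous
    fun_prop
  have hnn : ∀ s, 0 ≤ s → 0 ≤ max 0 (1 - ‖q s‖ / r) * inner ℝ (J (q s)) w := by
    intro s hs
    by_cases h : ‖q s‖ < r
    · exact mul_nonneg (le_max_left _ _) (hpos s hs h).le
    · have h1 : 1 ≤ ‖q s‖ / r := (one_le_div hr).2 (not_lt.1 h)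
      rw [max_eq_left (by linarith), zero_mul]
  rw [e2]
  refine ⟨intervalIntegral.integral_nonneg hT0.le fun s hs => hnn s hs.1, ?_⟩
  rintro ⟨s, hs, hqs⟩
  refine intervalIntegral.integral_pos hT0 hcc.continuousOn (fun s hs => hnn s hs.1.le)
    ⟨s, ⟨hs, ?_⟩, ?_⟩
  · by_contra h
    exact absurd (hT s (not_le.1 h).le) (not_le.2 hqs)
  · refine mul_pos (lt_max_of_lt_right ?_) (hpos s hs hqs)
    rw [sub_pos, div_lt_one hr]
    exact hqs

omit [InnerProductSpace ℝ H] in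
theorem exists_truncatedDist (hc : Continuous q) (hq : ∃ T, ∀ s, T ≤ s → r ≤ ‖q s‖) :
    ∃ s, 0 ≤ s ∧ truncatedDist r q = min ‖q s‖ r ∧
      ∀ t, 0 ≤ t → truncatedDist r q ≤ min ‖q t‖ r := by
  obtain ⟨T, hT⟩ := hq
  have hg : Continuous fun s => min ‖q s‖ r := by fun_prop
  obtain ⟨s, hs, hmin⟩ := isCompact_Icc.exists_isMinOn (s := Icc (0 : ℝ) (max T 0))
    ⟨0, le_rfl, le_max_right _ _⟩ hg.continuousOn
  have hall : ∀ t, 0 ≤ t → min ‖q s‖ r ≤ min ‖q t‖ r := by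
    intro t ht
    rcases le_total t (max T 0) with h | h
    · exact hmin ⟨ht, h⟩
    · rw [min_eq_right (hT t ((le_max_left _ _).trans h))]
      exact min_le_right _ _
  have hleast : IsLeast ((fun s => min ‖q s‖ r) '' Ici 0) (min ‖q s‖ r) := by
    refine ⟨⟨s, hs.1, rfl⟩, ?_⟩
    rintro _ ⟨t, ht, rfl⟩
    exact hall t ht
  have he : truncatedDist r q = min ‖q s‖ r := hleast.csInf_eq
  exact ⟨s, hs.1, he, fun t ht => he ▸ hall t ht⟩

/-- Otherwise a small step forward or backward in time would shorten `q s`. The backward step needs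
`0 < s`. -/
theorem abs_inner_le_of_isMin (hq : IsNearlyStraight J f r q) {s : ℝ} (hs : 0 ≤ s)
    (hqs : ‖q s‖ < r) (hmin : ∀ t, 0 ≤ t → ‖q s‖ ≤ ‖q t‖) :
    -(r * ‖f‖ / 10) ≤ inner ℝ (q s) f ∧ (0 < s → inner ℝ (q s) f ≤ r * ‖f‖ / 10) := by
  have hr := hq.pos
  have hf0 := hq.norm_pos
  have hev : ∀ᶠ t in 𝓝 s, ‖q t‖ < r :=
    (hq.continuous.norm.continuousAt).eventually (gt_mem_nhds hqs)
  obtain ⟨η, hη, hball⟩ := Metric.eventually_nhds_iff.1 hev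
  constructor
  · by_contra hA
    rw [not_le] at hA
    set h := min (η / 2) (r / 10 / ‖f‖) with hh
    have hh0 : 0 < h := by positivity
    have hhf : h * ‖f‖ ≤ r / 10 := by
      rw [← le_div_iff₀ hf0]; exact min_le_right _ _
    have hin : ‖q (s + h)‖ < r := hball (by
      rw [Real.dist_eq, add_sub_cancel_left, abs_of_pos hh0]
      exact (min_le_left _ _).trans_lt (by linarith))
    have hst := hq.straight s (s + h) hs (by linarith) hqs hin
    rw [add_sub_cancel_left] at hst
    have := norm_add_smul_add_lt hh0 hqs.le hq.ne_zero hhf hst hA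
    have h3 : q s + h • f + (q (s + h) - q s - h • f) = q (s + h) := by abel
    rw [h3] at this
    exact absurd (hmin (s + h) (by linarith)) (not_le.2 this)
  · intro hs0
    by_contra hA
    rw [not_le] at hA
    set h := min s (min (η / 2) (r / 10 / ‖f‖)) with hh
    have hh0 : 0 < h := by positivity
    have hhs : h ≤ s := min_le_left _ _
    have hhf : h * ‖f‖ ≤ r / 10 := by
      rw [← le_div_iff₀ hf0]; exact (min_le_right _ _).trans (min_le_right _ _)
    have hin : ‖q (s - h)‖ < r := hball (by
      rw [Real.dist_eq, sub_sub_cancel_left, abs_neg, abs_of_pos hh0]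
      exact ((min_le_right _ _).trans (min_le_left _ _)).trans_lt (by linarith))
    have hst := hq.straight (s - h) s (by linarith) (by linarith) hin hqs
    rw [sub_sub_cancel] at hst
    have hst' : ‖-(q s - q (s - h) - h • f)‖ ≤ h * ‖-f‖ / 100 := by rwa [norm_neg, norm_neg]
    have := norm_add_smul_add_lt (f := -f) hh0 hqs.le (neg_ne_zero.2 hq.ne_zero)
      (by rwa [norm_neg]) hst' (by rw [inner_neg_right, norm_neg]; linarith)
    have h3 : q s + h • -f + -(q s - q (s - h) - h • f) = q (s - h) := by
      rw [smul_neg]; abel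
    rw [h3] at this
    exact absurd (hmin (s - h) (by linarith)) (not_le.2 this)

theorem displacement_of_norm_le (h : ‖q 0‖ ≤ r / 2) (hr : 0 < r) :
    displacement J f r q = J (q 0) := by
  have h1 : 4 * (‖q 0‖ / r) - 2 ≤ 0 := by
    have : ‖q 0‖ / r ≤ 1 / 2 := by rw [div_le_iff₀ hr]; linarith
    linarith
  rw [displacement, max_eq_left ((min_le_right _ _).trans h1)]
  simp

theorem displacement_of_le_norm (h : 3 * r / 4 ≤ ‖q 0‖) (hr : 0 < r) :
    displacement J f r q =
      J (passageIntegral r q) - (inner ℝ (J (passageIntegral r q)) f / ‖f‖ ^ 2) • f -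
        (r / 2 - truncatedDist r q) • f := by
  have h1 : 1 ≤ 4 * (‖q 0‖ / r) - 2 := by
    have : 3 / 4 ≤ ‖q 0‖ / r := by rw [le_div_iff₀ hr]; linarith
    linarith
  rw [displacement, min_eq_left h1, max_eq_right zero_le_one]
  simp

theorem displacement_of_forall_le_norm (h : ∀ s, 0 ≤ s → r ≤ ‖q s‖) (hr : 0 < r) :
    displacement J f r q = (r / 2) • f := by
  have h1 : passageIntegral r q = 0 := by
    rw [passageIntegral]
    refine (MeasureTheory.setIntegral_congr_fun (g := fun _ => (0 : H)) measurableSet_Ioi ?_).trans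
      (by simp)
    intro s hs
    have h1 : 1 ≤ ‖q s‖ / r := (one_le_div hr).2 (h s (le_of_lt hs))
    simp only
    rw [max_eq_left (by linarith), zero_smul]
  have h2 : truncatedDist r q = r := by
    rw [truncatedDist]
    have : (fun s => min ‖q s‖ r) '' Ici 0 = {r} := by
      ext y
      constructor
      · rintro ⟨s, hs, rfl⟩
        exact min_eq_right (h s hs)
      · rintro rfl
        exact ⟨0, self_mem_Ici, min_eq_right (h 0 le_rfl)⟩
    rw [this, csInf_singleton]
  rw [displacement_of_le_norm (by linarith [h 0 le_rfl]) hr, h1, h2]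
  simp only [map_zero, inner_zero_left, zero_div, zero_smul, sub_zero, zero_sub]
  rw [← neg_smul]
  congr 1
  ring

theorem inner_perp (hf : f ≠ 0) (u : H) (c : ℝ) :
    inner ℝ (u - (inner ℝ u f / ‖f‖ ^ 2) • f - c • f) f = -c * ‖f‖ ^ 2 := by
  rw [inner_sub_left, inner_sub_inner_div_smul u f hf, real_inner_smul_left,
    real_inner_self_eq_norm_sq]
  ring

theorem inner_perp_of_orthogonal {w : H} (hw : inner ℝ f w = 0) (u : H) (b c : ℝ) :
    inner ℝ (u - b • f - c • f) w = inner ℝ u w := by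
  rw [inner_sub_left, inner_sub_left, real_inner_smul_left, real_inner_smul_left, hw]
  ring

theorem le_norm_sub_inner_div_smul {u : H} (hf : f ≠ 0) (hr : 0 < r) (hu : r / 2 ≤ ‖u‖)
    (hlow : -(r * ‖f‖ / 10) ≤ inner ℝ u f) (hup : inner ℝ u f ≤ r * ‖f‖ / 10) :
    4 / 10 * r ≤ ‖u - (inner ℝ u f / ‖f‖ ^ 2) • f‖ := by
  have hf0 : 0 < ‖f‖ := norm_pos_iff.2 hf
  refine (pow_le_pow_iff_left₀ (by positivity) (norm_nonneg _) two_ne_zero).1 ?_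
  have h1 : inner ℝ u f ^ 2 / ‖f‖ ^ 2 ≤ (r / 10) ^ 2 := by
    rw [div_le_iff₀ (by positivity)]
    refine (sq_le_sq' hlow hup).trans (le_of_eq ?_)
    ring
  have h2 : (r / 2) ^ 2 ≤ ‖u‖ ^ 2 := pow_le_pow_left₀ (by positivity) hu 2
  rw [norm_sq_sub_inner_div_smul u f hf]
  nlinarith

/-- Pythagoras: `(r / 2) ^ 2 - (r / 10) ^ 2 = 24 / 100 * r ^ 2`, which is more than `(4 / 10 * r) ^
2`. -/
theorem sq_le_inner_sq {u : H} (hf : f ≠ 0) (hr : 0 < r) (hu : r / 2 ≤ ‖u‖)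
    (hw : ‖u - (inner ℝ u f / ‖f‖ ^ 2) • f‖ < r / 10) :
    (4 / 10 * (r * ‖f‖)) ^ 2 ≤ (inner ℝ u f) ^ 2 := by
  have hf0 : 0 < ‖f‖ := norm_pos_iff.2 hf
  have h1 : ‖u - (inner ℝ u f / ‖f‖ ^ 2) • f‖ ^ 2 ≤ (r / 10) ^ 2 :=
    pow_le_pow_left₀ (norm_nonneg _) hw.le 2
  rw [norm_sq_sub_inner_div_smul u f hf] at h1
  have h2 : (r / 2) ^ 2 ≤ ‖u‖ ^ 2 := pow_le_pow_left₀ (by positivity) hu 2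
  have h3 : 24 / 100 * r ^ 2 ≤ inner ℝ u f ^ 2 / ‖f‖ ^ 2 := by linarith
  rw [le_div_iff₀ (by positivity)] at h3
  have : 0 ≤ (r * ‖f‖) ^ 2 := sq_nonneg _
  linarith

/-- A path that starts ahead of the centre runs away from it: the term `s * inner ℝ (q 0) f`
outweighs the straightness error, so `‖q s‖` cannot fall below `r / 2 < ‖q 0‖`. -/
theorem half_le_truncatedDist (hq : IsNearlyStraight J f r q) (hlarge : r / 2 < ‖q 0‖)
    (hball : ‖q 0‖ < r) (hA1 : 4 / 10 * (r * ‖f‖) ≤ inner ℝ (q 0) f) :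
    r / 2 ≤ truncatedDist r q := by
  have hr := hq.pos
  have hf0 := hq.norm_pos
  obtain ⟨s, hs, hms, hmin⟩ := exists_truncatedDist hq.continuous hq.escapes
  by_contra hm
  rw [not_le] at hm
  have hqs : ‖q s‖ < r / 2 := by
    rw [hms] at hm
    rcases min_lt_iff.1 hm with h | h
    · exact h
    · linarith
  have hst := hq.straight 0 s le_rfl hs hball (by linarith)
  rw [sub_zero] at hst
  have hsp : 0 < s := by
    rcases hs.eq_or_lt with h | h
    · rw [← h] at hqs; linarith
    · exact h
  have e : q s = q 0 + (s • f + (q s - q 0 - s • f)) := by abel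
  set E := q s - q 0 - s • f
  have h1 : ‖q s‖ ^ 2 = ‖q 0‖ ^ 2 + 2 * (s * inner ℝ (q 0) f + inner ℝ (q 0) E) +
      ‖s • f + E‖ ^ 2 := by
    rw [e, norm_add_sq_real, inner_add_right, inner_smul_right]
  have h2 : -(r * (s * ‖f‖ / 100)) ≤ inner ℝ (q 0) E := by
    have := (abs_le.1 (abs_real_inner_le_norm (q 0) E)).1
    have := mul_le_mul hball.le hst (norm_nonneg _) hr.le
    linarith
  have h3 : s * (4 / 10 * (r * ‖f‖)) ≤ s * inner ℝ (q 0) f :=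
    mul_le_mul_of_nonneg_left hA1 hs
  have h4 : 0 < s * (r * ‖f‖) := by positivity
  have h5 : ‖q s‖ ^ 2 ≤ (r / 2) ^ 2 := pow_le_pow_left₀ (norm_nonneg _) hqs.le 2
  have h6 : (r / 2) ^ 2 ≤ ‖q 0‖ ^ 2 := pow_le_pow_left₀ (by positivity) hlarge.le 2
  nlinarith [sq_nonneg ‖s • f + E‖]

/-- A path that starts behind the centre, near the axis `ℝ f`, passes close to `0`. At its closest
point it is nearly orthogonal to `f`; at a distance above `r / 2` its orthogonal part would be at
least `4 / 10 * r`. But this part starts below `r / 10` and changes by at most `3 * r / 100`. -/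
theorem truncatedDist_le_half (hq : IsNearlyStraight J f r q) (hball : ‖q 0‖ < r)
    (hw : ‖q 0 - (inner ℝ (q 0) f / ‖f‖ ^ 2) • f‖ < r / 10)
    (hA1 : inner ℝ (q 0) f ≤ -(4 / 10 * (r * ‖f‖))) :
    truncatedDist r q ≤ r / 2 := by
  have hr := hq.pos
  have hf0 := hq.norm_pos
  have hf := hq.ne_zero
  have hrf : 0 < r * ‖f‖ := by positivity
  obtain ⟨s, hs, hms, hmin⟩ := exists_truncatedDist hq.continuous hq.escapes
  by_contra hm
  rw [not_le] at hm
  have hle := hmin 0 le_rfl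
  have hqs : ‖q s‖ < r ∧ ‖q s‖ = truncatedDist r q := by
    have h1 : truncatedDist r q < r :=
      (hle.trans (min_le_left _ _)).trans_lt hball
    rw [hms] at h1
    rcases min_lt_iff.1 h1 with h | h
    · exact ⟨h, by rw [hms, min_eq_left h.le]⟩
    · exact absurd h (lt_irrefl _)
  have hall : ∀ t, 0 ≤ t → ‖q s‖ ≤ ‖q t‖ := fun t ht =>
    hqs.2 ▸ (hmin t ht).trans (min_le_left _ _)
  obtain ⟨hlow, hup⟩ := hq.abs_inner_le_of_isMin hs hqs.1 hall
  -- At time `0` the path still points strongly against `f`, which the minimum does not allow.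
  have hsp : 0 < s := by
    rcases hs.eq_or_lt with h | h
    · rw [← h] at hlow; linarith
    · exact h
  have hup := hup hsp
  have hE := hq.norm_sub_sub_smul_le le_rfl hs hball hqs.1
  have hlow2 := le_norm_sub_inner_div_smul hf hr (by rw [hqs.2]; exact hm.le) hlow hup
  set E := q s - q 0 - (s - 0) • f with hEd
  have hproj : ‖E - (inner ℝ E f / ‖f‖ ^ 2) • f‖ ≤ ‖E‖ := by
    refine (pow_le_pow_iff_left₀ (by positivity) (norm_nonneg _) two_ne_zero).1 ?_
    rw [norm_sq_sub_inner_div_smul E f hf]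
    have : 0 ≤ inner ℝ E f ^ 2 / ‖f‖ ^ 2 := by positivity
    linarith
  have heq : q s - (inner ℝ (q s) f / ‖f‖ ^ 2) • f =
      (q 0 - (inner ℝ (q 0) f / ‖f‖ ^ 2) • f) + (E - (inner ℝ E f / ‖f‖ ^ 2) • f) := by
    have e : q s = q 0 + E + s • f := by rw [hEd, sub_zero]; abel
    have e2 : inner ℝ (q s) f / ‖f‖ ^ 2 =
        inner ℝ (q 0) f / ‖f‖ ^ 2 + inner ℝ E f / ‖f‖ ^ 2 + s := by
      rw [e, inner_add_left, inner_add_left, real_inner_smul_left,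
        real_inner_self_eq_norm_sq]
      field_simp
    rw [e2, add_smul, add_smul]
    nth_rw 1 [e]
    abel
  rw [heq] at hlow2
  have := norm_add_le (q 0 - (inner ℝ (q 0) f / ‖f‖ ^ 2) • f)
    (E - (inner ℝ E f / ‖f‖ ^ 2) • f)
  linarith

/-- In each zone of `‖q 0‖` some linear functional detects the vector: either pairing with `f`, or
pairing with the part orthogonal to `f` of a point of the path. -/
theorem displacement_ne_zero [CompleteSpace H] (hq : IsNearlyStraight J f r q) (h0 : q 0 ≠ 0) :
    displacement J f r q ≠ 0 := by
  have hr := hq.pos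
  have hf0 := hq.norm_pos
  have hf := hq.ne_zero
  have hrf : 0 < r * ‖f‖ := by positivity
  obtain ⟨s, hs, hms, hmin⟩ := exists_truncatedDist hq.continuous hq.escapes
  rcases le_or_gt ‖q 0‖ (r / 2) with hsmall | hlarge
  · rw [displacement_of_norm_le hsmall hr]
    intro hJ
    have h1 := hq.near 0 le_rfl (by linarith)
    rw [hJ, zero_sub, norm_neg] at h1
    have : 0 < ‖q 0‖ := norm_pos_iff.2 h0
    linarith
  rcases lt_or_ge ‖q 0‖ (3 * r / 4) with hmid | hfar
  · have hball : ‖q 0‖ < r := by linarith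
    have hθ1 : 4 * (‖q 0‖ / r) - 2 < 1 := by
      have : ‖q 0‖ / r < 3 / 4 := by rw [div_lt_iff₀ hr]; linarith
      linarith
    have hθ0 : 0 < 4 * (‖q 0‖ / r) - 2 := by
      have : 1 / 2 < ‖q 0‖ / r := by rw [lt_div_iff₀ hr]; linarith
      linarith
    rw [displacement, min_eq_right hθ1.le, max_eq_right hθ0.le]
    set θ := 4 * (‖q 0‖ / r) - 2
    have hwf := inner_sub_inner_div_smul (q 0) f hf
    intro hD
    -- If `q 0` is well off the axis, both interpolated vectors pair nonnegatively with its
    -- orthogonal part `w`, the first one strictly. If `q 0` is near the axis, the pairings with `f`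
    -- have the same sign: nonnegative ahead of the centre, nonpositive behind it, with that of `J
    -- (q 0)` nonzero.
    rcases le_or_gt (r / 10) ‖q 0 - (inner ℝ (q 0) f / ‖f‖ ^ 2) • f‖ with hw | hw
    · have hp : ∀ t, 0 ≤ t → ‖q t‖ < r →
          0 < inner ℝ (J (q t)) (q 0 - (inner ℝ (q 0) f / ‖f‖ ^ 2) • f) :=
        fun t ht hqt => hq.inner_map_pos le_rfl ht hball hqt hw
      set w := q 0 - (inner ℝ (q 0) f / ‖f‖ ^ 2) • f
      have hD' := congrArg (fun z => inner ℝ z w) hD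
      simp only [inner_add_left, real_inner_smul_left, inner_zero_left] at hD'
      rw [inner_perp_of_orthogonal (by rw [real_inner_comm]; exact hwf)] at hD'
      have h1 := hp 0 le_rfl hball
      have h2 := (hq.inner_map_passageIntegral hp).1
      have : 0 < (1 - θ) * inner ℝ (J (q 0)) w := mul_pos (by linarith) h1
      have : 0 ≤ θ * inner ℝ (J (passageIntegral r q)) w := mul_nonneg hθ0.le h2
      linarith
    · have hD' := congrArg (fun z => inner ℝ z f) hD
      simp only [inner_add_left (𝕜 := ℝ), real_inner_smul_left, inner_zero_left] at hD'
      rw [inner_perp hf] at hD'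
      have hA := sq_le_inner_sq hf hr hlarge.le hw
      have hJ : |inner ℝ (J (q 0)) f - inner ℝ (q 0) f| ≤ r * ‖f‖ / 100 := by
        rw [← inner_sub_left]
        refine (abs_real_inner_le_norm _ _).trans ?_
        have := hq.near 0 le_rfl hball
        have h2 : ‖J (q 0) - q 0‖ ≤ r / 100 := by linarith
        have := mul_le_mul_of_nonneg_right h2 hf0.le
        linarith
      have hJ' := abs_le.1 hJ
      rcases le_total 0 (inner ℝ (q 0) f) with hA0 | hA0
      · have hA1 : 4 / 10 * (r * ‖f‖) ≤ inner ℝ (q 0) f :=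
          by
          have := sq_le_sq.1 hA
          rwa [abs_of_pos (by positivity), abs_of_nonneg hA0] at this
        have hm := hq.half_le_truncatedDist hlarge hball hA1
        have h1 : 0 < (1 - θ) * inner ℝ (J (q 0)) f := mul_pos (by linarith) (by linarith)
        have h2 : 0 ≤ θ * (-(r / 2 - truncatedDist r q) * ‖f‖ ^ 2) :=
          mul_nonneg hθ0.le (mul_nonneg (by linarith) (by positivity))
        linarith
      · have hA1 : inner ℝ (q 0) f ≤ -(4 / 10 * (r * ‖f‖)) := by
          have := sq_le_sq.1 hA
          rw [abs_of_pos (by positivity), abs_of_nonpos hA0] at this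
          linarith
        have hm := hq.truncatedDist_le_half hball hw hA1
        have h1 : (1 - θ) * inner ℝ (J (q 0)) f < 0 :=
          mul_neg_of_pos_of_neg (by linarith) (by linarith)
        have h2 : θ * (-(r / 2 - truncatedDist r q) * ‖f‖ ^ 2) ≤ 0 := by
          refine mul_nonpos_of_nonneg_of_nonpos hθ0.le ?_
          exact mul_nonpos_of_nonpos_of_nonneg (by linarith) (by positivity)
        linarith
  · rw [displacement_of_le_norm hfar hr]
    intro hD
    -- Vanishing of the `f`-component forces a closest distance of exactly `r / 2`. It is attained
    -- at a positive time `s`, and then the part of `q s` orthogonal to `f` pairs positively with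
    -- the passage integral.
    have hm : truncatedDist r q = r / 2 := by
      have hD' := congrArg (fun z => inner ℝ z f) hD
      simp only [inner_perp hf, inner_zero_left] at hD'
      rcases mul_eq_zero.1 hD' with h | h
      · linarith
      · exact absurd h (by positivity)
    have hqs : ‖q s‖ = r / 2 := by
      rw [hms] at hm
      rcases min_choice ‖q s‖ r with h | h
      · rwa [h] at hm
      · rw [h] at hm; linarith
    have hall : ∀ t, 0 ≤ t → ‖q s‖ ≤ ‖q t‖ := fun t ht => by
      rw [hqs, ← hm]; exact (hmin t ht).trans (min_le_left _ _)
    have hsp : 0 < s := by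
      rcases hs.eq_or_lt with h | h
      · rw [← h] at hqs; linarith
      · exact h
    have hin : ‖q s‖ < r := by linarith
    obtain ⟨hlow, hup⟩ := hq.abs_inner_le_of_isMin hs hin hall
    have hup := hup hsp
    have hlow2 : r / 10 ≤ ‖q s - (inner ℝ (q s) f / ‖f‖ ^ 2) • f‖ :=
      le_trans (by linarith) (le_norm_sub_inner_div_smul hf hr hqs.ge hlow hup)
    have hp : ∀ t, 0 ≤ t → ‖q t‖ < r →
        0 < inner ℝ (J (q t)) (q s - (inner ℝ (q s) f / ‖f‖ ^ 2) • f) :=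
      fun t ht hqt => hq.inner_map_pos hs ht hin hqt hlow2
    have hpos := (hq.inner_map_passageIntegral hp).2 ⟨s, hs, hin⟩
    have hwf := inner_sub_inner_div_smul (q s) f hf
    have hD' := congrArg
      (fun z => inner ℝ z (q s - (inner ℝ (q s) f / ‖f‖ ^ 2) • f)) hD
    simp only [inner_zero_left] at hD'
    rw [inner_perp_of_orthogonal (by rw [real_inner_comm]; exact hwf)] at hD'
    linarith

end IsNearlyStraight

end HilbertDisplacement

/-! ### Continuous dependence of the displacement on parameters -/

section DisplacementContinuity

variable {H : Type*} [NormedAddCommGroup H] [InnerProductSpace ℝ H]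

omit [InnerProductSpace ℝ H] in
-- The escape time is locally uniform in `p`, so locally the infimum runs over a fixed compact
-- interval. The same reduction works for the passage integral.
theorem continuous_truncatedDist {P : Type*} [TopologicalSpace P] {r : P → ℝ} {q : P → ℝ → H}
    (hr : Continuous r) (hq : Continuous (Function.uncurry q))
    (hesc : ∀ p₀, ∃ T, ∀ᶠ p in 𝓝 p₀, ∀ s, T ≤ s → r p ≤ ‖q p s‖) :
    Continuous fun p => truncatedDist (r p) (q p) := by
  rw [continuous_iff_continuousAt]
  intro p₀
  obtain ⟨T, hT⟩ := hesc p₀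
  have hc : Continuous fun p => sInf ((fun s => min ‖q p s‖ (r p)) '' Icc 0 (max T 0)) := by
    refine isCompact_Icc.continuous_sInf ?_
    have : Continuous fun z : P × ℝ => min ‖Function.uncurry q z‖ (r z.1) := by fun_prop
    exact this
  refine hc.continuousAt.congr ?_
  filter_upwards [hT] with p hp
  refine congrArg sInf ((image_mono Icc_subset_Ici_self).antisymm ?_) |>.trans rfl
  rintro _ ⟨s, hs, rfl⟩
  rcases le_total s (max T 0) with h | h
  · exact ⟨s, ⟨hs, h⟩, rfl⟩
  · refine ⟨max T 0, ⟨le_max_right _ _, le_rfl⟩, ?_⟩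
    simp only
    rw [min_eq_right (hp _ (le_max_left _ _)), min_eq_right (hp _ ((le_max_left _ _).trans h))]

theorem continuous_passageIntegral {P : Type*} [TopologicalSpace P] {r : P → ℝ}
    {q : P → ℝ → H} (hr : Continuous r) (hr0 : ∀ p, 0 < r p)
    (hq : Continuous (Function.uncurry q))
    (hesc : ∀ p₀, ∃ T, ∀ᶠ p in 𝓝 p₀, ∀ s, T ≤ s → r p ≤ ‖q p s‖) :
    Continuous fun p => passageIntegral (r p) (q p) := by
  rw [continuous_iff_continuousAt]
  intro p₀
  obtain ⟨T, hT⟩ := hesc p₀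
  have hc : Continuous fun p => ∫ s in (0 : ℝ)..max T 0, max 0 (1 - ‖q p s‖ / r p) • q p s := by
    refine intervalIntegral.continuous_parametric_intervalIntegral_of_continuous' ?_ _ _
    have : Continuous fun z : P × ℝ =>
        max 0 (1 - ‖Function.uncurry q z‖ / r z.1) • Function.uncurry q z :=
      (continuous_const.max (continuous_const.sub (hq.norm.div (hr.comp continuous_fst)
        fun z => (hr0 _).ne'))).smul hq
    exact this
  refine hc.continuousAt.congr ?_
  filter_upwards [hT] with p hp
  rw [passageIntegral, intervalIntegral.integral_of_le (le_max_right _ _)]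
  symm
  refine MeasureTheory.setIntegral_eq_of_subset_of_forall_sdiff_eq_zero measurableSet_Ioi
    Ioc_subset_Ioi_self ?_
  rintro s ⟨hs0, hs⟩
  have hs1 : max T 0 < s := by
    by_contra h
    exact hs ⟨hs0, not_lt.1 h⟩
  have h1 : 1 ≤ ‖q p s‖ / r p :=
    (one_le_div (hr0 p)).2 (hp s ((le_max_left _ _).trans hs1.le))
  rw [max_eq_left (by linarith), zero_smul]

theorem continuous_displacement {P : Type*} [TopologicalSpace P] {J : P → H →L[ℝ] H} {f : P → H}
    {r : P → ℝ} {q : P → ℝ → H} (hJ : Continuous J) (hf : Continuous f) (hf0 : ∀ p, f p ≠ 0)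
    (hr : Continuous r) (hr0 : ∀ p, 0 < r p) (hq : Continuous (Function.uncurry q))
    (hesc : ∀ p₀, ∃ T, ∀ᶠ p in 𝓝 p₀, ∀ s, T ≤ s → r p ≤ ‖q p s‖) :
    Continuous fun p => displacement (J p) (f p) (r p) (q p) := by
  have h1 := continuous_truncatedDist hr hq hesc
  have h2 := continuous_passageIntegral hr hr0 hq hesc
  have h3 : Continuous fun p => q p 0 :=
    hq.comp (continuous_id.prodMk continuous_const)
  have h4 : Continuous fun p => ‖q p 0‖ / r p := h3.norm.div hr fun p => (hr0 p).ne'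
  have h5 : Continuous fun p => inner ℝ (J p (passageIntegral (r p) (q p))) (f p) / ‖f p‖ ^ 2 :=
    ((hJ.clm_apply h2).inner hf).div (hf.norm.pow 2) fun p =>
      pow_ne_zero 2 (norm_ne_zero_iff.2 (hf0 p))
  have h6 := hJ.clm_apply h2
  have h7 := hJ.clm_apply h3
  unfold displacement
  fun_prop

end DisplacementContinuity

/-! ### Flows read in an ambient normed space -/

section AbstractFlow

variable {M H : Type*} [NormedAddCommGroup H] [NormedSpace ℝ H]

/-- `γ` solves `(e ∘ γ)' = F ∘ γ` on the open interval `J ∋ 0`, with `γ 0 = x`. -/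
structure IsSol (e F : M → H) (x : M) (J : Set ℝ) (γ : ℝ → M) : Prop where
  isOpen : IsOpen J
  ordConnected : J.OrdConnected
  zero_mem : (0 : ℝ) ∈ J
  start : γ 0 = x
  hasDerivAt : ∀ t ∈ J, HasDerivAt (e ∘ γ) (F (γ t)) t

/-- `φ x` is, on the interval `D x`, a solution starting at `x` which extends all others. -/
structure IsUniversalFlow (e F : M → H) (D : M → Set ℝ) (φ : M → ℝ → M) : Prop where
  isSol : ∀ x, IsSol e F x (D x) (φ x)
  extends_isSol : ∀ x J γ, IsSol e F x J γ → J ⊆ D x ∧ EqOn γ (φ x) J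

theorem hasDerivAt_ite_lt {g₁ g₂ : ℝ → H} {d : H} {b : ℝ} (h₁ : HasDerivWithinAt g₁ d (Iic b) b)
    (h₂ : HasDerivWithinAt g₂ d (Ici b) b) (h : g₁ b = g₂ b) :
    HasDerivAt (fun t => if t < b then g₁ t else g₂ t) d b := by
  rw [← hasDerivWithinAt_univ, ← Iic_union_Ici (a := b)]
  refine HasDerivWithinAt.union (h₁.congr ?_ ?_) (h₂.congr ?_ ?_)
  · intro t ht
    rcases (mem_Iic.1 ht).lt_or_eq with h' | h'
    · simp [h']
    · simp [h', h]
  · simp [h]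
  · intro t ht
    simp [not_lt.2 (mem_Ici.1 ht)]
  · simp

theorem hasDerivAt_glue {e F : M → H} {γ₁ γ₂ : ℝ → M} {a b c : ℝ} (hz : γ₁ b = γ₂ b)
    (h₁ : ∀ t ∈ Ioo a b, HasDerivAt (e ∘ γ₁) (F (γ₁ t)) t)
    (h₂ : ∀ t ∈ Ioo b c, HasDerivAt (e ∘ γ₂) (F (γ₂ t)) t)
    (h₁b : HasDerivWithinAt (e ∘ γ₁) (F (γ₁ b)) (Iic b) b)
    (h₂b : HasDerivWithinAt (e ∘ γ₂) (F (γ₂ b)) (Ici b) b) :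
    ∀ t ∈ Ioo a c, HasDerivAt (e ∘ fun t => if t < b then γ₁ t else γ₂ t)
      (F (if t < b then γ₁ t else γ₂ t)) t := by
  have hcomp : (e ∘ fun t => if t < b then γ₁ t else γ₂ t) =
      fun t => if t < b then (e ∘ γ₁) t else (e ∘ γ₂) t := by
    funext t
    simp only [Function.comp_apply]
    split_ifs <;> rfl
  rw [hcomp]
  intro t ht
  rcases lt_trichotomy t b with h | h | h
  · rw [if_pos h]
    refine (h₁ t ⟨ht.1, h⟩).congr_of_eventuallyEq ?_
    filter_upwards [gt_mem_nhds h] with u hu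
    rw [if_pos hu]
  · subst h
    rw [if_neg (lt_irrefl _)]
    exact hasDerivAt_ite_lt (hz ▸ h₁b) h₂b (congrArg e hz)
  · rw [if_neg (not_lt.2 h.le)]
    refine (h₂ t ⟨h, ht.2⟩).congr_of_eventuallyEq ?_
    filter_upwards [lt_mem_nhds h] with u hu
    rw [if_neg (not_lt.2 hu.le)]

namespace IsUniversalFlow

variable {e F : M → H} {D : M → Set ℝ} {φ : M → ℝ → M}

theorem hasDerivAt (hφ : IsUniversalFlow e F D φ) {x : M} {t : ℝ} (ht : t ∈ D x) :
    HasDerivAt (e ∘ φ x) (F (φ x t)) t := (hφ.isSol x).hasDerivAt t ht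

theorem apply_zero (hφ : IsUniversalFlow e F D φ) (x : M) : φ x 0 = x := (hφ.isSol x).start

theorem zero_mem (hφ : IsUniversalFlow e F D φ) (x : M) : (0 : ℝ) ∈ D x := (hφ.isSol x).zero_mem

theorem Icc_subset (hφ : IsUniversalFlow e F D φ) {x : M} {t : ℝ} (ht : t ∈ D x) :
    Icc 0 t ⊆ D x := (hφ.isSol x).ordConnected.out (hφ.zero_mem x) ht

theorem continuousAt [TopologicalSpace M] (hφ : IsUniversalFlow e F D φ) (he : IsInducing e) {x : M} {t : ℝ}
    (ht : t ∈ D x) : ContinuousAt (φ x) t :=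
  he.continuousAt_iff.2 (hφ.hasDerivAt ht).continuousAt

theorem isSol_shift (hφ : IsUniversalFlow e F D φ) {x : M} {t : ℝ} (ht : t ∈ D x) :
    IsSol e F (φ x t) ((fun s => s + t) ⁻¹' D x) (fun s => φ x (s + t)) where
  isOpen := (hφ.isSol x).isOpen.preimage (by fun_prop)
  ordConnected := by
    have := (hφ.isSol x).ordConnected
    exact this.preimage_mono fun a b hab => by simpa using hab
  zero_mem := by simpa using ht
  start := by simp
  hasDerivAt s hs := by
    have := (hφ.hasDerivAt (x := x) (t := s + t) hs).comp_add_const s t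
    exact this

theorem preimage_add_subset (hφ : IsUniversalFlow e F D φ) {x : M} {t : ℝ} (ht : t ∈ D x) :
    (fun s => s + t) ⁻¹' D x ⊆ D (φ x t) := (hφ.extends_isSol _ _ _ (hφ.isSol_shift ht)).1

theorem apply_add (hφ : IsUniversalFlow e F D φ) {x : M} {t s : ℝ} (ht : t ∈ D x)
    (hs : s + t ∈ D x) : φ x (s + t) = φ (φ x t) s :=
  (hφ.extends_isSol _ _ _ (hφ.isSol_shift ht)).2 hs

theorem mem_shift_iff (hφ : IsUniversalFlow e F D φ) {x : M} {t s : ℝ} (ht : t ∈ D x) :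
    s ∈ D (φ x t) ↔ s + t ∈ D x := by
  refine ⟨fun hs => ?_, fun hs => hφ.preimage_add_subset ht hs⟩
  -- The remaining inclusion follows by shifting back from `φ x t` to `x`.
  have hneg : -t ∈ D (φ x t) := hφ.preimage_add_subset ht (by simpa using hφ.zero_mem x)
  have hback : φ (φ x t) (-t) = x := by
    rw [← hφ.apply_add ht (by simpa using hφ.zero_mem x), neg_add_cancel, hφ.apply_zero]
  have := hφ.preimage_add_subset hneg (show s + t + -t ∈ D (φ x t) by simpa using hs)
  rwa [hback] at this

end IsUniversalFlow

end AbstractFlow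

/-! ### Local existence times and continuity of the flow -/

section AbstractFlowContinuity

variable {M H : Type*} [TopologicalSpace M] [NormedAddCommGroup H] [NormedSpace ℝ H]

omit [NormedSpace ℝ H] in
theorem uniformly_close_of_isCompact {e F : M → H} {K : Set M} (he : IsEmbedding e)
    (hF : Continuous F) (hK : IsCompact K) {ε : ℝ} (hε : 0 < ε) :
    ∃ η > 0, ∀ a ∈ K, ∀ b ∈ K, ‖e a - e b‖ < η → ‖F a - F b‖ < ε := by
  -- In the metric pulled back along `e` the claim is uniform continuity on a compact set.
  let := he.comapMetricSpace
  have := hK.uniformContinuousOn_of_continuous hF.continuousOn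
  obtain ⟨η, hη, h⟩ := Metric.uniformContinuousOn_iff.1 this ε hε
  refine ⟨η, hη, fun a ha b hb hab => ?_⟩
  rw [← dist_eq_norm]
  exact h a ha b hb (by rw [← dist_eq_norm] at hab; exact hab)

omit [NormedSpace ℝ H] in
theorem exists_norm_lt_imp_mem {e : M → H} (he : IsInducing e) {x : M} {N : Set M}
    (hN : N ∈ 𝓝 x) : ∃ ρ > 0, ∀ y, ‖e y - e x‖ < ρ → y ∈ N := by
  rw [he.nhds_eq_comap, mem_comap] at hN
  obtain ⟨t, ht, htN⟩ := hN
  obtain ⟨ρ, hρ, hb⟩ := Metric.mem_nhds_iff.1 ht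
  exact ⟨ρ, hρ, fun y hy => htN (hb (by rwa [Metric.mem_ball, dist_eq_norm]))⟩

omit [NormedSpace ℝ H] in
theorem eventually_norm_map_sub_lt {e : M → H} (he : Continuous e) (x₀ : M) {ε : ℝ} (hε : 0 < ε) :
    ∀ᶠ x in 𝓝 x₀, ‖e x - e x₀‖ < ε := by
  have : ContinuousAt (fun y => ‖e y - e x₀‖) x₀ := by
    have := he.continuousAt (x := x₀); fun_prop
  exact this.eventually (gt_mem_nhds (show ‖e x₀ - e x₀‖ < ε by rwa [sub_self, norm_zero]))

/-- Passing to the limit in the estimate satisfied by solutions. -/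
theorem hasDerivWithinAt_of_forall_close {g : ℝ → H} {G : ℝ → H} {S : Set ℝ}
    (h : ∀ ε > 0, ∃ η > 0, ∀ s ∈ S, ∀ t ∈ S, |t - s| < η →
      ‖g t - g s - (t - s) • G s‖ ≤ ε * |t - s|) {s : ℝ} (hs : s ∈ S) :
    HasDerivWithinAt g (G s) S s := by
  rw [hasDerivWithinAt_iff_isLittleO, Asymptotics.isLittleO_iff]
  intro ε hε
  obtain ⟨η, hη, hb⟩ := h ε hε
  have : ∀ᶠ t in 𝓝[S] s, |t - s| < η := by
    refine nhdsWithin_le_nhds ?_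
    have := Metric.ball_mem_nhds s hη
    filter_upwards [this] with t ht
    rwa [Metric.mem_ball, Real.dist_eq] at ht
  filter_upwards [this, self_mem_nhdsWithin] with t ht htS
  simpa [Real.norm_eq_abs] using hb s hs t htS ht

namespace IsUniversalFlow

variable {e F : M → H} {D : M → Set ℝ} {φ : M → ℝ → M}

omit [TopologicalSpace M] in
-- The mean value inequality for `u ↦ e (φ x u) - u • v`. It serves with `v = 0` for Lipschitz
-- bounds and with `v` a value of `F` for first-order approximation.
theorem norm_sub_le_of_forall_mem (hφ : IsUniversalFlow e F D φ) {x : M} {S : Set ℝ}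
    (hS : Convex ℝ S) (hSD : S ⊆ D x) {v : H} {C : ℝ} (hC : ∀ u ∈ S, ‖F (φ x u) - v‖ ≤ C)
    {s t : ℝ} (hs : s ∈ S) (ht : t ∈ S) :
    ‖e (φ x t) - e (φ x s) - (t - s) • v‖ ≤ C * |t - s| := by
  have h1 : ∀ u ∈ S, HasDerivWithinAt (fun u => e (φ x u) - u • v) (F (φ x u) - v) S u := by
    intro u hu
    have h2 := (hφ.hasDerivAt (hSD hu)).sub ((hasDerivAt_id u).smul_const v)
    rw [one_smul] at h2
    exact h2.hasDerivWithinAt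
  have := Convex.norm_image_sub_le_of_norm_hasDerivWithin_le h1 hC hS hs ht
  rw [Real.norm_eq_abs] at this
  convert! this using 2
  rw [sub_smul]
  abel

omit [TopologicalSpace M] in
theorem norm_sub_le (hφ : IsUniversalFlow e F D φ) {x : M} {S : Set ℝ}
    (hS : Convex ℝ S) (hSD : S ⊆ D x) {C : ℝ} (hC : ∀ u ∈ S, ‖F (φ x u)‖ ≤ C)
    {s t : ℝ} (hs : s ∈ S) (ht : t ∈ S) :
    ‖e (φ x t) - e (φ x s)‖ ≤ C * |t - s| := by
  have := hφ.norm_sub_le_of_forall_mem hS hSD (v := 0) (by simpa using hC) hs ht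
  simpa using this

/-- `F` is bounded on `K`, so `e ∘ φ x` is Lipschitz on `[0, b)` and converges to some `e z` with `z
∈ K`. The solution starting at `z` continues the curve past `b`, and universality of `φ` gives `b ∈
D x`. -/
theorem mem_of_forall_mem_compact [CompleteSpace H] (hφ : IsUniversalFlow e F D φ)
    (he : IsEmbedding e) (hF : Continuous F) {K : Set M} (hK : IsCompact K) {x : M} {b : ℝ}
    (hb : 0 < b) (hsub : Ico 0 b ⊆ D x) (hmem : ∀ t ∈ Ico 0 b, φ x t ∈ K) : b ∈ D x := by
  obtain ⟨C, hC⟩ := hK.exists_bound_of_continuousOn hF.continuousOn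
  have hLip : LipschitzOnWith (Real.toNNReal C) (e ∘ φ x) (Ico 0 b) := by
    refine LipschitzOnWith.of_dist_le_mul fun s hs t ht => ?_
    rw [dist_eq_norm, Real.dist_eq]
    have hC0 : 0 ≤ C := (norm_nonneg _).trans (hC _ (hmem s hs))
    rw [Real.coe_toNNReal _ hC0]
    exact hφ.norm_sub_le (convex_Ico 0 b) hsub (fun u hu => hC _ (hmem u hu)) ht hs
  have hIco : Ico 0 b ∈ 𝓝[<] b := Ico_mem_nhdsLT hb
  have hcau : Cauchy (map (e ∘ φ x) (𝓝[<] b)) :=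
    (cauchy_nhds.mono nhdsWithin_le_nhds).map_of_le hLip.uniformContinuousOn
      (le_principal_iff.2 hIco)
  have hle : map (e ∘ φ x) (𝓝[<] b) ≤ 𝓟 (e '' K) := by
    rw [le_principal_iff, mem_map]
    filter_upwards [hIco] with t ht
    exact ⟨_, hmem t ht, rfl⟩
  obtain ⟨_, ⟨z, hz, rfl⟩, hlim⟩ := (hK.image he.continuous).isComplete _ hcau hle
  have hlim' : Tendsto (φ x) (𝓝[<] b) (𝓝 z) := he.tendsto_nhds_iff.2 hlim
  classical
  obtain ⟨η, hη, hηD⟩ := Metric.isOpen_iff.1 (hφ.isSol x).isOpen 0 (hφ.zero_mem x)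
  obtain ⟨δ, hδ, hδD⟩ := Metric.isOpen_iff.1 (hφ.isSol z).isOpen 0 (hφ.zero_mem z)
  have hderiv : ∀ t ∈ Ioo (-η) b, HasDerivAt (e ∘ φ x) (F (φ x t)) t := by
    intro t ht
    rcases lt_or_ge t 0 with h | h
    · exact hφ.hasDerivAt (hηD (by
        rw [Metric.mem_ball, Real.dist_eq, sub_zero, abs_of_neg h]; linarith [ht.1]))
    · exact hφ.hasDerivAt (hsub ⟨h, ht.2⟩)
  let γ₁ : ℝ → M := fun t => if t < b then φ x t else z
  have hγ₁ : ∀ t, t < b → e ∘ γ₁ =ᶠ[𝓝 t] e ∘ φ x := by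
    intro t ht
    filter_upwards [gt_mem_nhds ht] with u hu
    simp [γ₁, hu]
  have hγ₁d : ∀ t ∈ Ioo (-η) b, HasDerivAt (e ∘ γ₁) (F (γ₁ t)) t := by
    intro t ht
    have : γ₁ t = φ x t := if_pos ht.2
    rw [this]
    exact (hderiv t ht).congr_of_eventuallyEq (hγ₁ t ht.2)
  have hγ₁b : γ₁ b = z := if_neg (lt_irrefl _)
  have hIoo : Ioo (-η) b ∈ 𝓝[<] b := Ioo_mem_nhdsLT (by linarith)
  -- The one-sided derivative at `b` exists because the derivatives `F (φ x t)` converge to `F z`.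
  have h₁b : HasDerivWithinAt (e ∘ γ₁) (F (γ₁ b)) (Iic b) b := by
    refine hasDerivWithinAt_Iic_of_tendsto_deriv (s := Ioo (-η) b)
      (fun t ht => (hγ₁d t ht).differentiableAt.differentiableWithinAt) ?_ hIoo ?_
    · have h2 : Tendsto (e ∘ γ₁) (𝓝[<] b) (𝓝 (e z)) := by
        refine Tendsto.congr' ?_ (show Tendsto (e ∘ φ x) (𝓝[<] b) (𝓝 (e z)) from hlim)
        filter_upwards [self_mem_nhdsWithin] with t ht
        simp [γ₁, mem_Iio.1 ht]
      rw [ContinuousWithinAt, Function.comp_apply, hγ₁b]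
      exact h2.mono_left (nhdsWithin_mono _ Ioo_subset_Iio_self)
    · rw [hγ₁b]
      refine ((hF.tendsto z).comp hlim').congr' ?_
      filter_upwards [hIoo] with t ht
      rw [(hγ₁d t ht).deriv, Function.comp_apply]
      exact congrArg F (if_pos ht.2).symm
  let γ₂ : ℝ → M := fun t => φ z (t - b)
  have hγ₂ : ∀ t ∈ Ioo (b - δ) (b + δ), HasDerivAt (e ∘ γ₂) (F (γ₂ t)) t := by
    intro t ht
    have : t - b ∈ D z := hδD (by
      rw [Metric.mem_ball, Real.dist_eq, sub_zero, abs_lt]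
      constructor <;> linarith [ht.1, ht.2])
    exact (hφ.hasDerivAt this).comp_sub_const t b
  have hγ₂b : γ₂ b = z := by simp [γ₂, hφ.apply_zero]
  have hglue := hasDerivAt_glue (a := -η) (c := b + δ) (hγ₁b.trans hγ₂b.symm) hγ₁d
    (fun t ht => hγ₂ t ⟨by linarith [ht.1], ht.2⟩) h₁b
    (hγ₂ b ⟨by linarith, by linarith⟩).hasDerivWithinAt
  have hsol : IsSol e F x (Ioo (-η) (b + δ)) (fun t => if t < b then γ₁ t else γ₂ t) :=
    ⟨isOpen_Ioo, ordConnected_Ioo, ⟨by linarith, by linarith⟩, by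
      simp [γ₁, hb, hφ.apply_zero], hglue⟩
  exact (hφ.extends_isSol _ _ _ hsol).1 ⟨by linarith, by linarith⟩

/-- With speed at most `C` on `K`, a solution starting within `ρ / 4` of `x₀` travels at most `C * δ
= ρ / 4` up to time `δ`. It thus stays strictly inside the `ρ`-ball, hence in `K`, and cannot cease
to exist. The continuation argument uses `mem_of_forall_mem_compact` at limit times and the strict
margin elsewhere. -/
theorem exists_uniform_time [CompleteSpace H] [LocallyCompactSpace M]
    (hφ : IsUniversalFlow e F D φ) (he : IsEmbedding e) (hF : Continuous F) (x₀ : M) {N : Set M}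
    (hN : N ∈ 𝓝 x₀) : ∃ K, IsCompact K ∧ K ⊆ N ∧ ∃ δ > 0, ∃ O, IsOpen O ∧ x₀ ∈ O ∧
      ∀ x ∈ O, Icc 0 δ ⊆ D x ∧ ∀ t ∈ Icc 0 δ, φ x t ∈ K := by
  obtain ⟨K, hKx, hKN, hK⟩ := local_compact_nhds hN
  obtain ⟨C', hC'⟩ := hK.exists_bound_of_continuousOn hF.continuousOn
  set C := max C' 1 with hCdef
  have hC : ∀ y ∈ K, ‖F y‖ ≤ C := fun y hy => (hC' y hy).trans (le_max_left _ _)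
  have hC0 : 0 < C := lt_of_lt_of_le one_pos (le_max_right _ _)
  obtain ⟨ρ, hρ, hρK⟩ := exists_norm_lt_imp_mem he.isInducing hKx
  set δ := ρ / (4 * C) with hδdef
  have hδ : 0 < δ := by positivity
  have hCδ : C * δ = ρ / 4 := by rw [hδdef]; field_simp
  refine ⟨K, hK, hKN, δ, hδ, {x | ‖e x - e x₀‖ < ρ / 4},
    isOpen_lt (by have := he.continuous; fun_prop) continuous_const,
    by simpa using by positivity, fun x hx => ?_⟩
  let S : Set ℝ := {t | Icc 0 t ⊆ D x ∧ ∀ s ∈ Icc 0 t, φ x s ∈ K}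
  have hest : ∀ t ∈ S, 0 ≤ t → t ≤ δ → ‖e (φ x t) - e x₀‖ < 3 * ρ / 4 := by
    intro t ht h0 htδ
    have h1 := hφ.norm_sub_le (convex_Icc 0 t) ht.1 (fun u hu => hC _ (ht.2 u hu))
      (s := 0) (t := t) ⟨le_rfl, h0⟩ ⟨h0, le_rfl⟩
    rw [sub_zero, abs_of_nonneg h0, hφ.apply_zero] at h1
    have h2 : C * t ≤ ρ / 4 := hCδ ▸ mul_le_mul_of_nonneg_left htδ hC0.le
    have h3 := norm_sub_le_norm_sub_add_norm_sub (e (φ x t)) (e x) (e x₀)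
    have h4 : ‖e x - e x₀‖ < ρ / 4 := hx
    linarith
  have hxK : x ∈ K := hρK x (by have h4 : ‖e x - e x₀‖ < ρ / 4 := hx; linarith)
  have hsub : Icc 0 δ ⊆ S := by
    refine IsClosed.Icc_subset_of_forall_exists_gt ?_ ?_ ?_
    · refine isClosed_of_closure_subset fun t ht => ?_
      have htI : t ∈ Icc 0 δ := by
        have := closure_mono inter_subset_right ht
        rwa [isClosed_Icc.closure_eq] at this
      refine ⟨?_, htI⟩
      have hlt : ∀ u, u < t → Icc 0 u ⊆ D x ∧ ∀ s ∈ Icc 0 u, φ x s ∈ K := by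
        intro u hu
        obtain ⟨v, hv, hvS⟩ := mem_closure_iff.1 ht (Ioi u) isOpen_Ioi hu
        exact ⟨(Icc_subset_Icc_right (le_of_lt hv)).trans hvS.1.1,
          fun s hs => hvS.1.2 s ⟨hs.1, hs.2.trans (le_of_lt hv)⟩⟩
      have hIco : ∀ s ∈ Ico 0 t, s ∈ D x ∧ φ x s ∈ K := fun s hs =>
        ⟨(hlt s hs.2).1 ⟨hs.1, le_rfl⟩, (hlt s hs.2).2 s ⟨hs.1, le_rfl⟩⟩
      rcases htI.1.eq_or_lt with h | h
      · rw [← h]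
        refine ⟨by simpa using hφ.zero_mem x, ?_⟩
        intro s hs
        rw [Icc_self, mem_singleton_iff] at hs
        rw [hs, hφ.apply_zero]
        exact hxK
      · have htD := hφ.mem_of_forall_mem_compact he hF hK h (fun s hs => (hIco s hs).1)
          fun s hs => (hIco s hs).2
        refine ⟨hφ.Icc_subset htD, fun s hs => ?_⟩
        rcases hs.2.lt_or_eq with h' | h'
        · exact (hIco s ⟨hs.1, h'⟩).2
        · subst h'
          refine hρK _ ?_
          have hcl : ‖e (φ x s) - e x₀‖ ≤ 3 * ρ / 4 := by
            have hc : Tendsto (fun u => ‖e (φ x u) - e x₀‖) (𝓝[<] s)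
                (𝓝 ‖e (φ x s) - e x₀‖) :=
              (((hφ.hasDerivAt htD).continuousAt.tendsto.sub_const _).norm).mono_left
                nhdsWithin_le_nhds
            refine le_of_tendsto hc ?_
            filter_upwards [Ico_mem_nhdsLT h] with u hu
            exact (hest u (hlt u hu.2) hu.1 (hu.2.le.trans htI.2)).le
          linarith
    · refine ⟨by simpa using hφ.zero_mem x, ?_⟩
      intro s hs
      rw [Icc_self, mem_singleton_iff] at hs
      rw [hs, hφ.apply_zero]
      exact hxK
    · rintro t ⟨htS, htI⟩ y hy
      have htD : t ∈ D x := htS.1 ⟨htI.1, le_rfl⟩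
      have h1 : ∀ᶠ u in 𝓝 t, u ∈ D x ∧ φ x u ∈ K := by
        refine Eventually.and ((hφ.isSol x).isOpen.mem_nhds htD) ?_
        have hc : ContinuousAt (fun u => ‖e (φ x u) - e x₀‖) t :=
          ((hφ.hasDerivAt htD).continuousAt.sub continuousAt_const).norm
        have := hest t htS htI.1 htI.2.le
        filter_upwards [hc.eventually (gt_mem_nhds (this.trans (show 3 * ρ / 4 < ρ by linarith)))] with u hu
        exact hρK _ hu
      obtain ⟨η, hη, hb⟩ := Metric.eventually_nhds_iff.1 h1
      refine ⟨min y (t + η / 2), ⟨?_, ?_⟩, ⟨lt_min hy (by linarith), min_le_left _ _⟩⟩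
      · intro s hs
        rcases le_or_gt s t with h | h
        · exact htS.1 ⟨hs.1, h⟩
        · refine (hb ?_).1
          rw [Real.dist_eq, abs_of_pos (by linarith)]
          linarith [hs.2.trans (min_le_right _ _)]
      · intro s hs
        rcases le_or_gt s t with h | h
        · exact htS.2 s ⟨hs.1, h⟩
        · refine (hb ?_).2
          rw [Real.dist_eq, abs_of_pos (by linarith)]
          linarith [hs.2.trans (min_le_right _ _)]
  exact hsub ⟨hδ.le, le_rfl⟩

/-- Along an ultrafilter converging to `x₁` the curves `φ x` converge pointwise in the compact set
`K`. A uniform first-order estimate survives the limit, so the limit curve solves the equation and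
starts at `x₁`; by uniqueness it is `φ x₁`. -/
theorem tendsto_apply_of_uniform_time [T2Space M] (hφ : IsUniversalFlow e F D φ)
    (he : IsEmbedding e) (hF : Continuous F) {K O : Set M} (hK : IsCompact K) (hO : IsOpen O)
    {δ : ℝ} (hδ : 0 < δ) (hOK : ∀ x ∈ O, Icc 0 δ ⊆ D x ∧ ∀ t ∈ Icc 0 δ, φ x t ∈ K) {x₁ : M}
    (hx₁ : x₁ ∈ O) {t₁ : ℝ} (ht₁ : t₁ ∈ Ico 0 δ) :
    Tendsto (fun x => φ x t₁) (𝓝 x₁) (𝓝 (φ x₁ t₁)) := by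
  rw [tendsto_iff_ultrafilter]
  intro g hg
  have hOg : ∀ᶠ x in (g : Filter M), x ∈ O := hg (hO.mem_nhds hx₁)
  have hlim : ∀ s : ℝ, ∃ z, s ∈ Icc 0 δ → z ∈ K ∧ Tendsto (fun x => φ x s) g (𝓝 z) := by
    intro s
    by_cases hs : s ∈ Icc 0 δ
    · obtain ⟨z, hz, hzl⟩ := hK.ultrafilter_le_nhds (g.map fun x => φ x s) (by
        rw [le_principal_iff, Ultrafilter.mem_coe, Ultrafilter.mem_map, ← Ultrafilter.mem_coe]
        filter_upwards [hOg] with x hx using (hOK x hx).2 s hs)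
      exact ⟨z, fun _ => ⟨hz, hzl⟩⟩
    · exact ⟨x₁, fun h => absurd h hs⟩
  choose γ hγ using hlim
  have hγ0 : γ 0 = x₁ := by
    have h1 : Tendsto (fun x => φ x 0) g (𝓝 x₁) := by
      simp only [hφ.apply_zero]
      exact hg
    exact tendsto_nhds_unique (hγ 0 ⟨le_rfl, hδ.le⟩).2 h1
  obtain ⟨C', hC'⟩ := hK.exists_bound_of_continuousOn hF.continuousOn
  set C := max C' 1 with hCdef
  have hC : ∀ y ∈ K, ‖F y‖ ≤ C := fun y hy => (hC' y hy).trans (le_max_left _ _)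
  have hC0 : 0 < C := lt_of_lt_of_le one_pos (le_max_right _ _)
  have hclose : ∀ ε > 0, ∃ η > 0, ∀ s ∈ Icc 0 δ, ∀ t ∈ Icc 0 δ, |t - s| < η →
      ‖(e ∘ γ) t - (e ∘ γ) s - (t - s) • F (γ s)‖ ≤ ε * |t - s| := by
    intro ε hε
    obtain ⟨η, hη, hFη⟩ := uniformly_close_of_isCompact he hF hK hε
    refine ⟨η / C, by positivity, fun s hs t ht hst => ?_⟩
    have h1 : Tendsto (fun x => ‖e (φ x t) - e (φ x s) - (t - s) • F (φ x s)‖) g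
        (𝓝 ‖(e ∘ γ) t - (e ∘ γ) s - (t - s) • F (γ s)‖) := by
      have hs' := (hγ s hs).2
      have ht' := (hγ t ht).2
      exact ((((he.continuous.tendsto _).comp ht').sub ((he.continuous.tendsto _).comp hs')).sub
        (((hF.tendsto _).comp hs').const_smul _)).norm
    refine le_of_tendsto h1 ?_
    filter_upwards [hOg] with x hx
    obtain ⟨hxD, hxK⟩ := hOK x hx
    have hsub : uIcc s t ⊆ Icc 0 δ := uIcc_subset_Icc hs ht
    refine hφ.norm_sub_le_of_forall_mem (convex_uIcc s t) (hsub.trans hxD) (fun u hu => ?_)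
      left_mem_uIcc right_mem_uIcc
    refine (hFη _ (hxK u (hsub hu)) _ (hxK s hs) ?_).le
    have h2 := hφ.norm_sub_le (convex_Icc 0 δ) hxD (fun u hu => hC _ (hxK u hu)) hs (hsub hu)
    refine h2.trans_lt ?_
    have h3 : |u - s| ≤ |t - s| := abs_sub_left_of_mem_uIcc hu
    rw [lt_div_iff₀ hC0] at hst
    nlinarith
  have hder : ∀ s ∈ Icc 0 δ, HasDerivWithinAt (e ∘ γ) (F (γ s)) (Icc 0 δ) s :=
    fun s hs => hasDerivWithinAt_of_forall_close (G := fun s => F (γ s)) hclose hs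
  obtain ⟨η, hη, hηD⟩ := Metric.isOpen_iff.1 (hφ.isSol x₁).isOpen 0 (hφ.zero_mem x₁)
  have hx₁d : ∀ t ∈ Ioo (-η) η, HasDerivAt (e ∘ φ x₁) (F (φ x₁ t)) t := by
    intro t ht
    refine hφ.hasDerivAt (hηD ?_)
    rw [Metric.mem_ball, Real.dist_eq, sub_zero, abs_lt]
    exact ht
  -- The limit curve is defined only for nonnegative times. Since `IsSol` demands an open interval
  -- around `0`, the solution `φ x₁` supplies the negative times.
  have hglue := hasDerivAt_glue (e := e) (F := F) (γ₁ := φ x₁) (γ₂ := γ) (a := -η) (b := 0) (c := δ)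
    ((hφ.apply_zero x₁).trans hγ0.symm) (fun t ht => hx₁d t ⟨ht.1, ht.2.trans hη⟩)
    (fun t ht => (hder t ⟨ht.1.le, ht.2.le⟩).hasDerivAt (Icc_mem_nhds ht.1 ht.2))
    (hx₁d 0 ⟨by linarith, hη⟩).hasDerivWithinAt
    ((hder 0 ⟨le_rfl, hδ.le⟩).mono_of_mem_nhdsWithin (Icc_mem_nhdsGE hδ))
  have hsol : IsSol e F x₁ (Ioo (-η) δ) (fun t => if t < 0 then φ x₁ t else γ t) :=
    ⟨isOpen_Ioo, ordConnected_Ioo, ⟨by linarith, hδ⟩, by simp [hγ0], hglue⟩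
  have heq := (hφ.extends_isSol _ _ _ hsol).2 (show t₁ ∈ Ioo (-η) δ from ⟨by linarith [ht₁.1], ht₁.2⟩)
  simp only [not_lt.2 ht₁.1, if_false] at heq
  rw [← heq]
  exact (hγ t₁ ⟨ht₁.1, ht₁.2.le⟩).2

theorem exists_local_continuousOn [CompleteSpace H] [LocallyCompactSpace M] [T2Space M]
    (hφ : IsUniversalFlow e F D φ) (he : IsEmbedding e) (hF : Continuous F) (x₀ : M) {N : Set M}
    (hN : N ∈ 𝓝 x₀) : ∃ δ > 0, ∃ O, IsOpen O ∧ x₀ ∈ O ∧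
      (∀ x ∈ O, Icc 0 δ ⊆ D x ∧ ∀ t ∈ Icc 0 δ, φ x t ∈ N) ∧
      ContinuousOn (fun p : M × ℝ => φ p.1 p.2) (O ×ˢ Ico 0 δ) := by
  obtain ⟨K, hK, hKN, δ, hδ, O, hO, hx₀, hOK⟩ := hφ.exists_uniform_time he hF x₀ hN
  refine ⟨δ, hδ, O, hO, hx₀, fun x hx => ⟨(hOK x hx).1, fun t ht => hKN ((hOK x hx).2 t ht)⟩, ?_⟩
  obtain ⟨C, hC⟩ := hK.exists_bound_of_continuousOn hF.continuousOn
  rintro ⟨x₁, t₁⟩ ⟨hx₁, ht₁⟩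
  simp only at hx₁ ht₁
  rw [ContinuousWithinAt, he.tendsto_nhds_iff]
  have h1 := hφ.tendsto_apply_of_uniform_time he hF hK hO hδ hOK hx₁ ht₁
  have h2 : Tendsto (fun p : M × ℝ => e (φ p.1 t₁)) (𝓝[O ×ˢ Ico 0 δ] (x₁, t₁))
      (𝓝 (e (φ x₁ t₁))) :=
    ((he.continuous.tendsto _).comp h1).comp
      (continuous_fst.tendsto' _ _ rfl |>.mono_left nhdsWithin_le_nhds)
  have h3 : Tendsto (fun p : M × ℝ => e (φ p.1 p.2) - e (φ p.1 t₁)) (𝓝[O ×ˢ Ico 0 δ] (x₁, t₁))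
      (𝓝 0) := by
    have hb : Tendsto (fun p : M × ℝ => C * |p.2 - t₁|) (𝓝[O ×ˢ Ico 0 δ] (x₁, t₁)) (𝓝 0) := by
      have : Continuous fun p : M × ℝ => C * |p.2 - t₁| := by fun_prop
      exact (this.tendsto' (x₁, t₁) 0 (by simp)).mono_left nhdsWithin_le_nhds
    refine squeeze_zero_norm' ?_ hb
    filter_upwards [self_mem_nhdsWithin] with p hp
    exact hφ.norm_sub_le (convex_Icc 0 δ) (hOK _ hp.1).1 (fun u hu => hC _ ((hOK _ hp.1).2 u hu))
      ⟨ht₁.1, ht₁.2.le⟩ ⟨hp.2.1, hp.2.2.le⟩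
  have := h3.add h2
  simpa [Function.comp_def] using this

end IsUniversalFlow

end AbstractFlowContinuity

/-! ### Basins of attraction and absence of returns -/

section AbstractBasin

variable {M H : Type*} [TopologicalSpace M] [NormedAddCommGroup H] [NormedSpace ℝ H]

/-- The points whose forward solution exists for all times and converges to `A`. -/
def attractedTo (D : M → Set ℝ) (φ : M → ℝ → M) (A : Set M) : Set M :=
  {x | Ici 0 ⊆ D x ∧ Tendsto (φ x) atTop (𝓝ˢ A)}

/-- Asymptotic stability of `A` for the flow `φ`, without the invariance of `A`. -/
def IsFlowStable (D : M → Set ℝ) (φ : M → ℝ → M) (A : Set M) : Prop :=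
  ∀ W : Set M, IsOpen W → A ⊆ W → ∃ V : Set M, IsOpen V ∧ A ⊆ V ∧
    ∀ x ∈ V, Ici 0 ⊆ D x ∧ (∀ t, 0 ≤ t → φ x t ∈ W) ∧ Tendsto (φ x) atTop (𝓝ˢ A)

namespace IsUniversalFlow

variable {e F : M → H} {D : M → Set ℝ} {φ : M → ℝ → M}

theorem eventually_mem_and_tendsto_add (hφ : IsUniversalFlow e F D φ) {x₀ : M} {O : Set M} {δ : ℝ}
    (hO : IsOpen O) (hOD : ∀ x ∈ O, Icc 0 δ ⊆ D x)
    (hc : ContinuousOn (fun p : M × ℝ => φ p.1 p.2) (O ×ˢ Ico 0 δ)) {t s : ℝ}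
    (ht : t ∈ D x₀) (htO : φ x₀ t ∈ O) (hs : s ∈ Ico 0 δ)
    (hev : ∀ᶠ x in 𝓝 x₀, t ∈ D x) (hlim : Tendsto (fun x => φ x t) (𝓝 x₀) (𝓝 (φ x₀ t))) :
    (∀ᶠ x in 𝓝 x₀, s + t ∈ D x) ∧
      Tendsto (fun x => φ x (s + t)) (𝓝 x₀) (𝓝 (φ x₀ (s + t))) := by
  have hevO : ∀ᶠ x in 𝓝 x₀, φ x t ∈ O := hlim (hO.mem_nhds htO)
  have hmem : ∀ᶠ x in 𝓝 x₀, s + t ∈ D x := by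
    filter_upwards [hev, hevO] with x hx hxO
    exact (hφ.mem_shift_iff hx).1 (hOD _ hxO ⟨hs.1, hs.2.le⟩)
  refine ⟨hmem, ?_⟩
  have h1 : Tendsto (fun x => φ (φ x t) s) (𝓝 x₀) (𝓝 (φ (φ x₀ t) s)) := by
    have h2 : Tendsto (fun x => (φ x t, s)) (𝓝 x₀) (𝓝[O ×ˢ Ico 0 δ] (φ x₀ t, s)) := by
      refine tendsto_nhdsWithin_iff.2 ⟨hlim.prodMk_nhds tendsto_const_nhds, ?_⟩
      filter_upwards [hevO] with x hx using ⟨hx, hs⟩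
    exact (hc (φ x₀ t, s) ⟨htO, hs⟩).tendsto.comp h2
  have hmem₀ : s + t ∈ D x₀ := hmem.self_of_nhds
  rw [hφ.apply_add ht hmem₀]
  refine h1.congr' ?_
  filter_upwards [hev, hmem] with x hx hxs
  rw [hφ.apply_add hx hxs]

/-- The local statement is propagated along the orbit of `x₀`. The step length `δ` in `hloc` is
uniform for start times near `t`, so a limit time is reached from a slightly earlier good time. -/
theorem eventually_mem_and_tendsto [CompleteSpace H] [LocallyCompactSpace M] [T2Space M]
    (hφ : IsUniversalFlow e F D φ) (he : IsEmbedding e) (hF : Continuous F) {x₀ : M} {T : ℝ}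
    (hT0 : 0 ≤ T) (hT : T ∈ D x₀) :
    (∀ᶠ x in 𝓝 x₀, T ∈ D x) ∧ Tendsto (fun x => φ x T) (𝓝 x₀) (𝓝 (φ x₀ T)) := by
  let good : ℝ → Prop := fun t =>
    (∀ᶠ x in 𝓝 x₀, t ∈ D x) ∧ Tendsto (fun x => φ x t) (𝓝 x₀) (𝓝 (φ x₀ t))
  have hTD := hφ.Icc_subset hT
  have h0 : good 0 := by
    refine ⟨Eventually.of_forall fun x => hφ.zero_mem x, ?_⟩
    simp only [hφ.apply_zero]
    exact tendsto_id
  have hloc : ∀ t ∈ Icc 0 T, ∃ η > 0, ∃ δ > 0, ∀ u ∈ Icc 0 T, |u - t| < η → good u →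
      ∀ s ∈ Ico 0 δ, good (s + u) := by
    intro t ht
    obtain ⟨δ, hδ, O, hO, hzO, hOD, hc⟩ :=
      hφ.exists_local_continuousOn he hF (φ x₀ t) univ_mem
    have hcont := hφ.continuousAt he.isInducing (hTD ht)
    obtain ⟨η, hη, hb⟩ := Metric.eventually_nhds_iff.1 (hcont.eventually (hO.mem_nhds hzO))
    refine ⟨η, hη, δ, hδ, fun u hu hut hgu s hs => ?_⟩
    exact hφ.eventually_mem_and_tendsto_add hO (fun x hx => (hOD x hx).1) hc (hTD hu)
      (hb (by rwa [Real.dist_eq])) hs hgu.1 hgu.2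
  have hsub : Icc 0 T ⊆ {t | ∀ u ∈ Icc 0 t, good u} := by
    refine IsClosed.Icc_subset_of_forall_exists_gt ?_ ?_ ?_
    · refine isClosed_of_closure_subset fun t ht => ?_
      have htI : t ∈ Icc 0 T := by
        have := closure_mono inter_subset_right ht
        rwa [isClosed_Icc.closure_eq] at this
      refine ⟨?_, htI⟩
      have hlt : ∀ u ∈ Ico 0 t, good u := by
        intro u hu
        obtain ⟨v, hv, hvS⟩ := mem_closure_iff.1 ht (Ioi u) isOpen_Ioi hu.2
        exact hvS.1 u ⟨hu.1, le_of_lt hv⟩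
      intro u hu
      rcases hu.2.lt_or_eq with h | rfl
      · exact hlt u ⟨hu.1, h⟩
      rcases hu.1.eq_or_lt with h | h
      · rw [← h]; exact h0
      obtain ⟨η, hη, δ, hδ, hstep⟩ := hloc u htI
      set d := min u (min (η / 2) (δ / 2)) with hd
      have hd0 : 0 < d := by positivity
      have hdu : d ≤ u := min_le_left _ _
      have hdη : d ≤ η / 2 := (min_le_right _ _).trans (min_le_left _ _)
      have hdδ : d ≤ δ / 2 := (min_le_right _ _).trans (min_le_right _ _)
      have := hstep (u - d) ⟨by linarith, by linarith [htI.2]⟩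
        (by rw [sub_sub_cancel_left, abs_neg, abs_of_pos hd0]; linarith)
        (hlt _ ⟨by linarith, by linarith⟩) d ⟨hd0.le, by linarith⟩
      rwa [add_sub_cancel] at this
    · intro u hu
      rw [Icc_self, mem_singleton_iff] at hu
      rwa [hu]
    · rintro t ⟨htS, htI⟩ y hy
      obtain ⟨η, hη, δ, hδ, hstep⟩ := hloc t ⟨htI.1, htI.2.le⟩
      refine ⟨min y (t + δ / 2), ?_, ⟨lt_min hy (by linarith), min_le_left _ _⟩⟩
      intro s hs
      rcases le_or_gt s t with h | h
      · exact htS s ⟨hs.1, h⟩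
      · have := hstep t ⟨htI.1, htI.2.le⟩ (by simpa using hη) (htS t ⟨htI.1, le_rfl⟩) (s - t)
          ⟨by linarith, by linarith [hs.2.trans (min_le_right _ _)]⟩
        rwa [sub_add_cancel] at this
  exact hsub ⟨hT0, le_rfl⟩ T ⟨hT0, le_rfl⟩

theorem continuousOn_forward [CompleteSpace H] [LocallyCompactSpace M] [T2Space M]
    (hφ : IsUniversalFlow e F D φ) (he : IsEmbedding e) (hF : Continuous F) :
    ContinuousOn (fun p : M × ℝ => φ p.1 p.2) {p | 0 ≤ p.2 ∧ p.2 ∈ D p.1} := by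
  rintro ⟨x₀, t₀⟩ ⟨ht₀, htD⟩
  simp only at ht₀ htD
  obtain ⟨δ, hδ, O, hO, hzO, hOD, hc⟩ :=
    hφ.exists_local_continuousOn he hF (φ x₀ t₀) univ_mem
  have hcont := hφ.continuousAt he.isInducing htD
  obtain ⟨η, hη, hb⟩ := Metric.eventually_nhds_iff.1 (hcont.eventually (hO.mem_nhds hzO))
  -- Local continuity is available only for times in `[0, δ)`, so the flow is restarted slightly
  -- before `t₀`; then times on both sides of `t₀` are reached. If `t₀ = 0`, only later times matter
  -- and `t = t₀` suffices.
  obtain ⟨t, ht0, htt, htη, htδ, hev⟩ : ∃ t, 0 ≤ t ∧ t ≤ t₀ ∧ t₀ - t < η ∧ t₀ - t < δ ∧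
      ∀ᶠ u in 𝓝 t₀, 0 ≤ u → t ≤ u := by
    rcases ht₀.eq_or_lt with h | h
    · exact ⟨t₀, ht₀, le_rfl, by simpa using hη, by simpa using hδ,
        Eventually.of_forall fun u hu => h ▸ hu⟩
    · set d := min t₀ (min (η / 2) (δ / 2)) with hd
      have hd0 : 0 < d := by positivity
      have hdu : d ≤ t₀ := min_le_left _ _
      have hdη : d ≤ η / 2 := (min_le_right _ _).trans (min_le_left _ _)
      have hdδ : d ≤ δ / 2 := (min_le_right _ _).trans (min_le_right _ _)
      refine ⟨t₀ - d, by linarith, by linarith, by linarith, by linarith, ?_⟩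
      filter_upwards [lt_mem_nhds (show t₀ - d < t₀ by linarith)] with u hu _ using hu.le
  have htD' : t ∈ D x₀ := hφ.Icc_subset htD ⟨ht0, htt⟩
  obtain ⟨hevt, hlimt⟩ := hφ.eventually_mem_and_tendsto he hF ht0 htD'
  have htO : φ x₀ t ∈ O := hb (by
    rw [Real.dist_eq, abs_sub_comm, abs_of_nonneg (by linarith)]; exact htη)
  set S : Set (M × ℝ) := {p | 0 ≤ p.2 ∧ p.2 ∈ D p.1}
  have hfst : Tendsto (Prod.fst : M × ℝ → M) (𝓝[S] (x₀, t₀)) (𝓝 x₀) :=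
    (continuous_fst.tendsto' _ _ rfl).mono_left nhdsWithin_le_nhds
  have hsnd : Tendsto (Prod.snd : M × ℝ → ℝ) (𝓝[S] (x₀, t₀)) (𝓝 t₀) :=
    (continuous_snd.tendsto' _ _ rfl).mono_left nhdsWithin_le_nhds
  have hev1 : ∀ᶠ p in 𝓝[S] (x₀, t₀), t ∈ D p.1 ∧ φ p.1 t ∈ O :=
    hfst.eventually (hevt.and (hlimt.eventually (hO.mem_nhds htO)))
  have hev2 : ∀ᶠ p in 𝓝[S] (x₀, t₀), p.2 - t ∈ Ico 0 δ := by
    filter_upwards [hsnd.eventually hev, self_mem_nhdsWithin,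
      hsnd.eventually (gt_mem_nhds (show t₀ < t + δ by linarith))] with p h1 h2 h3
    exact ⟨by linarith [h1 h2.1], by linarith⟩
  have hmap : Tendsto (fun p : M × ℝ => (φ p.1 t, p.2 - t)) (𝓝[S] (x₀, t₀))
      (𝓝[O ×ˢ Ico 0 δ] (φ x₀ t, t₀ - t)) := by
    refine tendsto_nhdsWithin_iff.2
      ⟨(hlimt.comp hfst).prodMk_nhds (hsnd.sub tendsto_const_nhds), ?_⟩
    filter_upwards [hev1, hev2] with p h1 h2 using ⟨h1.2, h2⟩
  have hfin := (hc (φ x₀ t, t₀ - t) ⟨htO, by simpa using htt, htδ⟩).tendsto.comp hmap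
  rw [ContinuousWithinAt]
  have e1 : φ x₀ t₀ = φ (φ x₀ t) (t₀ - t) := by
    rw [← hφ.apply_add htD' (by simpa using htD), sub_add_cancel]
  simp only
  rw [e1]
  refine hfin.congr' ?_
  filter_upwards [hev1, self_mem_nhdsWithin] with p h1 h2
  simp only [Function.comp_apply]
  rw [← hφ.apply_add h1.1 (by simpa using h2.2), sub_add_cancel]

omit [TopologicalSpace M] in
theorem tendsto_shift_iff (hφ : IsUniversalFlow e F D φ) {x : M} (hx : Ici 0 ⊆ D x) {T : ℝ}
    (hT : 0 ≤ T) {l : Filter M} : Tendsto (φ (φ x T)) atTop l ↔ Tendsto (φ x) atTop l := by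
  constructor
  · intro h
    refine (h.comp (tendsto_atTop_add_const_right _ (-T) tendsto_id)).congr' ?_
    filter_upwards [eventually_ge_atTop T] with t ht
    simp only [Function.comp_apply, id]
    rw [← hφ.apply_add (hx hT) (by simpa using hx (hT.trans ht)), neg_add_cancel_right]
  · intro h
    refine (h.comp (tendsto_atTop_add_const_right _ T tendsto_id)).congr' ?_
    filter_upwards [eventually_ge_atTop 0] with t ht
    simp only [Function.comp_apply, id]
    rw [← hφ.apply_add (hx hT) (hx (add_nonneg ht hT))]

omit [TopologicalSpace M] in
theorem Ici_subset_of_shift (hφ : IsUniversalFlow e F D φ) {x : M} {T : ℝ}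
    (hT : T ∈ D x) (h : Ici 0 ⊆ D (φ x T)) : Ici 0 ⊆ D x := by
  intro t ht
  rcases le_total t T with h' | h'
  · exact hφ.Icc_subset hT ⟨ht, h'⟩
  · have := (hφ.mem_shift_iff hT).1 (h (show (0 : ℝ) ≤ t - T by linarith))
    rwa [sub_add_cancel] at this

/-- A return would give `φ x (n * t) = x` for all `n`, so the orbit would not be eventually in the
neighbourhood `{x}ᶜ` of `A`. -/
theorem apply_ne_self [T1Space M] (hφ : IsUniversalFlow e F D φ) {A : Set M} {x : M}
    (hx : x ∈ attractedTo D φ A) (hxA : x ∉ A) {t : ℝ} (ht : 0 < t) : φ x t ≠ x := by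
  intro h
  have hn : ∀ n : ℕ, φ x (n * t) = x := by
    intro n
    induction n with
    | zero => simp [hφ.apply_zero]
    | succ n ih =>
      have : ((n + 1 : ℕ) : ℝ) * t = n * t + t := by push_cast; ring
      rw [this, hφ.apply_add (hx.1 ht.le) (hx.1 (by rw [mem_Ici]; positivity)), h, ih]
  have hmem : ({x}ᶜ : Set M) ∈ 𝓝ˢ A :=
    isOpen_compl_singleton.mem_nhdsSet.2 fun a ha hax => hxA (hax ▸ ha)
  have h1 : Tendsto (fun n : ℕ => (n : ℝ) * t) atTop atTop :=
    tendsto_natCast_atTop_atTop.atTop_mul_const ht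
  obtain ⟨n, hne⟩ := ((hx.2.comp h1).eventually hmem).exists
  exact hne (hn n)

theorem field_ne_zero [T1Space M] (hφ : IsUniversalFlow e F D φ) {A : Set M} {x : M}
    (hx : x ∈ attractedTo D φ A) (hxA : x ∉ A) : F x ≠ 0 := by
  intro h
  have hsol : IsSol e F x univ fun _ => x :=
    ⟨isOpen_univ, ordConnected_univ, mem_univ _, rfl, fun t _ => by
      rw [h]; exact hasDerivAt_const t (e x)⟩
  exact hφ.apply_ne_self hx hxA one_pos ((hφ.extends_isSol _ _ _ hsol).2 (mem_univ 1)).symm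

variable [CompleteSpace H] [LocallyCompactSpace M] [T2Space M]

/-- The orbit of `x₀` enters the set `V` given by stability at some time `T`. Nearby orbits are in
`V` at the same time, and from then on they stay in `W`. -/
theorem eventually_forward_mem (hφ : IsUniversalFlow e F D φ) (he : IsEmbedding e)
    (hF : Continuous F) {A W : Set M} (hA : IsFlowStable D φ A) {x₀ : M}
    (hx₀ : x₀ ∈ attractedTo D φ A) (hW : IsOpen W) (hAW : A ⊆ W) :
    ∃ T, 0 ≤ T ∧ ∀ᶠ x in 𝓝 x₀, x ∈ attractedTo D φ A ∧ ∀ t, T ≤ t → φ x t ∈ W := by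
  obtain ⟨V, hV, hAV, hVW⟩ := hA W hW hAW
  obtain ⟨T, hTV, hT⟩ := ((hx₀.2.eventually (hV.mem_nhdsSet.2 hAV)).and
    (eventually_ge_atTop 0)).exists
  obtain ⟨hev, hlim⟩ := hφ.eventually_mem_and_tendsto he hF hT (hx₀.1 hT)
  refine ⟨T, hT, ?_⟩
  filter_upwards [hev, hlim.eventually (hV.mem_nhds hTV)] with x hxT hxV
  obtain ⟨h1, h2, h3⟩ := hVW _ hxV
  have hx := hφ.Ici_subset_of_shift hxT h1
  refine ⟨⟨hx, (hφ.tendsto_shift_iff hx hT).1 h3⟩, fun t ht => ?_⟩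
  have := h2 (t - T) (by linarith)
  rwa [← hφ.apply_add hxT (by simpa using hx (hT.trans ht)), sub_add_cancel] at this

theorem isOpen_attractedTo (hφ : IsUniversalFlow e F D φ) (he : IsEmbedding e)
    (hF : Continuous F) {A : Set M} (hA : IsFlowStable D φ A) : IsOpen (attractedTo D φ A) := by
  refine isOpen_iff_mem_nhds.2 fun x hx => ?_
  obtain ⟨T, -, h⟩ := hφ.eventually_forward_mem he hF hA hx isOpen_univ (subset_univ _)
  exact h.mono fun x hx => hx.1

/-- Extending the flow by `max p.2 0` to negative times replaces the half-line of times by all of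
`ℝ`. As the basin of a stable set is open, this gives genuine continuity at points with time `0`. -/
theorem continuousOn_attractedTo (hφ : IsUniversalFlow e F D φ) (he : IsEmbedding e)
    (hF : Continuous F) {A : Set M} :
    ContinuousOn (fun p : M × ℝ => φ p.1 (max p.2 0)) (attractedTo D φ A ×ˢ univ) := by
  refine (hφ.continuousOn_forward he hF).comp (f := fun p : M × ℝ => (p.1, max p.2 0))
    (by fun_prop) ?_
  rintro ⟨x, t⟩ ⟨hx, -⟩
  exact ⟨le_max_right _ _, hx.1 (le_max_right t 0)⟩

omit [NormedSpace ℝ H] [CompleteSpace H] [LocallyCompactSpace M] [T2Space M] in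
theorem exists_norm_gt (he : IsEmbedding e) {A : Set M} (hA : IsClosed A) {x₀ : M} (hx₀ : x₀ ∉ A) :
    ∃ ρ > 0, ∀ a ∈ A, ρ ≤ ‖e a - e x₀‖ := by
  obtain ⟨ρ, hρ, h⟩ := exists_norm_lt_imp_mem he.isInducing (hA.isOpen_compl.mem_nhds hx₀)
  exact ⟨ρ, hρ, fun a ha => not_lt.1 fun hlt => h a hlt ha⟩

/-- After a time `T` all nearby orbits stay close to `A`, away from `x₀`. On the compact interval
`[τ, T]` the orbit of `x₀` keeps a positive distance from `x₀` by `apply_ne_self`, and so do nearby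
orbits. -/
theorem exists_no_return (hφ : IsUniversalFlow e F D φ) (he : IsEmbedding e)
    (hF : Continuous F) {A : Set M} (hA : IsFlowStable D φ A) (hAc : IsClosed A) {x₀ : M}
    (hx₀ : x₀ ∈ attractedTo D φ A) (hxA : x₀ ∉ A) {τ : ℝ} (hτ : 0 < τ) :
    ∃ ρ > 0, ∀ᶠ x in 𝓝 x₀, ∀ t, τ ≤ t → ρ ≤ ‖e (φ x t) - e x₀‖ := by
  obtain ⟨ρ₀, hρ₀, hρA⟩ := exists_norm_gt he hAc hxA
  obtain ⟨T, hT, hev⟩ := hφ.eventually_forward_mem he hF hA hx₀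
    (W := {y | ρ₀ / 2 < ‖e y - e x₀‖})
    (isOpen_lt continuous_const (by have := he.continuous; fun_prop))
    (fun a ha => lt_of_lt_of_le (by linarith) (hρA a ha))
  have hcont : ∀ t, 0 ≤ t →
      ContinuousAt (fun p : M × ℝ => ‖e (φ p.1 (max p.2 0)) - e x₀‖) (x₀, t) := by
    intro t ht
    have h1 := (hφ.continuousOn_attractedTo he hF (A := A)).continuousAt
      (((hφ.isOpen_attractedTo he hF hA).prod isOpen_univ).mem_nhds
        (show (x₀, t) ∈ attractedTo D φ A ×ˢ univ from ⟨hx₀, mem_univ _⟩))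
    exact ((he.continuous.continuousAt.comp h1).sub continuousAt_const).norm
  obtain ⟨m, hm, hmin⟩ : ∃ m > 0, ∀ t ∈ Icc τ T, m < ‖e (φ x₀ t) - e x₀‖ := by
    rcases (Icc τ T).eq_empty_or_nonempty with h | h
    · exact ⟨1, one_pos, by simp [h]⟩
    · obtain ⟨t, ht, hmin⟩ := isCompact_Icc.exists_isMinOn h
        (f := fun t => ‖e (φ x₀ t) - e x₀‖) (fun t ht =>
          ((hφ.hasDerivAt (hx₀.1 (hτ.le.trans ht.1))).continuousAt.sub
            continuousAt_const).norm.continuousWithinAt)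
      have hne := hφ.apply_ne_self hx₀ hxA (hτ.trans_le ht.1)
      have hpos : 0 < ‖e (φ x₀ t) - e x₀‖ :=
        norm_pos_iff.2 (sub_ne_zero.2 fun h => hne (he.injective h))
      exact ⟨_, half_pos hpos, fun u hu => (half_lt_self hpos).trans_le (hmin hu)⟩
  have hcomp : ∀ᶠ x in 𝓝 x₀, ∀ t ∈ Icc τ T, m < ‖e (φ x (max t 0)) - e x₀‖ := by
    refine isCompact_Icc.eventually_forall_of_forall_eventually fun t ht => ?_
    have ht0 := hτ.le.trans ht.1
    refine (hcont t ht0).eventually (lt_mem_nhds ?_)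
    simp only [max_eq_left ht0]
    exact hmin t ht
  refine ⟨min m (ρ₀ / 2), by positivity, ?_⟩
  filter_upwards [hev, hcomp] with x hx1 hx2 t ht
  rcases le_total t T with h | h
  · have := hx2 t ⟨ht, h⟩
    rw [max_eq_left (hτ.le.trans ht)] at this
    exact (min_le_left _ _).trans this.le
  · exact (min_le_right _ _).trans (hx1.2 t h).le

/-- Without returns, two points of a forward orbit near `x` are joined by an arc of duration less
than `τ`. Even if this arc leaves the ball, it stays where `F` is nearly `F x`, and the mean value
inequality applies. -/
theorem exists_straight (hφ : IsUniversalFlow e F D φ) (he : IsEmbedding e)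
    (hF : Continuous F) {A : Set M} (hA : IsFlowStable D φ A) (hAc : IsClosed A) {x₀ : M}
    (hx₀ : x₀ ∈ attractedTo D φ A) (hxA : x₀ ∉ A) :
    ∃ ρ > 0, ∀ᶠ x in 𝓝 x₀, ∀ z, ∀ s, 0 ≤ s → ‖e z - e x‖ < ρ → ‖e (φ z s) - e x‖ < ρ →
      ‖e (φ z s) - e z - s • F x‖ ≤ s * ‖F x‖ / 100 := by
  have hF0 : 0 < ‖F x₀‖ := norm_pos_iff.2 (hφ.field_ne_zero hx₀ hxA)
  -- Two such errors give `‖F x₀‖ / 200`, which is at most `‖F x‖ / 100` because `‖F x‖ ≥ 399 / 400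
  -- * ‖F x₀‖`.
  have hN : ∀ᶠ y in 𝓝 x₀, ‖F y - F x₀‖ < ‖F x₀‖ / 400 :=
    eventually_norm_map_sub_lt hF x₀ (by positivity)
  obtain ⟨τ, hτ, O, hO, hxO, hOD, -⟩ := hφ.exists_local_continuousOn he hF x₀ hN
  obtain ⟨ρ₁, hρ₁, hret⟩ := hφ.exists_no_return he hF hA hAc hx₀ hxA hτ
  obtain ⟨ρ₂, hρ₂, hball⟩ := exists_norm_lt_imp_mem he.isInducing
    (Filter.inter_mem (hO.mem_nhds hxO) hret)
  refine ⟨min ρ₁ ρ₂ / 2, by positivity, ?_⟩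
  have hnear : ∀ᶠ x in 𝓝 x₀, ‖e x - e x₀‖ < min ρ₁ ρ₂ / 2 :=
    eventually_norm_map_sub_lt he.continuous x₀ (by positivity)
  filter_upwards [hnear, hN] with x hx hFx z s hs hz hzs
  have hclose : ∀ w, ‖e w - e x‖ < min ρ₁ ρ₂ / 2 → ‖e w - e x₀‖ < min ρ₁ ρ₂ := by
    intro w hw
    have := norm_sub_le_norm_sub_add_norm_sub (e w) (e x) (e x₀)
    linarith
  obtain ⟨hzO, hzret⟩ := hball z ((hclose z hz).trans_le (min_le_right _ _))
  have hsτ : s < τ := by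
    by_contra h
    have h1 := hzret s (not_lt.1 h)
    exact absurd ((hclose _ hzs).trans_le (min_le_left _ _)) (not_lt.2 h1)
  obtain ⟨hzD, hzN⟩ := hOD z hzO
  have hsub : Icc 0 s ⊆ Icc 0 τ := Icc_subset_Icc_right hsτ.le
  have hbound : ∀ u ∈ Icc 0 s, ‖F (φ z u) - F x‖ ≤ ‖F x‖ / 100 := by
    intro u hu
    have h1 : ‖F (φ z u) - F x₀‖ < ‖F x₀‖ / 400 := hzN u (hsub hu)
    have h2 := norm_sub_le_norm_sub_add_norm_sub (F (φ z u)) (F x₀) (F x)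
    rw [norm_sub_rev (F x₀)] at h2
    have h3 := norm_sub_norm_le (F x₀) (F x)
    rw [norm_sub_rev] at h3
    linarith
  have := hφ.norm_sub_le_of_forall_mem (convex_Icc 0 s) (hsub.trans hzD) hbound
    (s := 0) (t := s) ⟨le_rfl, hs⟩ ⟨hs, le_rfl⟩
  rw [hφ.apply_zero, sub_zero, abs_of_nonneg hs] at this
  linarith

end IsUniversalFlow

end AbstractBasin

/-! ### The homotopy in the ambient space -/

section AbstractHomotopy

variable {M H : Type*} [TopologicalSpace M] [NormedAddCommGroup H] [InnerProductSpace ℝ H]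

theorem displacement_mem_range {J : H →L[ℝ] H} {f : H} (hJ : J f = f) (r : ℝ) (q : ℝ → H) :
    ∃ w, J w = displacement J f r q := by
  refine ⟨(1 - max 0 (min 1 (4 * (‖q 0‖ / r) - 2))) • q 0 +
    max 0 (min 1 (4 * (‖q 0‖ / r) - 2)) •
      (passageIntegral r q - (inner ℝ (J (passageIntegral r q)) f / ‖f‖ ^ 2) • f -
        (r / 2 - truncatedDist r q) • f), ?_⟩
  simp only [map_add, map_sub, map_smul, hJ, displacement]

/-- A radius around `x` in which the flow `φ` runs nearly straight, `J x` nearly fixes all chords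
from `x`, and which is smaller than half of the distance to `A`. -/
structure IsStraightRadius (e F : M → H) (φ : M → ℝ → M) (J : M → H →L[ℝ] H) (A : Set M)
    (x : M) (ρ : ℝ) : Prop where
  pos : 0 < ρ
  near : ∀ y, ‖e y - e x‖ < ρ → ‖J x (e y - e x) - (e y - e x)‖ ≤ ‖e y - e x‖ / 100
  straight : ∀ z s, 0 ≤ s → ‖e z - e x‖ < ρ → ‖e (φ z s) - e x‖ < ρ →
    ‖e (φ z s) - e z - s • F x‖ ≤ s * ‖F x‖ / 100
  away : ∀ a ∈ A, 2 * ρ ≤ ‖e a - e x‖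

omit [TopologicalSpace M] in
theorem IsStraightRadius.mono {e F : M → H} {φ : M → ℝ → M} {J : M → H →L[ℝ] H} {A : Set M}
    {x : M} {ρ ρ' : ℝ} (h : IsStraightRadius e F φ J A x ρ) (h0 : 0 < ρ') (hle : ρ' ≤ ρ) :
    IsStraightRadius e F φ J A x ρ' where
  pos := h0
  near y hy := h.near y (hy.trans_le hle)
  straight z s hs h1 h2 := h.straight z s hs (h1.trans_le hle) (h2.trans_le hle)
  away a ha := (mul_le_mul_of_nonneg_left hle zero_le_two).trans (h.away a ha)

variable {e F : M → H} {D : M → Set ℝ} {φ : M → ℝ → M} {J : M → H →L[ℝ] H} {A : Set M}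

theorem eventually_isStraightRadius [CompleteSpace H] [LocallyCompactSpace M] [T2Space M]
    (hφ : IsUniversalFlow e F D φ) (he : IsEmbedding e) (hF : Continuous F)
    (hA : IsFlowStable D φ A) (hAc : IsClosed A)
    (hJ : ∀ x₀, ∀ ε > 0, ∃ N ∈ 𝓝 x₀, ∀ x ∈ N, ∀ y ∈ N,
      ‖J x (e y - e x) - (e y - e x)‖ ≤ ε * ‖e y - e x‖)
    {x₀ : M} (hx₀ : x₀ ∈ attractedTo D φ A) (hxA : x₀ ∉ A) :
    ∃ ρ, ∀ᶠ x in 𝓝 x₀, IsStraightRadius e F φ J A x ρ := by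
  obtain ⟨ρ₁, hρ₁, h₁⟩ := hφ.exists_straight he hF hA hAc hx₀ hxA
  obtain ⟨N, hN, h₂⟩ := hJ x₀ (1 / 100) (by norm_num)
  obtain ⟨ρ₂, hρ₂, hball⟩ := exists_norm_lt_imp_mem he.isInducing hN
  obtain ⟨ρ₃, hρ₃, h₃⟩ := IsUniversalFlow.exists_norm_gt he hAc hxA
  refine ⟨min ρ₁ (min (ρ₂ / 2) (ρ₃ / 4)), ?_⟩
  filter_upwards [h₁, hN, eventually_norm_map_sub_lt he.continuous x₀ (half_pos hρ₂),
    eventually_norm_map_sub_lt he.continuous x₀ (half_pos hρ₃)] with x h1 h2 h3 h4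
  refine ⟨by positivity, fun y hy => ?_, fun z s hs hz hzs => h1 z s hs
    (hz.trans_le (min_le_left _ _)) (hzs.trans_le (min_le_left _ _)), fun a ha => ?_⟩
  · have hyN : y ∈ N := by
      refine hball y ?_
      have := norm_sub_le_norm_sub_add_norm_sub (e y) (e x) (e x₀)
      have := hy.trans_le ((min_le_right _ _).trans (min_le_left _ _))
      linarith
    have := h₂ x h2 y hyN
    linarith
  · have h5 := norm_sub_le_norm_sub_add_norm_sub (e a) (e x) (e x₀)
    have h6 := h₃ a ha
    have h7 : min ρ₁ (min (ρ₂ / 2) (ρ₃ / 4)) ≤ ρ₃ / 4 :=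
      (min_le_right _ _).trans (min_le_right _ _)
    linarith

/-- The chord from `x` to the point reached from `x` by flowing for time `t` along `φX` and then
for time `s` along `φY`. -/
noncomputable def chordPath (e : M → H) (φX φY : M → ℝ → M) (x : M) (t s : ℝ) : H :=
  e (φY (φX x (max t 0)) (max s 0)) - e x

theorem isNearlyStraight_chordPath [CompleteSpace H] [LocallyCompactSpace M] [T2Space M]
    (hφ : IsUniversalFlow e F D φ) (he : IsEmbedding e) (hF : Continuous F)
    {φX : M → ℝ → M} {x : M} {t r : ℝ} (hF0 : F x ≠ 0)
    (hr : IsStraightRadius e F φ J A x r)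
    (hy : φX x (max t 0) ∈ attractedTo D φ A) :
    IsNearlyStraight (J x) (F x) r (chordPath e φX φ x t) where
  pos := hr.pos
  continuous := by
    have h1 : Continuous fun s : ℝ => (φX x (max t 0), s) := by fun_prop
    have h2 := (hφ.continuousOn_attractedTo he hF (A := A)).comp_continuous h1
      fun s => ⟨hy, mem_univ s⟩
    exact (he.continuous.comp h2).sub continuous_const
  ne_zero := hF0
  near s hs h := hr.near _ h
  straight s₁ s₂ h₁ h₁₂ hq₁ hq₂ := by
    have h₂ := h₁.trans h₁₂
    simp only [chordPath, max_eq_left h₁, max_eq_left h₂] at hq₁ hq₂ ⊢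
    have e1 : φ (φX x (max t 0)) s₂ = φ (φ (φX x (max t 0)) s₁) (s₂ - s₁) := by
      rw [← hφ.apply_add (hy.1 h₁) (by simpa using hy.1 h₂), sub_add_cancel]
    rw [e1] at hq₂ ⊢
    rw [sub_sub_sub_cancel_right]
    exact hr.straight _ _ (sub_nonneg.2 h₁₂) hq₁ hq₂
  escapes := by
    have hW : {z | r < ‖e z - e x‖} ∈ 𝓝ˢ A := by
      refine (isOpen_lt continuous_const
        (by have := he.continuous; fun_prop)).mem_nhdsSet.2 fun a ha => ?_
      have := hr.away a ha
      have := hr.pos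
      change r < ‖e a - e x‖
      linarith
    obtain ⟨T, hT⟩ := eventually_atTop.1 (hy.2.eventually hW)
    refine ⟨max T 0, fun s hs => ?_⟩
    rw [chordPath, max_eq_left ((le_max_right _ _).trans hs)]
    exact (hT s ((le_max_left _ _).trans hs)).le

/-- The difference quotient of `e` along the flow, continuously extended to time `0`. -/
noncomputable def diffQuotient (e F : M → H) (φ : M → ℝ → M) (x : M) (t : ℝ) : H :=
  if 0 < t then t⁻¹ • (e (φ x t) - e x) else F x

theorem continuousAt_diffQuotient [CompleteSpace H] [LocallyCompactSpace M] [T2Space M]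
    (hφ : IsUniversalFlow e F D φ) (he : IsEmbedding e) (hF : Continuous F)
    (hA : IsFlowStable D φ A) {x₀ : M} (hx₀ : x₀ ∈ attractedTo D φ A) :
    ContinuousAt (fun p : M × ℝ => diffQuotient e F φ p.1 p.2) (x₀, 0) := by
  have hopen := hφ.isOpen_attractedTo he hF hA
  have hc : ContinuousAt (fun p : M × ℝ => ‖F (φ p.1 (max p.2 0)) - F x₀‖) (x₀, 0) := by
    have h1 := (hφ.continuousOn_attractedTo he hF (A := A)).continuousAt
      ((hopen.prod isOpen_univ).mem_nhds
        (show (x₀, (0 : ℝ)) ∈ attractedTo D φ A ×ˢ univ from ⟨hx₀, mem_univ _⟩))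
    exact ((hF.continuousAt.comp h1).sub continuousAt_const).norm
  rw [Metric.continuousAt_iff']
  intro ε hε
  have hev : ∀ᶠ p : M × ℝ in 𝓝 (x₀, 0), ‖F (φ p.1 (max p.2 0)) - F x₀‖ < ε / 2 :=
    hc.eventually (gt_mem_nhds (by
      simp only [max_self, hφ.apply_zero, sub_self, norm_zero]; positivity))
  rw [nhds_prod_eq, eventually_prod_iff] at hev
  obtain ⟨P, hP, Q, hQ, hPQ⟩ := hev
  obtain ⟨η, hη, hQη⟩ := Metric.eventually_nhds_iff.1 hQ
  rw [nhds_prod_eq]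
  filter_upwards [(hP.and (hopen.mem_nhds hx₀)).prod_mk (Metric.ball_mem_nhds (0 : ℝ) hη)]
    with p hp
  obtain ⟨⟨hpP, hpA⟩, hpη⟩ := hp
  rw [Real.dist_eq, sub_zero] at hpη
  have h0 : diffQuotient e F φ x₀ 0 = F x₀ := if_neg (lt_irrefl _)
  rw [h0, dist_eq_norm, diffQuotient]
  have hbound : ∀ u, 0 ≤ u → u ≤ |p.2| → ‖F (φ p.1 u) - F x₀‖ ≤ ε / 2 := by
    intro u hu0 hu
    have := hPQ hpP (hQη (y := u) (by
      rw [Real.dist_eq, sub_zero, abs_of_nonneg hu0]; exact hu.trans_lt hpη))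
    simp only [max_eq_left hu0] at this
    exact this.le
  split_ifs with h
  · have h1 := hφ.norm_sub_le_of_forall_mem (convex_Icc 0 p.2)
      (fun u hu => hpA.1 hu.1) (fun u hu => hbound u hu.1 (hu.2.trans (le_abs_self _)))
      (s := 0) (t := p.2) ⟨le_rfl, h.le⟩ ⟨h.le, le_rfl⟩
    rw [hφ.apply_zero, sub_zero, abs_of_pos h] at h1
    have h2 : p.2⁻¹ • (e (φ p.1 p.2) - e p.1) - F x₀ =
        p.2⁻¹ • (e (φ p.1 p.2) - e p.1 - p.2 • F x₀) := by
      rw [smul_sub p.2⁻¹ _ (p.2 • F x₀), inv_smul_smul₀ h.ne']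
    rw [h2, norm_smul, norm_inv, Real.norm_of_nonneg h.le, inv_mul_lt_iff₀ h]
    nlinarith
  · have := hbound 0 le_rfl (abs_nonneg _)
    rw [hφ.apply_zero] at this
    linarith

/-- The vector obtained by comparing the point `φX x t` with the flow `φY`, divided by `t`, and
extended to `t = 0` by the vector field of `φX`. -/
noncomputable def rescaledDisplacement (e FX FY : M → H) (φX φY : M → ℝ → M) (J : M → H →L[ℝ] H)
    (x : M) (r t : ℝ) : H :=
  if 0 < t then t⁻¹ • displacement (J x) (FY x) r (chordPath e φX φY x t) else FX x

set_option maxHeartbeats 400000 in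
/-- A path of nonvanishing tangent vectors, depending on the point, from the vector field of `φX` to
a positive multiple of the vector field of `φY`. -/
theorem exists_displacement_path [CompleteSpace H] [LocallyCompactSpace M] [T2Space M]
    {FX FY : M → H} {DX DY : M → Set ℝ} {φX φY : M → ℝ → M}
    (hX : IsUniversalFlow e FX DX φX) (hY : IsUniversalFlow e FY DY φY) (he : IsEmbedding e)
    (hFX : Continuous FX) (hFY : Continuous FY) (hXA : IsFlowStable DX φX A)
    (hYA : IsFlowStable DY φY A) (hAc : IsClosed A) (hJc : Continuous J)
    (hJX : ∀ x, J x (FX x) = FX x) (hJY : ∀ x, J x (FY x) = FY x)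
    (hJ : ∀ x₀, ∀ ε > 0, ∃ N ∈ 𝓝 x₀, ∀ x ∈ N, ∀ y ∈ N,
      ‖J x (e y - e x) - (e y - e x)‖ ≤ ε * ‖e y - e x‖)
    {U : Set M} (hUX : U ⊆ attractedTo DX φX A)
    (hUY : ∀ x ∈ U, ∀ t, 0 ≤ t → φX x t ∈ attractedTo DY φY A) :
    ∃ K : (U \ A : Set M) → ℝ → H, ∃ T : C((U \ A : Set M), ℝ), ∃ c : (U \ A : Set M) → ℝ,
      Continuous (Function.uncurry K) ∧ (∀ x t, K x t ≠ 0) ∧ (∀ (x : (U \ A : Set M)) (t : ℝ), ∃ w, J x w = K x t) ∧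
        (∀ x, K x 0 = FX x) ∧ (∀ x, 0 < c x) ∧ ∀ x, K x (T x) = c x • FY x := by
  -- Metrizability provides the partitions of unity on `U \ A`.
  let := he.comapMetricSpace
  set S : Set M := U \ A with hS
  have hSX : ∀ x : S, (x : M) ∈ attractedTo DX φX A := fun x => hUX x.2.1
  have hSY : ∀ (x : S) (t : ℝ), φX x (max t 0) ∈ attractedTo DY φY A :=
    fun x t => hUY x x.2.1 _ (le_max_right _ _)
  have hSY0 : ∀ x : S, (x : M) ∈ attractedTo DY φY A := fun x => by
    have := hSY x 0
    rwa [max_self, hX.apply_zero] at this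
  have hSA : ∀ x : S, (x : M) ∉ A := fun x => x.2.2
  have hFX0 : ∀ x : S, FX x ≠ 0 := fun x => hX.field_ne_zero (hSX x) (hSA x)
  have hFY0 : ∀ x : S, FY x ≠ 0 := fun x => hY.field_ne_zero (hSY0 x) (hSA x)
  have hval : ∀ (x₀ : S) {p : M → Prop}, (∀ᶠ x in 𝓝 (x₀ : M), p x) → ∀ᶠ x : S in 𝓝 x₀, p x :=
    fun x₀ p h => continuous_subtype_val.continuousAt.eventually h
  -- the radii
  obtain ⟨r, hr⟩ : ∃ r : C(S, ℝ), ∀ x : S, IsStraightRadius e FY φY J A x (r x) := by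
    refine exists_continuous_forall_mem_convex_of_local_const
      (t := fun x : S => {ρ | IsStraightRadius e FY φY J A x ρ}) (fun x => ?_) fun x => ?_
    · exact OrdConnected.convex ⟨fun a ha b hb c hc => IsStraightRadius.mono hb
        (ha.pos.trans_le hc.1) hc.2⟩
    · obtain ⟨ρ, hρ⟩ := eventually_isStraightRadius hY he hFY hYA hAc hJ (hSY0 x) (hSA x)
      exact ⟨ρ, hval x hρ⟩
  have hr0 : ∀ x, 0 < r x := fun x => (hr x).pos
  have hfar : ∀ x₀ : S, ∃ W : Set M, IsOpen W ∧ A ⊆ W ∧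
      ∀ᶠ x : S in 𝓝 x₀, ∀ z ∈ W, r x ≤ ‖e z - e x‖ := by
    intro x₀
    -- Points of `A` are at distance at least `2 * r x₀`, so there is room: `3 / 2 - 1 / 4 = 5 / 4`
    -- absorbs both moving `x` and the variation of `r x`.
    refine ⟨{z | 3 / 2 * r x₀ < ‖e z - e x₀‖},
      isOpen_lt continuous_const (by have := he.continuous; fun_prop), fun a ha => ?_, ?_⟩
    · have := (hr x₀).away a ha
      have := hr0 x₀
      change 3 / 2 * r x₀ < ‖e a - e x₀‖
      linarith
    · have h1 := hval x₀ (eventually_norm_map_sub_lt he.continuous (x₀ : M)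
        (show 0 < r x₀ / 4 by linarith [hr0 x₀]))
      have h2 : ∀ᶠ x in 𝓝 x₀, r x < 5 / 4 * r x₀ :=
        r.continuous.continuousAt.eventually (gt_mem_nhds (by linarith [hr0 x₀]))
      filter_upwards [h1, h2] with x hx1 hx2 z hz
      have := norm_sub_le_norm_sub_add_norm_sub (e z) (e x) (e x₀)
      have hz' : 3 / 2 * r x₀ < ‖e z - e x₀‖ := hz
      linarith
  -- the times after which the flow of `Y` no longer returns
  obtain ⟨T, hT⟩ : ∃ T : C(S, ℝ), ∀ x : S, T x ∈ {τ : ℝ | 0 < τ ∧ ∀ t, τ ≤ t → ∀ s, 0 ≤ s →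
      r x ≤ ‖e (φY (φX x t) s) - e x‖} := by
    refine exists_continuous_forall_mem_convex_of_local_const (fun x => ?_) fun x => ?_
    · exact OrdConnected.convex ⟨fun a ha b hb c hc =>
        ⟨ha.1.trans_le hc.1, fun t ht => ha.2 t (hc.1.trans ht)⟩⟩
    · obtain ⟨W, hW, hAW, hev⟩ := hfar x
      -- Two stabilities are combined: `Y`-orbits from `V` stay in `W`, far from `x`, and `X`-orbits
      -- stay in `V` after time `τ`.
      obtain ⟨V, hV, hAV, hVW⟩ := hYA W hW hAW
      obtain ⟨τ, hτ, hevτ⟩ := hX.eventually_forward_mem he hFX hXA (hSX x) hV hAV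
      refine ⟨τ + 1, ?_⟩
      filter_upwards [hev, hval x hevτ] with y hy1 hy2
      exact ⟨by linarith, fun t ht s hs =>
        hy1 _ ((hVW _ (hy2.2 t (by linarith))).2.1 s hs)⟩
  have hXc : Continuous fun p : S × ℝ => φX p.1 (max p.2 0) := by
    have h1 : Continuous fun p : S × ℝ => ((p.1 : M), p.2) := by fun_prop
    exact (hX.continuousOn_attractedTo he hFX (A := A)).comp_continuous h1
      fun p => ⟨hSX p.1, mem_univ _⟩
  have hDc : Continuous fun p : S × ℝ =>
      displacement (J p.1) (FY p.1) (r p.1) (chordPath e φX φY p.1 p.2) := by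
    refine continuous_displacement (hJc.comp (by fun_prop)) (hFY.comp (by fun_prop))
      (fun p => hFY0 p.1) (by fun_prop) (fun p => hr0 p.1) ?_ ?_
    · have h1 : Continuous fun p : (S × ℝ) × ℝ => (φX p.1.1 (max p.1.2 0), p.2) :=
        (hXc.comp continuous_fst).prodMk continuous_snd
      have h2 := (hY.continuousOn_attractedTo he hFY (A := A)).comp_continuous h1
        fun p => ⟨hSY p.1.1 p.1.2, mem_univ _⟩
      exact (he.continuous.comp h2).sub
        (he.continuous.comp (continuous_subtype_val.comp (continuous_fst.comp continuous_fst)))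
    · intro p₀
      obtain ⟨W, hW, hAW, hev⟩ := hfar p₀.1
      obtain ⟨τ, hτ, hevτ⟩ := hY.eventually_forward_mem he hFY hYA (hSY p₀.1 p₀.2) hW hAW
      refine ⟨τ, ?_⟩
      filter_upwards [hXc.continuousAt.eventually hevτ,
        continuous_fst.continuousAt.eventually hev] with p hp1 hp2 s hs
      rw [chordPath, max_eq_left (hτ.trans hs)]
      exact hp2 _ (hp1.2 s hs)
  have hq0 : ∀ (x : S) (t : ℝ), chordPath e φX φY x t 0 = e (φX x (max t 0)) - e x := by
    intro x t
    rw [chordPath, max_self, hY.apply_zero]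
  have hKc : Continuous fun p : S × ℝ =>
      rescaledDisplacement e FX FY φX φY J p.1 (r p.1) p.2 := by
    rw [continuous_iff_continuousAt]
    rintro ⟨x₀, t₀⟩
    rcases lt_trichotomy t₀ 0 with h | h | h
    · have h1 : Continuous fun p : S × ℝ => FX p.1 := hFX.comp (by fun_prop)
      refine h1.continuousAt.congr ?_
      filter_upwards [continuous_snd.continuousAt.eventually
        (gt_mem_nhds (show ((x₀, t₀) : S × ℝ).2 < 0 from h))] with p hp
      rw [rescaledDisplacement, if_neg (not_lt.2 hp.le)]
    · subst h
      have h1 : ContinuousAt (fun p : S × ℝ => J p.1 (diffQuotient e FX φX p.1 p.2)) (x₀, 0) := by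
        have h2 : ContinuousAt (fun p : S × ℝ => diffQuotient e FX φX p.1 p.2) (x₀, 0) :=
          (show ContinuousAt (fun p : M × ℝ => diffQuotient e FX φX p.1 p.2)
            ((fun p : S × ℝ => ((p.1 : M), p.2)) (x₀, 0)) from
              continuousAt_diffQuotient hX he hFX hXA (hSX x₀)).comp
            (f := fun p : S × ℝ => ((p.1 : M), p.2)) (x := (x₀, 0))
            (by fun_prop : Continuous fun p : S × ℝ => ((p.1 : M), p.2)).continuousAt
        have h3 : Continuous fun p : S × ℝ => J p.1 := hJc.comp (by fun_prop)
        exact h3.continuousAt.clm_apply h2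
      -- For small `t` the chord is shorter than `r / 2`, so the rescaled displacement is `J` of the
      -- difference quotient, whose limit `FX x₀` is fixed by `J`.
      refine h1.congr ?_
      have h4 : Continuous fun p : S × ℝ => ‖e (φX p.1 (max p.2 0)) - e p.1‖ - r p.1 / 2 :=
        ((he.continuous.comp hXc).sub (he.continuous.comp
          (continuous_subtype_val.comp continuous_fst))).norm.sub
          ((r.continuous.comp continuous_fst).div_const 2)
      have h5 : ‖e (φX x₀ (max 0 0)) - e x₀‖ - r x₀ / 2 < 0 := by
        rw [max_self, hX.apply_zero, sub_self, norm_zero]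
        linarith [hr0 x₀]
      filter_upwards [h4.continuousAt.eventually (gt_mem_nhds (a := 0) h5)] with p hp
      rw [rescaledDisplacement, diffQuotient]
      split_ifs with h
      · rw [IsNearlyStraight.displacement_of_norm_le (by rw [hq0]; linarith) (hr0 _), hq0,
          max_eq_left h.le, map_smul]
      · exact hJX _
    · have h1 : ContinuousAt (fun p : S × ℝ => p.2⁻¹ •
          displacement (J p.1) (FY p.1) (r p.1) (chordPath e φX φY p.1 p.2)) (x₀, t₀) :=
        (continuous_snd.continuousAt.inv₀ h.ne').smul hDc.continuousAt
      refine h1.congr ?_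
      filter_upwards [continuous_snd.continuousAt.eventually
        (lt_mem_nhds (show 0 < ((x₀, t₀) : S × ℝ).2 from h))] with p hp
      rw [rescaledDisplacement, if_pos hp]
  have hK0 : ∀ (x : S) (t : ℝ), rescaledDisplacement e FX FY φX φY J x (r x) t ≠ 0 := by
    intro x t
    rw [rescaledDisplacement]
    split_ifs with h
    · refine smul_ne_zero (inv_ne_zero h.ne') ?_
      refine (isNearlyStraight_chordPath hY he hFY (hFY0 x) (hr x)
        (hSY x t)).displacement_ne_zero ?_
      rw [hq0, max_eq_left h.le]
      exact sub_ne_zero.2 fun h' => hX.apply_ne_self (hSX x) (hSA x) h (he.injective h')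
    · exact hFX0 x
  have hKrange : ∀ (x : S) (t : ℝ),
      ∃ w, J x w = rescaledDisplacement e FX FY φX φY J x (r x) t := by
    intro x t
    rw [rescaledDisplacement]
    split_ifs with h
    · obtain ⟨w, hw⟩ := displacement_mem_range (hJY x) (r x) (chordPath e φX φY x t)
      exact ⟨t⁻¹ • w, by rw [map_smul, hw]⟩
    · exact ⟨_, hJX x⟩
  have hKT : ∀ x : S, rescaledDisplacement e FX FY φX φY J x (r x) (T x) =
      ((T x)⁻¹ * (r x / 2)) • FY x := by
    intro x
    rw [rescaledDisplacement, if_pos (hT x).1, IsNearlyStraight.displacement_of_forall_le_norm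
      (fun s hs => ?_) (hr0 x), smul_smul]
    rw [chordPath, max_eq_left hs, max_eq_left (hT x).1.le]
    exact (hT x).2 _ le_rfl s hs
  exact ⟨fun x t => rescaledDisplacement e FX FY φX φY J x (r x) t, T,
    fun x => (T x)⁻¹ * (r x / 2), hKc, hK0, hKrange, fun x => if_neg (lt_irrefl _),
    fun x => mul_pos (inv_pos.2 (hT x).1) (half_pos (hr0 x)), hKT⟩

/-- The homotopy, in the ambient space `H`, between two vector fields for which `A` is
asymptotically stable. -/
theorem exists_ambient_homotopy [CompleteSpace H] [LocallyCompactSpace M] [T2Space M]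
    {FX FY : M → H} {DX DY : M → Set ℝ} {φX φY : M → ℝ → M}
    (hX : IsUniversalFlow e FX DX φX) (hY : IsUniversalFlow e FY DY φY) (he : IsEmbedding e)
    (hFX : Continuous FX) (hFY : Continuous FY) (hXA : IsFlowStable DX φX A)
    (hYA : IsFlowStable DY φY A) (hAc : IsClosed A) (hJc : Continuous J)
    (hJX : ∀ x, J x (FX x) = FX x) (hJY : ∀ x, J x (FY x) = FY x)
    (hJ : ∀ x₀, ∀ ε > 0, ∃ N ∈ 𝓝 x₀, ∀ x ∈ N, ∀ y ∈ N,
      ‖J x (e y - e x) - (e y - e x)‖ ≤ ε * ‖e y - e x‖)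
    {U : Set M} (hUX : U ⊆ attractedTo DX φX A)
    (hUY : ∀ x ∈ U, ∀ t, 0 ≤ t → φX x t ∈ attractedTo DY φY A) :
    ∃ G : ℝ → M → H, ContinuousOn (fun p : ℝ × M => G p.1 p.2) (Icc 0 1 ×ˢ (U \ A)) ∧
      (∀ x ∈ U \ A, G 0 x = FX x) ∧ (∀ x ∈ U \ A, G 1 x = FY x) ∧
      ∀ t ∈ Icc (0 : ℝ) 1, ∀ x ∈ U \ A, G t x ≠ 0 ∧ ∃ w, J x w = G t x := by
  set S : Set M := U \ A with hS
  obtain ⟨K, T, c, hKc, hK0, hKrange, hKX, hc, hKT⟩ :=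
    exists_displacement_path hX hY he hFX hFY hXA hYA hAc hJc hJX hJY hJ hUX hUY
  -- The first half runs through the path up to time `T`; the second moves linearly from `c • FY` to
  -- `FY`.
  let g : ℝ × S → H := fun p => (1 - max 0 (2 * p.1 - 1)) • K p.2 (min (2 * p.1) 1 * T p.2) +
    max 0 (2 * p.1 - 1) • FY p.2
  have hg : Continuous g := by
    have h1 : Continuous fun p : ℝ × S => K p.2 (min (2 * p.1) 1 * T p.2) :=
      hKc.comp (f := fun p : ℝ × S => (p.2, min (2 * p.1) 1 * T p.2)) (by fun_prop)
    have h2 : Continuous fun p : ℝ × S => FY p.2 := hFY.comp (by fun_prop)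
    exact ((continuous_const.sub (by fun_prop)).smul h1).add ((by fun_prop : Continuous
      fun p : ℝ × S => max 0 (2 * p.1 - 1)).smul h2)
  have hFY0 : ∀ x : S, FY x ≠ 0 := fun x h => hK0 x (T x) (by rw [hKT, h, smul_zero])
  classical
  let G : ℝ → M → H := fun t x => if h : x ∈ S then g (t, ⟨x, h⟩) else 0
  have hG : ∀ (t : ℝ) (x : M) (h : x ∈ S), G t x = g (t, ⟨x, h⟩) := fun t x h => dif_pos h
  refine ⟨G, ?_, fun x hx => ?_, fun x hx => ?_, fun t ht x hx => ⟨?_, ?_⟩⟩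
  · rw [continuousOn_iff_continuous_domRestrict]
    have h1 : Continuous fun p : (Icc (0 : ℝ) 1 ×ˢ S : Set (ℝ × M)) =>
        g (p.1.1, ⟨p.1.2, p.2.2⟩) := hg.comp (by fun_prop)
    exact h1.congr fun p => (hG _ _ p.2.2).symm
  · rw [hG 0 x hx]
    simp [g, hKX]
  · rw [hG 1 x hx]
    have h1 : max (0 : ℝ) (2 * 1 - 1) = 1 := by norm_num
    simp only [g, h1, sub_self, zero_smul, one_smul, zero_add]
  · rw [hG t x hx]
    rcases le_total t (1 / 2) with h | h
    · simp only [g]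
      have h1 : max 0 (2 * t - 1) = 0 := max_eq_left (by linarith)
      rw [h1, sub_zero, one_smul, zero_smul, add_zero]
      exact hK0 _ _
    · simp only [g]
      have h1 : max 0 (2 * t - 1) = 2 * t - 1 := max_eq_right (by linarith)
      have h2 : min (2 * t) 1 = 1 := min_eq_right (by linarith)
      rw [h1, h2, one_mul, hKT, smul_smul, ← add_smul]
      refine smul_ne_zero (ne_of_gt ?_) (hFY0 ⟨x, hx⟩)
      have h1 := hc ⟨x, hx⟩
      rcases ht.2.lt_or_eq with h3 | h3
      · have : 0 < (1 - (2 * t - 1)) * c ⟨x, hx⟩ :=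
          mul_pos (by linarith) h1
        linarith
      · rw [h3]; norm_num
  · rw [hG t x hx]
    obtain ⟨w, hw⟩ := hKrange ⟨x, hx⟩ (min (2 * t) 1 * T ⟨x, hx⟩)
    refine ⟨(1 - max 0 (2 * t - 1)) • w + max 0 (2 * t - 1) • FY x, ?_⟩
    rw [map_add, map_smul, map_smul, hJY, hw]

end AbstractHomotopy

/-! ### A smooth embedding into a Hilbert sum -/

section ChartEmbedding

variable {n : ℕ} {M : Type*} [TopologicalSpace M] [ChartedSpace (EuclideanSpace ℝ (Fin n)) M]
  [IsManifold (𝓡 n) ∞ M] {H : Type*} [NormedAddCommGroup H] [NormedSpace ℝ H]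

/-- A smooth embedding into a normed space whose charts extend to continuous linear maps. -/
structure IsChartEmbedding (n : ℕ) {M : Type*} [TopologicalSpace M]
    [ChartedSpace (EuclideanSpace ℝ (Fin n)) M]
    {H : Type*} [NormedAddCommGroup H] [NormedSpace ℝ H] (e : M → H) : Prop where
  contMDiff : ContMDiff (𝓡 n) 𝓘(ℝ, H) ∞ e
  isEmbedding : IsEmbedding e
  exists_proj : ∀ x₀ : M, ∃ c : M, x₀ ∈ (extChartAt (𝓡 n) c).source ∧
    ∃ P : H →L[ℝ] EuclideanSpace ℝ (Fin n), ∀ᶠ x in 𝓝 x₀, P (e x) = extChartAt (𝓡 n) c x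

namespace SmoothBumpCovering

variable {ι : Type*} (f : SmoothBumpCovering ι (𝓡 n) M)

open scoped Classical in
/-- The inclusion of one summand in the Hilbert sum. -/
noncomputable def hilbertIncl (n : ℕ) {ι : Type*} (i : ι) : EuclideanSpace ℝ (Fin n) × ℝ →L[ℝ]
    lp (fun _ : ι => WithLp 2 (EuclideanSpace ℝ (Fin n) × ℝ)) 2 :=
  lp.singleContinuousLinearMap ℝ (fun _ : ι => WithLp 2 (EuclideanSpace ℝ (Fin n) × ℝ)) 2 i ∘L
    (WithLp.prodContinuousLinearEquiv 2 ℝ (EuclideanSpace ℝ (Fin n)) ℝ).symm.toContinuousLinearMap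

/-- The family of bump functions and cut off charts, as a point of a Hilbert sum. -/
noncomputable def hilbertEmbedding (x : M) :
    lp (fun _ : ι => WithLp 2 (EuclideanSpace ℝ (Fin n) × ℝ)) 2 :=
  ∑ᶠ i, hilbertIncl n i (f i x • extChartAt (𝓡 n) (f.c i) x, f i x)

omit [IsManifold (𝓡 n) ∞ M] in
theorem hilbertIncl_eq_zero {x : M} {i : ι} (h : f i x = 0) :
    hilbertIncl n i (f i x • extChartAt (𝓡 n) (f.c i) x, f i x) = 0 := by
  rw [h, zero_smul]
  exact map_zero _

omit [IsManifold (𝓡 n) ∞ M] in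
open scoped Classical in
theorem hilbertEmbedding_apply (x : M) (i : ι) :
    f.hilbertEmbedding x i = (WithLp.prodContinuousLinearEquiv 2 ℝ (EuclideanSpace ℝ (Fin n)) ℝ).symm
      (f i x • extChartAt (𝓡 n) (f.c i) x, f i x) := by
  have hfin := f.point_finite x
  rw [hilbertEmbedding, finsum_eq_sum_of_support_subset (s := hfin.toFinset)]
  · rw [lp.coeFn_sum, Finset.sum_apply, Finset.sum_eq_single i]
    · exact lp.single_apply_self _ _ _
    · exact fun j _ hj => lp.single_apply_ne _ _ _ hj.symm
    · intro hi
      rw [f.hilbertIncl_eq_zero (by simpa using hi)]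
      rfl
  · intro j hj
    rw [Finite.coe_toFinset]
    exact fun h0 => hj (f.hilbertIncl_eq_zero h0)

theorem contMDiff_hilbertEmbedding [T2Space M] : ContMDiff (𝓡 n)
    𝓘(ℝ, lp (fun _ : ι => WithLp 2 (EuclideanSpace ℝ (Fin n) × ℝ)) 2) ∞ f.hilbertEmbedding :=
  contMDiff_finsum (fun i => (hilbertIncl n i).contMDiff.comp
    (((f i).contMDiff_smul contMDiffOn_extChartAt).prodMk_space (f i).contMDiff))
    (f.locallyFinite.subset fun _ _ hx h0 => hx (f.hilbertIncl_eq_zero h0))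

/-- The projection of the Hilbert sum on the chart coordinates of one summand. -/
noncomputable def chartProj (i : ι) :
    lp (fun _ : ι => WithLp 2 (EuclideanSpace ℝ (Fin n) × ℝ)) 2 →L[ℝ] EuclideanSpace ℝ (Fin n) :=
  (ContinuousLinearMap.fst ℝ _ ℝ ∘L
    (WithLp.prodContinuousLinearEquiv 2 ℝ (EuclideanSpace ℝ (Fin n)) ℝ).toContinuousLinearMap) ∘L
    lp.evalCLM ℝ (fun _ : ι => WithLp 2 (EuclideanSpace ℝ (Fin n) × ℝ)) 2 i

/-- The projection of the Hilbert sum on the bump function coordinate of one summand. -/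
noncomputable def bumpProj (n : ℕ) {ι : Type*} (i : ι) :
    lp (fun _ : ι => WithLp 2 (EuclideanSpace ℝ (Fin n) × ℝ)) 2 →L[ℝ] ℝ :=
  (ContinuousLinearMap.snd ℝ _ ℝ ∘L
    (WithLp.prodContinuousLinearEquiv 2 ℝ (EuclideanSpace ℝ (Fin n)) ℝ).toContinuousLinearMap) ∘L
    lp.evalCLM ℝ (fun _ : ι => WithLp 2 (EuclideanSpace ℝ (Fin n) × ℝ)) 2 i

omit [IsManifold (𝓡 n) ∞ M] in
theorem chartProj_hilbertEmbedding (x : M) (i : ι) :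
    chartProj i (f.hilbertEmbedding x) = f i x • extChartAt (𝓡 n) (f.c i) x := by
  change (WithLp.prodContinuousLinearEquiv 2 ℝ (EuclideanSpace ℝ (Fin n)) ℝ
    (f.hilbertEmbedding x i)).1 = _
  rw [hilbertEmbedding_apply, ContinuousLinearEquiv.apply_symm_apply]

omit [IsManifold (𝓡 n) ∞ M] in
theorem bumpProj_hilbertEmbedding (x : M) (i : ι) :
    bumpProj n i (f.hilbertEmbedding x) = f i x := by
  change (WithLp.prodContinuousLinearEquiv 2 ℝ (EuclideanSpace ℝ (Fin n)) ℝ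
    (f.hilbertEmbedding x i)).2 = _
  rw [hilbertEmbedding_apply, ContinuousLinearEquiv.apply_symm_apply]

omit [IsManifold (𝓡 n) ∞ M] in
-- Dividing the cut-off chart by the bump value recovers the chart. This is a local left inverse of
-- the embedding, continuous where the bump is nonzero, and yields both injectivity and the induced
-- topology.
theorem symm_smul_chartProj_hilbertEmbedding {x : M} {i : ι} (hx : f i x ≠ 0) :
    (extChartAt (𝓡 n) (f.c i)).symm ((bumpProj n i (f.hilbertEmbedding x))⁻¹ •
      chartProj i (f.hilbertEmbedding x)) = x := by
  rw [bumpProj_hilbertEmbedding, chartProj_hilbertEmbedding, inv_smul_smul₀ hx]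
  refine (extChartAt (𝓡 n) (f.c i)).left_inv ?_
  rw [extChartAt_source]
  exact (f i).support_subset_source hx

theorem isEmbedding_hilbertEmbedding [T2Space M] : IsEmbedding f.hilbertEmbedding := by
  refine ⟨isInducing_iff_nhds.2 fun x₀ => le_antisymm
    f.contMDiff_hilbertEmbedding.continuous.continuousAt.le_comap ?_, fun x y hxy => ?_⟩
  · set i := f.ind x₀ (mem_univ _)
    have hi : f i x₀ = 1 := f.apply_ind x₀ _
    have hb : ContinuousAt (bumpProj n i) (f.hilbertEmbedding x₀) :=
      (bumpProj n i).continuous.continuousAt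
    have hb0 : bumpProj n i (f.hilbertEmbedding x₀) ≠ 0 := by
      rw [bumpProj_hilbertEmbedding, hi]; exact one_ne_zero
    have hc : ContinuousAt (fun h => (extChartAt (𝓡 n) (f.c i)).symm
        ((bumpProj n i h)⁻¹ • chartProj i h)) (f.hilbertEmbedding x₀) := by
      refine ContinuousAt.comp (g := (extChartAt (𝓡 n) (f.c i)).symm) ?_
        ((hb.inv₀ hb0).smul (chartProj i).continuous.continuousAt)
      rw [bumpProj_hilbertEmbedding, chartProj_hilbertEmbedding, hi, inv_one, one_smul, one_smul]
      exact continuousAt_extChartAt_symm'' ((extChartAt (𝓡 n) (f.c i)).map_source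
        (f.mem_extChartAt_ind_source x₀ _))
    intro N hN
    rw [ContinuousAt, f.symm_smul_chartProj_hilbertEmbedding (by rw [hi]; exact one_ne_zero)] at hc
    refine ⟨_, (hc.eventually hN).and (hb.eventually_ne hb0), ?_⟩
    rintro y ⟨hy1, hy2⟩
    rw [bumpProj_hilbertEmbedding] at hy2
    rwa [f.symm_smul_chartProj_hilbertEmbedding hy2] at hy1
  · have hi : f (f.ind x (mem_univ _)) x = 1 := f.apply_ind x _
    have hy : f (f.ind x (mem_univ _)) y ≠ 0 := by
      rw [← bumpProj_hilbertEmbedding, ← hxy, bumpProj_hilbertEmbedding, hi]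
      exact one_ne_zero
    rw [← f.symm_smul_chartProj_hilbertEmbedding (i := f.ind x (mem_univ _)) (x := x)
      (by rw [hi]; exact one_ne_zero), hxy, f.symm_smul_chartProj_hilbertEmbedding hy]

theorem isChartEmbedding_hilbertEmbedding [T2Space M] :
    IsChartEmbedding n f.hilbertEmbedding where
  contMDiff := f.contMDiff_hilbertEmbedding
  isEmbedding := f.isEmbedding_hilbertEmbedding
  exists_proj x₀ := by
    refine ⟨_, f.mem_extChartAt_ind_source x₀ (mem_univ _), chartProj (f.ind x₀ (mem_univ _)), ?_⟩
    filter_upwards [f.eventuallyEq_one x₀ (mem_univ _)] with x hx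
    rw [chartProj_hilbertEmbedding, hx, Pi.one_apply, one_smul]

end SmoothBumpCovering

end ChartEmbedding

/-! ### The tangent bundle inside the ambient space -/

section AmbientDeriv

variable {n : ℕ} {M : Type*} [TopologicalSpace M] [ChartedSpace (EuclideanSpace ℝ (Fin n)) M]
  {H : Type*} [NormedAddCommGroup H] [NormedSpace ℝ H]

/-- The derivative of a map to a normed space, with values in this normed space. -/
noncomputable def ambientDeriv (n : ℕ) {M : Type*} [TopologicalSpace M]
    [ChartedSpace (EuclideanSpace ℝ (Fin n)) M] {H : Type*} [NormedAddCommGroup H]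
    [NormedSpace ℝ H] (e : M → H) (x : M) : TangentSpace (𝓡 n) x →L[ℝ] H :=
  mfderiv (𝓡 n) 𝓘(ℝ, H) e x

/-- On the open set `N` the chart at `c` is the restriction of the linear map `P`. -/
structure IsLinearChart (e : M → H) (c : M) (P : H →L[ℝ] EuclideanSpace ℝ (Fin n)) (N : Set M) :
    Prop where
  isOpen : IsOpen N
  subset_source : N ⊆ (extChartAt (𝓡 n) c).source
  proj_apply : ∀ x ∈ N, P (e x) = extChartAt (𝓡 n) c x

theorem IsChartEmbedding.exists_isLinearChart {e : M → H} (he : IsChartEmbedding n e) (x₀ : M) :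
    ∃ (c : M) (P : H →L[ℝ] EuclideanSpace ℝ (Fin n)) (N : Set M), x₀ ∈ N ∧ IsLinearChart e c P N := by
  obtain ⟨c, hc, P, hP⟩ := he.exists_proj x₀
  obtain ⟨N, hN, hNo, hxN⟩ := eventually_nhds_iff.1 hP
  exact ⟨c, P, N ∩ (extChartAt (𝓡 n) c).source, ⟨hxN, hc⟩,
    hNo.inter (isOpen_extChartAt_source c), inter_subset_right, fun x hx => hN x hx.1⟩

/-- The embedding read in the chart at `c`. -/
noncomputable def inChart (n : ℕ) {M : Type*} [TopologicalSpace M]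
    [ChartedSpace (EuclideanSpace ℝ (Fin n)) M] {H : Type*} (e : M → H) (c : M) :
    EuclideanSpace ℝ (Fin n) → H :=
  e ∘ (extChartAt (𝓡 n) c).symm

omit [NormedAddCommGroup H] [NormedSpace ℝ H] in
theorem inChart_extChartAt (e : M → H) {c x : M} (hx : x ∈ (extChartAt (𝓡 n) c).source) :
    inChart n e c (extChartAt (𝓡 n) c x) = e x :=
  congrArg e ((extChartAt (𝓡 n) c).left_inv hx)

variable [IsManifold (𝓡 n) ∞ M] {e : M → H}

namespace IsChartEmbedding

variable (he : IsChartEmbedding n e)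
include he

omit [IsManifold (𝓡 n) ∞ M] in
theorem mdifferentiableAt (x : M) : MDifferentiableAt (𝓡 n) 𝓘(ℝ, H) e x :=
  (he.contMDiff x).mdifferentiableAt (by simp)

theorem contDiffOn_inChart (c : M) :
    ContDiffOn ℝ ∞ (inChart n e c) (extChartAt (𝓡 n) c).target :=
  contMDiffOn_iff_contDiffOn.1 (he.contMDiff.comp_contMDiffOn (contMDiffOn_extChartAt_symm c))

theorem contDiffAt_inChart {c x : M} (hx : x ∈ (extChartAt (𝓡 n) c).source) :
    ContDiffAt ℝ ∞ (inChart n e c) (extChartAt (𝓡 n) c x) :=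
  (he.contDiffOn_inChart c).contDiffAt
    ((isOpen_extChartAt_target c).mem_nhds ((extChartAt (𝓡 n) c).map_source hx))

theorem ambientDeriv_eq {c x : M} (hx : x ∈ (extChartAt (𝓡 n) c).source)
    (v : TangentSpace (𝓡 n) x) :
    ambientDeriv n e x v = fderiv ℝ (inChart n e c) (extChartAt (𝓡 n) c x)
      (ambientDeriv n (extChartAt (𝓡 n) c) x v) := by
  have h1 := ((he.contDiffAt_inChart hx).differentiableAt
    (by simp)).hasFDerivAt.hasMFDerivAt
  have h2 := h1.comp x (mdifferentiableAt_extChartAt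
    (by rwa [extChartAt_source] at hx)).hasMFDerivAt
  have h3 := h2.congr_of_eventuallyEq (f₁ := e) (by
    filter_upwards [(isOpen_extChartAt_source c).mem_nhds hx] with y hy
    exact (inChart_extChartAt e hy).symm)
  exact DFunLike.congr_fun h3.mfderiv v

theorem continuousOn_fderiv_inChart (c : M) :
    ContinuousOn (fun x => fderiv ℝ (inChart n e c) (extChartAt (𝓡 n) c x))
      (extChartAt (𝓡 n) c).source :=
  ((he.contDiffOn_inChart c).continuousOn_fderiv_of_isOpen (isOpen_extChartAt_target c)
    (by simp)).comp (continuousOn_extChartAt c) fun _ => (extChartAt (𝓡 n) c).map_source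

theorem fderiv_inChart_mem_range {c x : M} (hx : x ∈ (extChartAt (𝓡 n) c).source)
    (u : EuclideanSpace ℝ (Fin n)) :
    ∃ v, ambientDeriv n e x v = fderiv ℝ (inChart n e c) (extChartAt (𝓡 n) c x) u := by
  obtain ⟨v, hv⟩ := (isInvertible_mfderiv_extChartAt hx).surjective u
  exact ⟨v, (he.ambientDeriv_eq hx v).trans (congrArg _ hv)⟩

variable {c : M} {P : H →L[ℝ] EuclideanSpace ℝ (Fin n)} {N : Set M}

theorem proj_ambientDeriv (hN : IsLinearChart e c P N) {x : M} (hx : x ∈ N)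
    (v : TangentSpace (𝓡 n) x) : P (ambientDeriv n e x v) =
      ambientDeriv n (extChartAt (𝓡 n) c) x v := by
  have h1 := P.hasMFDerivAt.comp x (he.mdifferentiableAt x).hasMFDerivAt
  have h2 := (mdifferentiableAt_extChartAt (I := 𝓡 n) (x := c) (y := x)
    (by simpa [extChartAt_source] using hN.subset_source hx)).hasMFDerivAt
  have h3 := h2.congr_of_eventuallyEq (f₁ := P ∘ e) (by
    filter_upwards [hN.isOpen.mem_nhds hx] with y hy using hN.proj_apply y hy)
  exact DFunLike.congr_fun (h1.mfderiv.symm.trans h3.mfderiv) v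

theorem fderiv_inChart_proj (hN : IsLinearChart e c P N) {x : M} (hx : x ∈ N)
    (v : TangentSpace (𝓡 n) x) :
    fderiv ℝ (inChart n e c) (extChartAt (𝓡 n) c x) (P (ambientDeriv n e x v)) =
      ambientDeriv n e x v := by
  rw [he.proj_ambientDeriv hN hx]
  exact (he.ambientDeriv_eq (hN.subset_source hx) v).symm

theorem injective_ambientDeriv (x : M) : Function.Injective (ambientDeriv n e x) := by
  obtain ⟨c, P, N, hx, hN⟩ := he.exists_isLinearChart x
  intro v w hvw
  refine (isInvertible_mfderiv_extChartAt (hN.subset_source hx)).injective ?_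
  exact (he.proj_ambientDeriv hN hx v).symm.trans
    ((congrArg P hvw).trans (he.proj_ambientDeriv hN hx w))

/-- Over `N` the trivialization of the tangent bundle is the fixed linear map `P` applied to the
ambient vector. Conversely, the ambient vector is recovered through the derivative of `inChart`,
which depends continuously on the base point. -/
theorem tendsto_totalSpace_iff {Z : Type*} {l : Filter Z} {z : Z → M} {x₀ : M}
    {v : (i : Z) → TangentSpace (𝓡 n) (z i)} {v₀ : TangentSpace (𝓡 n) x₀} :
    Tendsto (fun i => (⟨z i, v i⟩ : TangentBundle (𝓡 n) M)) l (𝓝 ⟨x₀, v₀⟩) ↔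
      Tendsto z l (𝓝 x₀) ∧
        Tendsto (fun i => ambientDeriv n e (z i) (v i)) l (𝓝 (ambientDeriv n e x₀ v₀)) := by
  obtain ⟨c, P, N, hx, hN⟩ := he.exists_isLinearChart x₀
  have hsrc : ∀ x ∈ N, x ∈ (chartAt (EuclideanSpace ℝ (Fin n)) c).source := fun x hx => by
    simpa [extChartAt_source] using hN.subset_source hx
  have htriv : ∀ x ∈ N, ∀ w : TangentSpace (𝓡 n) x,
      (trivializationAt (EuclideanSpace ℝ (Fin n)) (TangentSpace (𝓡 n)) c
        (⟨x, w⟩ : TangentBundle (𝓡 n) M)).2 = P (ambientDeriv n e x w) := by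
    intro x hx w
    rw [he.proj_ambientDeriv hN hx]
    refine Eq.trans ?_ (DFunLike.congr_fun
      (TangentBundle.continuousLinearMapAt_trivializationAt (hsrc x hx)) w)
    rw [Bundle.Trivialization.continuousLinearMapAt_apply,
      Bundle.Trivialization.coe_linearMapAt_of_mem]
    exact hsrc x hx
  rw [(trivializationAt (EuclideanSpace ℝ (Fin n)) (TangentSpace (𝓡 n) (M := M)) c).tendsto_nhds_iff
    (by rw [Bundle.Trivialization.mem_source]; exact hsrc _ hx)]
  refine and_congr_right fun hz => ?_
  have hzN : ∀ᶠ i in l, z i ∈ N := hz.eventually (hN.isOpen.mem_nhds hx)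
  change Tendsto _ l (𝓝 (trivializationAt (EuclideanSpace ℝ (Fin n)) (TangentSpace (𝓡 n)) c
        (⟨x₀, v₀⟩ : TangentBundle (𝓡 n) M)).2) ↔ _
  rw [htriv x₀ hx, tendsto_congr' (f₂ := fun i => P (ambientDeriv n e (z i) (v i)))
    (by filter_upwards [hzN] with i hi using htriv _ hi _)]
  refine ⟨fun h => ?_, fun h => (P.continuous.tendsto _).comp h⟩
  have h1 : Tendsto (fun i => fderiv ℝ (inChart n e c) (extChartAt (𝓡 n) c (z i))) l
      (𝓝 (fderiv ℝ (inChart n e c) (extChartAt (𝓡 n) c x₀))) :=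
    (((he.continuousOn_fderiv_inChart c).mono hN.subset_source).continuousAt
      (hN.isOpen.mem_nhds hx)).tendsto.comp hz
  have h2 := ((isBoundedBilinearMap_apply.continuous.tendsto _).comp (h1.prodMk_nhds h))
  change Tendsto _ l (𝓝 (fderiv ℝ (inChart n e c) (extChartAt (𝓡 n) c x₀)
    (P (ambientDeriv n e x₀ v₀)))) at h2
  rw [he.fderiv_inChart_proj hN hx] at h2
  refine h2.congr' ?_
  filter_upwards [hzN] with i hi using he.fderiv_inChart_proj hN hi _

end IsChartEmbedding

end AmbientDeriv

/-! ### Vector fields, tangent projections and chords -/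

section AmbientVectorField

variable {n : ℕ} {M : Type*} [TopologicalSpace M] [ChartedSpace (EuclideanSpace ℝ (Fin n)) M]
  [IsManifold (𝓡 n) ∞ M] {H : Type*} [NormedAddCommGroup H] [NormedSpace ℝ H] {e : M → H}

/-- The vector field `X` along an embedding, as a function with values in the ambient space. -/
noncomputable def ambientField {n : ℕ} {M : Type*} [TopologicalSpace M]
    [ChartedSpace (EuclideanSpace ℝ (Fin n)) M] {H : Type*} [NormedAddCommGroup H]
    [NormedSpace ℝ H] (e : M → H) (X : (x : M) → TangentSpace (𝓡 n) x) (x : M) : H :=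
  ambientDeriv n e x (X x)

namespace IsChartEmbedding

variable (he : IsChartEmbedding n e)
include he

theorem continuous_ambientField {X : (x : M) → TangentSpace (𝓡 n) x} (hX : IsC0VectorField X) :
    Continuous (ambientField e X) :=
  continuous_iff_continuousAt.2 fun x =>
    (he.tendsto_totalSpace_iff.1 (hX.tendsto x)).2

/-- For the converse, `γ` is continuous since `e` is an embedding, and differentiable as the inverse
chart applied to `P (e (γ s))`. Its velocity is then determined by injectivity of the derivative of
`e`. -/
theorem hasMFDerivAt_iff {γ : ℝ → M} {t : ℝ} {v : TangentSpace (𝓡 n) (γ t)} :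
    HasMFDerivAt 𝓘(ℝ, ℝ) (𝓡 n) γ t ((1 : ℝ →L[ℝ] ℝ).smulRight v) ↔
      HasDerivAt (e ∘ γ) (ambientDeriv n e (γ t) v) t := by
  refine ⟨fun h => ?_, fun h => ?_⟩
  · have h1 : HasFDerivAt (e ∘ γ)
        (ambientDeriv n e (γ t) ∘L (1 : ℝ →L[ℝ] ℝ).smulRight v) t :=
      hasMFDerivAt_iff_hasFDerivAt.1 ((he.mdifferentiableAt (γ t)).hasMFDerivAt.comp t h)
    exact h1.hasDerivAt.congr_deriv (congrArg (ambientDeriv n e (γ t)) (one_smul ℝ v))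
  · have hc : ContinuousAt γ t := he.isEmbedding.continuousAt_iff.2 h.continuousAt
    obtain ⟨c, P, N, hx, hN⟩ := he.exists_isLinearChart (γ t)
    have h1 : MDifferentiableAt 𝓘(ℝ, ℝ) 𝓘(ℝ, EuclideanSpace ℝ (Fin n)) (fun s => P (e (γ s))) t :=
      (P.differentiableAt.comp t h.differentiableAt).mdifferentiableAt
    have h2 : MDifferentiableAt 𝓘(ℝ, EuclideanSpace ℝ (Fin n)) (𝓡 n) (extChartAt (𝓡 n) c).symm
        (P (e (γ t))) := by
      rw [hN.proj_apply _ hx]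
      exact ((contMDiffOn_extChartAt_symm (n := ∞) c).contMDiffAt ((isOpen_extChartAt_target c).mem_nhds
        ((extChartAt (𝓡 n) c).map_source (hN.subset_source hx)))).mdifferentiableAt (by simp)
    have h3 : MDifferentiableAt 𝓘(ℝ, ℝ) (𝓡 n) γ t := by
      refine (h2.comp t h1).congr_of_eventuallyEq ?_
      filter_upwards [hc.eventually (hN.isOpen.mem_nhds hx)] with s hs
      simp only [Function.comp_apply]
      rw [hN.proj_apply _ hs, (extChartAt (𝓡 n) c).left_inv (hN.subset_source hs)]
    have h4 : HasFDerivAt (e ∘ γ)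
        (ambientDeriv n e (γ t) ∘L mfderiv 𝓘(ℝ, ℝ) (𝓡 n) γ t) t :=
      hasMFDerivAt_iff_hasFDerivAt.1
        ((he.mdifferentiableAt (γ t)).hasMFDerivAt.comp t h3.hasMFDerivAt)
    refine h3.hasMFDerivAt.congr_mfderiv (ContinuousLinearMap.ext_ring
      (he.injective_ambientDeriv (γ t) (Eq.symm ?_)))
    exact (congrArg (ambientDeriv n e (γ t)) (one_smul ℝ v)).trans (h.unique h4.hasDerivAt)

theorem isMIntegralCurveOn_iff {X : (x : M) → TangentSpace (𝓡 n) x} {γ : ℝ → M} {J : Set ℝ}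
    (hJ : IsOpen J) : IsMIntegralCurveOn γ X J ↔
      ∀ t ∈ J, HasDerivAt (e ∘ γ) (ambientField e X (γ t)) t :=
  forall₂_congr fun t ht => by
    rw [ambientField, ← he.hasMFDerivAt_iff]
    exact ⟨fun h => h.hasMFDerivAt (hJ.mem_nhds ht), fun h => h.hasMFDerivWithinAt⟩

/-- Linear maps with values in the tangent space that fix it pointwise form a convex set. Locally
one is given by the derivative of `inChart` after `P`; a partition of unity glues them. -/
theorem exists_continuous_retraction [NormalSpace M] [ParacompactSpace M] :
    ∃ J : M → H →L[ℝ] H, Continuous J ∧ (∀ x w, ∃ v, ambientDeriv n e x v = J x w) ∧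
      ∀ x v, J x (ambientDeriv n e x v) = ambientDeriv n e x v := by
  suffices h : ∃ J : C(M, H →L[ℝ] H), ∀ x, J x ∈ {J : H →L[ℝ] H |
      (∀ w, ∃ v, ambientDeriv n e x v = J w) ∧
        ∀ v, J (ambientDeriv n e x v) = ambientDeriv n e x v} by
    obtain ⟨J, hJ⟩ := h
    exact ⟨J, J.continuous, fun x => (hJ x).1, fun x => (hJ x).2⟩
  refine exists_continuous_forall_mem_convex_of_local ?_ ?_
  · rintro x J₁ ⟨h1, h1'⟩ J₂ ⟨h2, h2'⟩ a b - - hab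
    refine ⟨fun w => ?_, fun v => ?_⟩
    · obtain ⟨v₁, hv₁⟩ := h1 w
      obtain ⟨v₂, hv₂⟩ := h2 w
      exact ⟨a • v₁ + b • v₂, by simp [hv₁, hv₂]⟩
    · simp only [add_apply, smul_apply, h1', h2']
      rw [← add_smul, hab, one_smul]
  · intro x₀
    obtain ⟨c, P, N, hx, hN⟩ := he.exists_isLinearChart x₀
    refine ⟨N, hN.isOpen.mem_nhds hx,
      fun x => fderiv ℝ (inChart n e c) (extChartAt (𝓡 n) c x) ∘L P,
      ((he.continuousOn_fderiv_inChart c).mono hN.subset_source).clm_comp continuousOn_const,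
      fun x hx => ⟨fun w => he.fderiv_inChart_mem_range (hN.subset_source hx) (P w),
        fun v => he.fderiv_inChart_proj hN hx v⟩⟩

/-- By strict differentiability a short chord is close to the tangent vector `D u`, which `J x`
fixes. The error is relative to the chord because `‖u‖ ≤ ‖P‖ * ‖e y - e x‖`. -/
theorem exists_nhds_norm_sub_le {J : M → H →L[ℝ] H} (hJc : Continuous J)
    (hJ : ∀ x v, J x (ambientDeriv n e x v) = ambientDeriv n e x v) (x₀ : M) {ε : ℝ} (hε : 0 < ε) :
    ∃ N ∈ 𝓝 x₀, ∀ x ∈ N, ∀ y ∈ N,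
      ‖J x (e y - e x) - (e y - e x)‖ ≤ ε * ‖e y - e x‖ := by
  obtain ⟨c, P, N, hx₀, hN⟩ := he.exists_isLinearChart x₀
  set ψ := extChartAt (𝓡 n) c
  set K : ℝ := ‖J x₀‖ + 1 + 1
  have hK : 0 < K := by positivity
  set δ : ℝ := ε / (2 * K * (‖P‖ + 1))
  have hδ : 0 < δ := by positivity
  have hψ : ContinuousAt ψ x₀ := continuousAt_extChartAt' (by
    simpa [extChartAt_source] using hN.subset_source hx₀)
  have hs : ∀ᶠ q in 𝓝 (ψ x₀, ψ x₀), ‖inChart n e c q.1 - inChart n e c q.2 -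
      fderiv ℝ (inChart n e c) (ψ x₀) (q.1 - q.2)‖ ≤ δ * ‖q.1 - q.2‖ :=
    (((he.contDiffAt_inChart (hN.subset_source hx₀)).hasStrictFDerivAt
      (by simp)).isLittleO).def hδ
  rw [nhds_prod_eq, eventually_prod_self_iff'] at hs
  obtain ⟨W, hW, hs⟩ := hs
  have hJx : ∀ᶠ x in 𝓝 x₀, ‖J x‖ < ‖J x₀‖ + 1 :=
    hJc.norm.continuousAt.eventually_lt_const (lt_add_one _)
  have hD : ∀ᶠ x in 𝓝 x₀, ‖fderiv ℝ (inChart n e c) (ψ x) -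
      fderiv ℝ (inChart n e c) (ψ x₀)‖ < δ := by
    have := (((he.continuousOn_fderiv_inChart c).mono hN.subset_source).continuousAt
      (hN.isOpen.mem_nhds hx₀)).sub_const (fderiv ℝ (inChart n e c) (ψ x₀))
    refine this.norm.eventually_lt_const ?_
    rwa [sub_self, norm_zero]
  have hN₀ : ∀ᶠ x in 𝓝 x₀, x ∈ N := hN.isOpen.mem_nhds hx₀
  refine ⟨_, hN₀.and ((hψ.eventually hW).and (hJx.and hD)), ?_⟩
  rintro x ⟨hxN, hxW, hxJ, hxD⟩ y ⟨hyN, hyW, -, -⟩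
  set u := ψ y - ψ x
  set D := fderiv ℝ (inChart n e c) (ψ x)
  set D₀ := fderiv ℝ (inChart n e c) (ψ x₀)
  set p := e y - e x
  have hu : ‖u‖ ≤ ‖P‖ * ‖p‖ := by
    have : P p = u := by rw [map_sub, hN.proj_apply _ hxN, hN.proj_apply _ hyN]
    rw [← this]
    exact P.le_opNorm p
  have herr : ‖p - D u‖ ≤ 2 * δ * ‖u‖ := by
    have h1 : ‖p - D₀ u‖ ≤ δ * ‖u‖ := by
      have := hs _ hyW _ hxW
      rwa [inChart_extChartAt e (hN.subset_source hxN),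
        inChart_extChartAt e (hN.subset_source hyN)] at this
    have h2 : ‖(D - D₀) u‖ ≤ δ * ‖u‖ :=
      ((D - D₀).le_opNorm u).trans (mul_le_mul_of_nonneg_right hxD.le (norm_nonneg _))
    have h3 : p - D u = (p - D₀ u) - (D - D₀) u := by
      rw [sub_apply]; abel
    rw [h3]
    linarith [norm_sub_le (p - D₀ u) ((D - D₀) u)]
  have hfix : J x (D u) = D u := by
    obtain ⟨v, hv⟩ := he.fderiv_inChart_mem_range (hN.subset_source hxN) u
    rw [← hv, hJ]
  have h1 : J x p - p = J x (p - D u) - (p - D u) := by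
    rw [(J x).map_sub p (D u), hfix]; abel
  have h2 : ‖J x (p - D u)‖ ≤ (‖J x₀‖ + 1) * ‖p - D u‖ :=
    ((J x).le_opNorm _).trans (mul_le_mul_of_nonneg_right hxJ.le (norm_nonneg _))
  calc ‖J x p - p‖ ≤ K * ‖p - D u‖ := by
        rw [h1]
        linarith [norm_sub_le (J x (p - D u)) (p - D u)]
    _ ≤ K * (2 * δ * (‖P‖ * ‖p‖)) := by gcongr; exact herr.trans (by gcongr)
    _ = ε * ‖p‖ * (‖P‖ / (‖P‖ + 1)) := by
        simp only [δ]
        field_simp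
    _ ≤ ε * ‖p‖ * 1 := by
        gcongr
        exact (div_le_one (by positivity)).2 (by linarith)
    _ = ε * ‖p‖ := mul_one _

end IsChartEmbedding

end AmbientVectorField

/-! ### Extension of solutions to maximal ones -/

section MaximalSolutions

variable {M H : Type*} [NormedAddCommGroup H] [NormedSpace ℝ H] {e F : M → H} {x : M}

theorem IsSol.exists_sUnion {c : Set (Set ℝ × (ℝ → M))}
    (hc : ∀ p ∈ c, IsSol e F x p.1 p.2) (hne : c.Nonempty)
    (hchain : ∀ p ∈ c, ∀ q ∈ c, EqOn p.2 q.2 (p.1 ∩ q.1)) :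
    ∃ γ, IsSol e F x (⋃ p ∈ c, p.1) γ ∧ ∀ p ∈ c, EqOn γ p.2 p.1 := by
  classical
  let γ : ℝ → M := fun t => if h : ∃ p ∈ c, t ∈ p.1 then h.choose.2 t else x
  have hγ : ∀ p ∈ c, EqOn γ p.2 p.1 := by
    intro p hp t ht
    have h : ∃ p ∈ c, t ∈ p.1 := ⟨p, hp, ht⟩
    have : γ t = h.choose.2 t := dif_pos h
    rw [this]
    exact hchain _ h.choose_spec.1 _ hp ⟨h.choose_spec.2, ht⟩
  obtain ⟨p₀, hp₀⟩ := hne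
  refine ⟨γ, ⟨isOpen_biUnion fun p hp => (hc p hp).isOpen, ?_,
    mem_biUnion hp₀ (hc p₀ hp₀).zero_mem, ?_, ?_⟩, hγ⟩
  · rw [biUnion_eq_iUnion]
    exact (isPreconnected_iUnion (s := fun p : c => p.1.1) ⟨0, mem_iInter.2 fun p => (hc p p.2).zero_mem⟩
      fun p => (hc p p.2).ordConnected.isPreconnected).ordConnected
  · rw [hγ p₀ hp₀ (hc p₀ hp₀).zero_mem, (hc p₀ hp₀).start]
  · intro t ht
    obtain ⟨p, hp, htp⟩ := mem_iUnion₂.1 ht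
    rw [hγ p hp htp]
    refine ((hc p hp).hasDerivAt t htp).congr_of_eventuallyEq ?_
    filter_upwards [(hc p hp).isOpen.mem_nhds htp] with s hs
    exact congrArg e (hγ p hp hs)

theorem IsSol.exists_maximal {J : Set ℝ} {γ : ℝ → M} (h : IsSol e F x J γ) :
    ∃ J' γ', IsSol e F x J' γ' ∧ J ⊆ J' ∧ EqOn γ' γ J ∧
      ∀ J'' γ'', IsSol e F x J'' γ'' → J' ⊆ J'' → EqOn γ'' γ' J' → J'' = J' := by
  let α := {p : Set ℝ × (ℝ → M) // IsSol e F x p.1 p.2 ∧ J ⊆ p.1 ∧ EqOn p.2 γ J}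
  let r : α → α → Prop := fun p q => p.1.1 ⊆ q.1.1 ∧ EqOn q.1.2 p.1.2 p.1.1
  have : Nonempty α := ⟨⟨(J, γ), h, Subset.rfl, fun _ _ => rfl⟩⟩
  suffices h' : ∃ m, ∀ a, r m a → r a m by
    obtain ⟨m, hm⟩ := h'
    exact ⟨m.1.1, m.1.2, m.2.1, m.2.2.1, m.2.2.2, fun J'' γ'' h'' hJ hγ =>
      (hm ⟨(J'', γ''), h'', m.2.2.1.trans hJ,
        fun t ht => (hγ (m.2.2.1 ht)).trans (m.2.2.2 ht)⟩ ⟨hJ, hγ⟩).1.antisymm hJ⟩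
  -- The relation is only a preorder, since values of a curve off its interval are arbitrary; Zorn's
  -- lemma is used in this form.
  refine exists_maximal_of_nonempty_chains_bounded ?_ ?_
  · intro c hc ⟨a₀, ha₀⟩
    obtain ⟨δ, hδ, hδc⟩ := IsSol.exists_sUnion (e := e) (F := F) (x := x)
      (c := Subtype.val '' c) (by rintro _ ⟨p, -, rfl⟩; exact p.2.1) ⟨_, mem_image_of_mem _ ha₀⟩ (by
        rintro _ ⟨p, hp, rfl⟩ _ ⟨q, hq, rfl⟩ t ⟨ht, ht'⟩
        rcases eq_or_ne p q with rfl | hpq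
        · rfl
        · rcases hc hp hq hpq with h | h
          · exact (h.2 ht).symm
          · exact h.2 ht')
    have hsub : ∀ a ∈ c, a.1.1 ⊆ ⋃ p ∈ Subtype.val '' c, p.1 := fun a ha =>
      subset_biUnion_of_mem (u := fun p : Set ℝ × (ℝ → M) => p.1) (mem_image_of_mem _ ha)
    refine ⟨⟨(_, δ), hδ, a₀.2.2.1.trans (hsub a₀ ha₀), fun t ht => ?_⟩, fun a ha =>
      ⟨hsub a ha, hδc _ (mem_image_of_mem _ ha)⟩⟩
    exact (hδc _ (mem_image_of_mem _ ha₀) (a₀.2.2.1 ht)).trans (a₀.2.2.2 ht)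
  · intro p q s hpq hqs
    exact ⟨hpq.1.trans hqs.1, fun t ht => (hqs.2 (hpq.1 ht)).trans (hpq.2 ht)⟩

end MaximalSolutions

/-! ### The flow and the basins of a uniquely integrable field -/

section Flow

variable {n : ℕ} {M : Type*} [TopologicalSpace M] [ChartedSpace (EuclideanSpace ℝ (Fin n)) M]
  [IsManifold (𝓡 n) ∞ M] {H : Type*} [NormedAddCommGroup H] [NormedSpace ℝ H] {e : M → H}
  {X : (x : M) → TangentSpace (𝓡 n) x} {D : M → Set ℝ} {φ : M → ℝ → M} {A S : Set M}

theorem IsChartEmbedding.isIntegralCurveFrom_iff (he : IsChartEmbedding n e) {x : M} {J : Set ℝ}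
    {γ : ℝ → M} : IsIntegralCurveFrom X S x J γ ↔
      IsSol e (ambientField e X) x J γ ∧ MapsTo γ J S :=
  ⟨fun h => ⟨⟨h.isOpen, h.ordConnected, h.zero_mem, h.start,
    (he.isMIntegralCurveOn_iff h.isOpen).1 h.isMIntegralCurveOn⟩, h.mapsTo⟩,
  fun h => ⟨h.1.isOpen, h.1.ordConnected, h.1.zero_mem, h.1.start, h.2,
    (he.isMIntegralCurveOn_iff h.1.isOpen).2 h.1.hasDerivAt⟩⟩

/-- Uniqueness is assumed for maximal curves only. Any solution extends to a maximal one, which must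
be the chosen one. -/
theorem UniquelyIntegrable.exists_isUniversalFlow (he : IsChartEmbedding n e)
    (hX : UniquelyIntegrable X) : ∃ D φ, IsUniversalFlow e (ambientField e X) D φ := by
  choose D φ hφ using fun x => (hX x).1
  refine ⟨D, φ, fun x => (he.isIntegralCurveFrom_iff.1 (hφ x).1).1, fun x J γ h => ?_⟩
  obtain ⟨J', γ', h', hJ, hγ, hmax⟩ := h.exists_maximal
  obtain ⟨rfl, h2⟩ := (hX x).2 J' _ γ' _ ⟨he.isIntegralCurveFrom_iff.2 ⟨h', mapsTo_univ _ _⟩,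
    fun J'' γ'' h'' => hmax J'' γ'' (he.isIntegralCurveFrom_iff.1 h'').1⟩ (hφ x)
  exact ⟨hJ, fun t ht => (hγ ht).symm.trans (h2 (hJ ht))⟩

namespace IsUniversalFlow

variable (hφ : IsUniversalFlow e (ambientField e X) D φ) (he : IsChartEmbedding n e)
include hφ he

theorem isMaximalIntegralCurveFrom (x : M) : IsMaximalIntegralCurveFrom X univ x (D x) (φ x) :=
  ⟨he.isIntegralCurveFrom_iff.2 ⟨hφ.isSol x, mapsTo_univ _ _⟩, fun J γ h hJ _ =>
    (hφ.extends_isSol x J γ (he.isIntegralCurveFrom_iff.1 h).1).1.antisymm hJ⟩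

theorem eq_of_isMaximalIntegralCurveFrom {x : M} {J : Set ℝ} {γ : ℝ → M}
    (h : IsMaximalIntegralCurveFrom X univ x J γ) : J = D x ∧ EqOn γ (φ x) J := by
  obtain ⟨h1, h2⟩ := hφ.extends_isSol x J γ (he.isIntegralCurveFrom_iff.1 h.1).1
  exact ⟨(h.2 _ _ (hφ.isMaximalIntegralCurveFrom he x).1 h1 h2.symm).symm, h2⟩

theorem isFlowStable (hA : IsAsymptoticallyStable X A) : IsFlowStable D φ A := by
  intro W hW hAW
  obtain ⟨V, hV, hAV, h⟩ := hA.stable W hW hAW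
  exact ⟨V, hV, hAV, fun x hx => h x hx _ _ (hφ.isMaximalIntegralCurveFrom he x)⟩

theorem basin_eq (hS : IsOpen S) :
    basin X S A = {x ∈ attractedTo D φ A | ∀ t, 0 ≤ t → φ x t ∈ S} := by
  ext x
  constructor
  · rintro ⟨J, γ, h, hJ, hγ⟩
    have h0 := he.isIntegralCurveFrom_iff.1 h.1
    obtain ⟨h1, h2⟩ := hφ.extends_isSol x J γ h0.1
    refine ⟨⟨hJ.trans h1, hγ.congr' ?_⟩, fun t ht => ?_⟩
    · filter_upwards [eventually_ge_atTop 0] with t ht using h2 (hJ ht)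
    · rw [← h2 (hJ ht)]
      exact h0.2 (hJ ht)
  · rintro ⟨⟨hx, hlim⟩, hxS⟩
    -- The maximal curve of the restricted field lives on the component of `0` in the set of times
    -- at which the orbit is in `S`; this component may be smaller than `D x` at negative times.
    set O : Set ℝ := {t ∈ D x | φ x t ∈ S}
    have hO : IsOpen O := isOpen_iff_mem_nhds.2 fun t ht =>
      inter_mem ((hφ.isSol x).isOpen.mem_nhds ht.1)
        ((he.isEmbedding.continuousAt_iff.2
          ((hφ.isSol x).hasDerivAt t ht.1).continuousAt).preimage_mem_nhds (hS.mem_nhds ht.2))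
    have hIci : Ici (0 : ℝ) ⊆ O := fun t ht => ⟨hx ht, hxS t ht⟩
    have h0 : (0 : ℝ) ∈ O := hIci self_mem_Ici
    have hsub : connectedComponentIn O 0 ⊆ O := connectedComponentIn_subset O 0
    refine ⟨connectedComponentIn O 0, φ x, ⟨he.isIntegralCurveFrom_iff.2
      ⟨⟨hO.connectedComponentIn, isPreconnected_connectedComponentIn.ordConnected,
        mem_connectedComponentIn h0, (hφ.isSol x).start,
        fun t ht => (hφ.isSol x).hasDerivAt t (hsub ht).1⟩, fun t ht => (hsub ht).2⟩, ?_⟩,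
      isPreconnected_Ici.subset_connectedComponentIn self_mem_Ici hIci, hlim⟩
    intro J γ h hJ _
    have h1 := he.isIntegralCurveFrom_iff.1 h
    obtain ⟨h2, h3⟩ := hφ.extends_isSol x J γ h1.1
    have h4 : J ⊆ O := fun t ht => ⟨h2 ht, h3 ht ▸ h1.2 ht⟩
    exact (h.ordConnected.isPreconnected.subset_connectedComponentIn h.zero_mem h4).antisymm hJ

theorem basin_univ : basin X univ A = attractedTo D φ A := by
  rw [hφ.basin_eq he isOpen_univ]
  simp

end IsUniversalFlow

end Flow

/-! ### Openness of the basin of the restricted field -/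

section Basin

variable {M H : Type*} [TopologicalSpace M] [NormedAddCommGroup H] [NormedSpace ℝ H]
  {e F : M → H} {D : M → Set ℝ} {φ : M → ℝ → M} {A S : Set M}

theorem IsFlowStable.subset_attractedTo (hA : IsFlowStable D φ A) : A ⊆ attractedTo D φ A := by
  obtain ⟨V, -, hAV, hV⟩ := hA univ isOpen_univ (subset_univ A)
  exact fun x hx => ⟨(hV x (hAV hx)).1, (hV x (hAV hx)).2.2⟩

theorem IsFlowStable.subset_forward_mem (hA : IsFlowStable D φ A) (hS : IsOpen S) (hAS : A ⊆ S) :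
    A ⊆ {x ∈ attractedTo D φ A | ∀ t, 0 ≤ t → φ x t ∈ S} := by
  obtain ⟨V, -, hAV, hV⟩ := hA S hS hAS
  exact fun x hx => ⟨hA.subset_attractedTo hx, (hV x (hAV hx)).2.1⟩

/-- Stability controls nearby orbits after some time `T`; compactness of `[0, T]` controls them
before. -/
theorem IsUniversalFlow.isOpen_forward_mem [CompleteSpace H] [LocallyCompactSpace M] [T2Space M]
    (hφ : IsUniversalFlow e F D φ) (he : IsEmbedding e) (hF : Continuous F)
    (hA : IsFlowStable D φ A) (hS : IsOpen S) (hAS : A ⊆ S) :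
    IsOpen {x ∈ attractedTo D φ A | ∀ t, 0 ≤ t → φ x t ∈ S} := by
  refine isOpen_iff_mem_nhds.2 fun x₀ hx₀ => ?_
  obtain ⟨T, -, hT⟩ := hφ.eventually_forward_mem he hF hA hx₀.1 hS hAS
  have h : ∀ᶠ x in 𝓝 x₀, ∀ t ∈ Icc 0 T, φ x (max t 0) ∈ S := by
    refine isCompact_Icc.eventually_forall_of_forall_eventually fun t ht => ?_
    have hc := (hφ.continuousOn_attractedTo he hF (A := A)).continuousAt (x := (x₀, t))
      (((hφ.isOpen_attractedTo he hF hA).prod isOpen_univ).mem_nhds ⟨hx₀.1, mem_univ t⟩)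
    refine hc.eventually (hS.mem_nhds ?_)
    exact hx₀.2 _ (le_max_right _ _)
  filter_upwards [hT, h] with x hx hx'
  refine ⟨hx.1, fun t ht => ?_⟩
  rcases le_total T t with hTt | hTt
  · exact hx.2 t hTt
  · rw [← max_eq_left ht]
    exact hx' t ⟨ht, hTt⟩

end Basin

/-! ### The theorem -/

theorem theorem1 {n : ℕ} {M : Type*} [TopologicalSpace M] [T2Space M] [SecondCountableTopology M]
    [ChartedSpace (EuclideanSpace ℝ (Fin n)) M] [IsManifold (𝓡 n) ∞ M]
    (X Y : (x : M) → TangentSpace (𝓡 n) x)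
    (hX : IsC0VectorField X) (hY : IsC0VectorField Y)
    (hXu : UniquelyIntegrable X) (hYu : UniquelyIntegrable Y)
    (A : Set M) (hXA : IsAsymptoticallyStable X A) (hYA : IsAsymptoticallyStable Y A) :
    ∃ U : Set M, IsOpen U ∧ A ⊆ U ∧
      HomotopicThroughNonvanishing X Y (U \ A) ∧
      U = basin X (basin Y univ A) A ∧
      IsGreatest {S : Set M | S ⊆ basin X univ A ∩ basin Y univ A ∧
        ForwardOrbitsIn X S (basin Y univ A)} U := by
  have : LocallyCompactSpace M := Manifold.locallyCompact_of_finiteDimensional (𝓡 n)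
  obtain ⟨ι, f, -⟩ := SmoothBumpCovering.exists_isSubordinate (𝓡 n) (isClosed_univ (X := M))
    (U := fun _ => univ) fun _ _ => univ_mem
  set e := f.hilbertEmbedding
  have he : IsChartEmbedding n e := f.isChartEmbedding_hilbertEmbedding
  obtain ⟨DX, φX, hφX⟩ := hXu.exists_isUniversalFlow he
  obtain ⟨DY, φY, hφY⟩ := hYu.exists_isUniversalFlow he
  have hFX := he.continuous_ambientField hX
  have hFY := he.continuous_ambientField hY
  have hXs := hφX.isFlowStable he hXA
  have hYs := hφY.isFlowStable he hYA
  have hBY : IsOpen (attractedTo DY φY A) := hφY.isOpen_attractedTo he.isEmbedding hFY hYs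
  have hABY : A ⊆ attractedTo DY φY A := hYs.subset_attractedTo
  rw [hφX.basin_univ he, hφY.basin_univ he, hφX.basin_eq he hBY]
  refine ⟨_, hφX.isOpen_forward_mem he.isEmbedding hFX hXs hBY hABY,
    hXs.subset_forward_mem hBY hABY, ?_, rfl, ⟨fun x hx => ⟨hx.1, ?_⟩, ?_⟩, ?_⟩
  · obtain ⟨J, hJc, hJr, hJ⟩ := he.exists_continuous_retraction
    obtain ⟨G, hGc, hG0, hG1, hG⟩ := exists_ambient_homotopy hφX hφY he.isEmbedding hFX hFY hXs hYs
      hXA.isCompact.isClosed hJc (fun x => hJ x _) (fun x => hJ x _)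
      (fun x₀ ε hε => he.exists_nhds_norm_sub_le hJc hJ x₀ hε)
      (U := {x ∈ attractedTo DX φX A | ∀ t, 0 ≤ t → φX x t ∈ attractedTo DY φY A})
      (fun x hx => hx.1) (fun x hx => hx.2)
    -- The ambient homotopy takes values in the range of `J x`, hence in the image of the tangent
    -- space, and is pulled back by the injective derivative of `e`.
    let K : ℝ → (x : M) → TangentSpace (𝓡 n) x := fun t x =>
      Function.invFun (ambientDeriv n e x) (G t x)
    have hK : ∀ t ∈ Icc (0 : ℝ) 1, ∀ x ∈ {x ∈ attractedTo DX φX A |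
        ∀ t, 0 ≤ t → φX x t ∈ attractedTo DY φY A} \ A, ambientDeriv n e x (K t x) = G t x := by
      intro t ht x hx
      obtain ⟨w, hw⟩ := (hG t ht x hx).2
      obtain ⟨v, hv⟩ := hJr x w
      exact Function.invFun_eq ⟨v, hv.trans hw⟩
    refine ⟨K, ?_, fun x hx => ?_, fun x hx => ?_, fun t ht x hx h0 => ?_⟩
    · intro p hp
      refine he.tendsto_totalSpace_iff.2 ⟨continuous_snd.continuousWithinAt, ?_⟩
      rw [hK _ hp.1 _ hp.2]
      refine (hGc p hp).congr' ?_
      filter_upwards [self_mem_nhdsWithin] with q hq using (hK _ hq.1 _ hq.2).symm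
    · refine he.injective_ambientDeriv x ?_
      rw [hK 0 (left_mem_Icc.2 zero_le_one) x hx, hG0 x hx, ambientField]
    · refine he.injective_ambientDeriv x ?_
      rw [hK 1 (right_mem_Icc.2 zero_le_one) x hx, hG1 x hx, ambientField]
    · refine (hG t ht x hx).1 ?_
      rw [← hK t ht x hx, h0, map_zero]
  · rw [← (hφX.isSol x).start]
    exact hx.2 0 le_rfl
  · intro x hx J γ h t ht ht0
    rw [(hφX.eq_of_isMaximalIntegralCurveFrom he h).2 ht]
    exact hx.2 t ht0
  · rintro S ⟨hS, hSf⟩ x hx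
    exact ⟨(hS hx).1, fun t ht => hSf x hx _ _ (hφX.isMaximalIntegralCurveFrom he x) t
      ((hS hx).1.1 ht) ht⟩
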